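/- **Setting.** Let $k\ge 1$ and let $\Lambda$ be a $k$-graph, i.e. a countable small category with a degree functor $d:\Lambda\to\mathbb N^k$ having the factorisation property: whenever $d(\lambda)=m+n$ there are unique $\mu,\nu\in\Lambda$ with $d(\mu)=m$, $d(\nu)=n$ and $\lambda=\mu\nu$. Write $r,s$ for range and source, $\Lambda^n=d^{-1}(n)$, $e_1,\dots,e_k$ for the generators of $\mathbb N^k$, and $v\Lambda=\{\lambda: r(\lambda)=v\}$ for a vertex $v\in\Lambda^0$. For a finite nonempty $G\subseteq\Lambda$ let $\mathrm{MCE}(G)=\{\lambda\in\bigcap_{\nu\in G}\nu\Lambda : d(\lambda)=\bigvee_{\nu\in G}d(\nu)\}$, and let $\Lambda^{\min}(\mu,\nu)=\{(\alpha,\beta):\mu\alpha=\nu\beta\in\mathrm{MCE}(\{\mu,\nu\})\}$. Assume that $\Lambda$ is finitely aligned (every $\Lambda^{\min}(\mu,\nu)$ is finite) and locally convex (if $\lambda\in\Lambda^{e_i}$, $\mu\in\Lambda^{e_j}$, $i\ne j$ and $r(\lambda)=r(\mu)$, then $s(\lambda)\Lambda^{e_j}\neq\emptyset$ and $s(\mu)\Lambda^{e_i}\ne\emptyset$).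 For a higher-rank graph $\Gamma$, $\mathrm{FE}(\Gamma)$ is the set of finite sets $E\subseteq v\Gamma\setminus\{v\}$ ($v\in\Gamma^0$) such that for every $\mu\in v\Gamma$ some $\nu\in E$ has $\Gamma^{\min}(\mu,\nu)\neq\emptyset$; then $r(E):=v$. A Cuntz–Krieger $\Gamma$-family in a C*-algebra is a family $(q_\lambda)_{\lambda\in\Gamma}$ such that the $q_v$, $v\in\Gamma^0$, are mutually orthogonal projections, $q_\mu q_\nu=q_{\mu\nu}$ whenever $s(\mu)=r(\nu)$, $q_\mu^*q_\nu=\sum_{(\alpha,\beta)\in\Gamma^{\min}(\mu,\nu)}q_\alpha q_\beta^*$, and $\Delta(q)^E:=\prod_{\lambda\in E}(q_{r(E)}-q_\lambda q_\lambda^*)=0$ for all $E\in\mathrm{FE}(\Gamma)$. $C^*(\Gamma)$ denotes the C*-algebra generated by a universal Cuntz–Krieger family $(s^\Gamma_\lambda)_{\lambda\in\Gamma}$. The product $\Delta(s^\Gamma)^E$ is defined in the same way for every finite nonempty $E\subseteq v\Gamma$. Fix $i\in\{1,\dots,k\}$ and let $\Lambda^i=\{\lambda\in\Lambda:d(\lambda)_i=0\}$,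 a $(k-1)$-graph. Let $\phi:C^*(\Lambda^i)\to C^*(\Lambda)$ be the (injective) $*$-homomorphism with $\phi(s^{\Lambda^i}_\lambda)=s^\Lambda_\lambda$, and let $X=\overline{\mathrm{span}}\{s^\Lambda_\lambda {s^{\Lambda}_\mu}^*:d(\lambda)_i=1,\ d(\mu)_i=0\}\subseteq C^*(\Lambda)$, a Hilbert $C^*(\Lambda^i)$-bimodule with $a\cdot x\cdot b=\phi(a)x\phi(b)$ and $\langle x,y\rangle=\phi^{-1}(x^*y)$. Let $\psi(a)x=a\cdot x$ be the left action, let $\Theta_{x,y}(z)=x\cdot\langle y,z\rangle$, let $\mathcal K(X)=\overline{\mathrm{span}}\{\Theta_{x,y}:x,y\in X\}$, and let $J_X=\psi^{-1}(\mathcal K(X))\cap\ker(\psi)^\perp$ be the Katsura ideal, where $\ker(\psi)^\perp=\{a: ab=0 \text{ for all } b\in\ker\psi\}$. Put $H_{J_X}=\{v\in\Lambda^0:s_v^{\Lambda^i}\in J_X\}$ and let $\Lambda^i\setminus\Lambda^iH_{J_X}$ be the graph of all $\lambda\in\Lambda^i$ with $s(\lambda)\notin H_{J_X}$. **Lemma.**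 Let $E\in\mathrm{FE}(\Lambda^i\setminus\Lambda^iH_{J_X})$ with $E\subseteq\bigcup_{j=1}^k\Lambda^{e_j}$. Then $\Delta(s^{\Lambda^i})^E\in J_X$ if and only if there is a finite set $F\subseteq r(E)\Lambda^{e_i}$ with $E\cup F\in\mathrm{FE}(\Lambda)$. Moreover, for every $F\subseteq r(E)\Lambda^{e_i}$ with $E\cup F\in\mathrm{FE}(\Lambda)$, $$\psi\big(\Delta(s^{\Lambda^i})^E\big)=\sum_{\substack{G\subseteq E\cup F\\ G\cap F\ne\emptyset}}\ \sum_{\mu\in\mathrm{MCE}(G)}(-1)^{|G|+1}\,\Theta_{s^\Lambda_\mu,s^\Lambda_\mu}\in\mathcal K(X).$$ -/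

import Mathlib

open CategoryTheory
open scoped ENNReal

universe u

/-- A higher-rank graph whose set of colours is `ι` (a `k`-graph is the case `ι = Fin k`):
a countable small category with a degree functor to `ℕ^ι` that has the factorisation property.
A morphism `f : v ⟶ w` is a path with source `v` and range `w`, so that the path written `μν`
(`μ` after `ν`) is `ν ≫ μ` in Mathlib's order of composition. -/
structure HigherRankGraph (ι : Type) where
  /-- the vertices -/
  Obj : Type u
  [cat : SmallCategory Obj]
  countable_paths : Countable (Σ v w : Obj, v ⟶ w)
  /-- the degree functor -/
  degree : ∀ {v w : Obj}, (v ⟶ w) → ι → ℕ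
  degree_id : ∀ v : Obj, degree (𝟙 v) = 0
  degree_comp : ∀ {u v w : Obj} (g : u ⟶ v) (f : v ⟶ w), degree (g ≫ f) = degree f + degree g
  factorisation : ∀ {u w : Obj} (f : u ⟶ w) (m n : ι → ℕ), degree f = m + n →
    ∃! p : Σ v : Obj, (v ⟶ w) × (u ⟶ v),
      degree p.2.1 = m ∧ degree p.2.2 = n ∧ p.2.2 ≫ p.2.1 = f

attribute [instance] HigherRankGraph.cat

namespace HigherRankGraph

variable {ι : Type} (Λ : HigherRankGraph.{u} ι)

/-- A path of `Λ`: a morphism together with its source and its range. -/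
@[ext]
structure Path where
  src : Λ.Obj
  rng : Λ.Obj
  hom : src ⟶ rng

variable {Λ}

/-- The degree `d(μ)`. -/
def Path.d (μ : Λ.Path) : ι → ℕ := Λ.degree μ.hom

/-- The path `μν`, defined when `s(μ) = r(ν)`. -/
def Path.comp : (μ ν : Λ.Path) → μ.src = ν.rng → Λ.Path
  | ⟨_, w, f⟩, ⟨u, _, g⟩, rfl => ⟨u, w, g ≫ f⟩

variable (Λ) in
/-- A vertex, regarded as a path of degree zero. -/
def vertex (v : Λ.Obj) : Λ.Path := ⟨v, v, 𝟙 v⟩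

/-- `μ.IsPrefix lam` says that `lam` belongs to `μΛ`. -/
def Path.IsPrefix (μ lam : Λ.Path) : Prop := ∃ (α : Λ.Path) (h : μ.src = α.rng), μ.comp α h = lam

/-- `Λ^min(μ, ν)`: the pairs `(α, β)` with `μα = νβ` of degree `d(μ) ∨ d(ν)`. -/
def minExt (μ ν : Λ.Path) : Set (Λ.Path × Λ.Path) :=
  {p | ∃ (h₁ : μ.src = p.1.rng) (h₂ : ν.src = p.2.rng),
    μ.comp p.1 h₁ = ν.comp p.2 h₂ ∧ (μ.comp p.1 h₁).d = μ.d ⊔ ν.d}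

/-- `MCE(G)`: the minimal common extensions of a finite nonempty set `G` of paths. -/
def mce (G : Finset Λ.Path) : Set Λ.Path :=
  {lam | (∀ ν ∈ G, ν.IsPrefix lam) ∧ lam.d = G.sup Path.d}

variable (Λ) in
/-- `Λ` is finitely aligned. -/
def FinitelyAligned : Prop := ∀ μ ν : Λ.Path, (minExt μ ν).Finite

variable (Λ) in
/-- `Λ` is locally convex. -/
def LocallyConvex [DecidableEq ι] : Prop :=
  ∀ (i j : ι), i ≠ j → ∀ lam μ : Λ.Path, lam.d = Pi.single i 1 → μ.d = Pi.single j 1 →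
    lam.rng = μ.rng →
    (∃ α : Λ.Path, α.rng = lam.src ∧ α.d = Pi.single j 1) ∧
    (∃ β : Λ.Path, β.rng = μ.src ∧ β.d = Pi.single i 1)

/-- `E ∈ v FE(Γ)`, where `Γ` is the subgraph of `Λ` with set of paths `P`: the vertex `v` belongs
to `Γ`, and `E` is a finite subset of `vΓ \ {v}` that is exhaustive in `Γ`. -/
def IsFEIn (P : Set Λ.Path) (v : Λ.Obj) (E : Finset Λ.Path) : Prop :=
  Λ.vertex v ∈ P ∧
  (∀ lam ∈ E, lam ∈ P ∧ lam.rng = v ∧ lam ≠ Λ.vertex v) ∧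
  ∀ μ ∈ P, μ.rng = v → ∃ ν ∈ E, ∃ p ∈ minExt μ ν, p.1 ∈ P ∧ p.2 ∈ P

/-- `E ∈ v FE(Λ)`. -/
def IsFE (v : Λ.Obj) (E : Finset Λ.Path) : Prop := IsFEIn Set.univ v E

/-! ### Basic facts on paths -/

@[simp] lemma Path.comp_src (μ ν : Λ.Path) (h : μ.src = ν.rng) : (μ.comp ν h).src = ν.src := by
  obtain ⟨_, _, f⟩ := μ; obtain ⟨_, _, g⟩ := ν; cases h; rfl

@[simp] lemma Path.comp_rng (μ ν : Λ.Path) (h : μ.src = ν.rng) : (μ.comp ν h).rng = μ.rng := by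
  obtain ⟨_, _, f⟩ := μ; obtain ⟨_, _, g⟩ := ν; cases h; rfl

lemma Path.comp_d (μ ν : Λ.Path) (h : μ.src = ν.rng) : (μ.comp ν h).d = μ.d + ν.d := by
  obtain ⟨_, _, f⟩ := μ; obtain ⟨_, _, g⟩ := ν; cases h; exact Λ.degree_comp g f

@[simp] lemma vertex_d (v : Λ.Obj) : (Λ.vertex v).d = 0 := Λ.degree_id v

@[simp] lemma vertex_src (v : Λ.Obj) : (Λ.vertex v).src = v := rfl

@[simp] lemma vertex_rng (v : Λ.Obj) : (Λ.vertex v).rng = v := rfl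

lemma Path.comp_vertex (μ : Λ.Path) (v : Λ.Obj) (h : μ.src = (Λ.vertex v).rng) :
    μ.comp (Λ.vertex v) h = μ := by
  obtain ⟨_, _, f⟩ := μ
  cases h
  simp [Path.comp, vertex]

lemma Path.vertex_comp (μ : Λ.Path) (v : Λ.Obj) (h : (Λ.vertex v).src = μ.rng) :
    (Λ.vertex v).comp μ h = μ := by
  obtain ⟨_, _, f⟩ := μ
  cases h
  simp [Path.comp, vertex]

lemma Path.comp_assoc (lam μ ν : Λ.Path) (h₁ : lam.src = μ.rng) (h₂ : μ.src = ν.rng)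
    (h₃ : (lam.comp μ h₁).src = ν.rng) (h₄ : lam.src = (μ.comp ν h₂).rng) :
    (lam.comp μ h₁).comp ν h₃ = lam.comp (μ.comp ν h₂) h₄ := by
  obtain ⟨_, _, f⟩ := lam; obtain ⟨_, _, g⟩ := μ; obtain ⟨_, _, k⟩ := ν
  dsimp at h₁ h₂; subst h₁; subst h₂
  simp [Path.comp]

lemma Path.exists_factor (lam : Λ.Path) (m n : ι → ℕ) (h : lam.d = m + n) :
    ∃ (μ ν : Λ.Path) (hc : μ.src = ν.rng), μ.comp ν hc = lam ∧ μ.d = m ∧ ν.d = n := by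
  obtain ⟨u, w, f⟩ := lam
  obtain ⟨⟨v, a, b⟩, ⟨h₁, h₂, h₃⟩, -⟩ := Λ.factorisation f m n h
  refine ⟨⟨v, w, a⟩, ⟨u, v, b⟩, rfl, ?_, h₁, h₂⟩
  dsimp at h₃; simp [Path.comp, h₃]

lemma Path.comp_inj {μ ν μ' ν' : Λ.Path} (h : μ.src = ν.rng) (h' : μ'.src = ν'.rng)
    (e : μ.comp ν h = μ'.comp ν' h') (hd : μ.d = μ'.d) : μ = μ' ∧ ν = ν' := by
  have hd' : ν.d = ν'.d := by
    have := congrArg Path.d e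
    rw [Path.comp_d, Path.comp_d, hd] at this
    exact add_left_cancel this
  obtain ⟨v, w, f⟩ := μ; obtain ⟨u, _, g⟩ := ν
  obtain ⟨v', w', f'⟩ := μ'; obtain ⟨u', _, g'⟩ := ν'
  dsimp at h h'; subst h; subst h'
  simp only [Path.comp, Path.mk.injEq] at e
  obtain ⟨rfl, rfl, e⟩ := e
  rw [heq_eq_eq] at e
  have key := (Λ.factorisation (g ≫ f) (Λ.degree f) (Λ.degree g) (Λ.degree_comp g f)).unique
    (y₁ := ⟨v, f, g⟩) (y₂ := ⟨v', f', g'⟩) ⟨rfl, rfl, rfl⟩ ⟨hd.symm, hd'.symm, e.symm⟩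
  simp only [Sigma.mk.injEq] at key
  obtain ⟨rfl, key⟩ := key
  rw [heq_eq_eq, Prod.mk.injEq] at key
  obtain ⟨rfl, rfl⟩ := key
  exact ⟨rfl, rfl⟩

lemma Path.eq_vertex_of_d_eq_zero (μ : Λ.Path) (h : μ.d = 0) : μ = Λ.vertex μ.rng := by
  have h1 := Path.vertex_comp μ μ.rng rfl
  have h2 := Path.comp_vertex μ μ.src rfl
  exact (Path.comp_inj _ _ (h2.trans h1.symm) (by simp [h])).1

/-! ### Deleting a colour -/

variable (Λ) in
/-- The graph `Λ^i` of all paths `lam` of `Λ` with `d(lam)_i = 0`. It has the vertices of `Λ`, and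
its degrees are those of `Λ` with the `i`-th coordinate omitted. -/
def deleteColour (i : ι) : HigherRankGraph.{u} {j : ι // j ≠ i} where
  Obj := Λ.Obj
  cat :=
    { Hom := fun v w => {f : v ⟶ w // Λ.degree f i = 0}
      id := fun v => ⟨𝟙 v, by simp [Λ.degree_id]⟩
      comp := fun g f => ⟨g.1 ≫ f.1, by simp [Λ.degree_comp, g.2, f.2]⟩
      id_comp := fun f => Subtype.ext (Category.id_comp f.1)
      comp_id := fun f => Subtype.ext (Category.comp_id f.1)
      assoc := fun f g h => Subtype.ext (Category.assoc f.1 g.1 h.1) }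
  countable_paths := by
    have := Λ.countable_paths
    refine Function.Injective.countable
      (f := fun p : (Σ v w : Λ.Obj, {f : v ⟶ w // Λ.degree f i = 0}) =>
        (⟨p.1, p.2.1, p.2.2.1⟩ : Σ v w : Λ.Obj, v ⟶ w)) ?_
    rintro ⟨v, w, f, hf⟩ ⟨v', w', f', hf'⟩ h
    simp only [Sigma.mk.injEq] at h
    obtain ⟨rfl, h⟩ := h
    rw [heq_eq_eq, Sigma.mk.injEq] at h
    obtain ⟨rfl, h⟩ := h
    rw [heq_eq_eq] at h
    subst h
    rfl
  degree := fun f j => Λ.degree f.1 j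
  degree_id := fun v => by
    funext j
    exact congrFun (Λ.degree_id v) j
  degree_comp := fun g f => by
    funext j
    exact congrFun (Λ.degree_comp g.1 f.1) j
  factorisation := by
    classical
    intro u w f m n h
    have hex : ∀ m : {j : ι // j ≠ i} → ℕ, ∃ m' : ι → ℕ, m' i = 0 ∧ ∀ j : {j : ι // j ≠ i},
        m' j = m j := fun m =>
      ⟨fun j => if hj : j = i then 0 else m ⟨j, hj⟩, by simp, fun j => by simp [j.2]⟩
    obtain ⟨m', hm0, hm⟩ := hex m
    obtain ⟨n', hn0, hn⟩ := hex n
    have hf : Λ.degree f.1 = m' + n' := by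
      funext j
      by_cases hj : j = i
      · subst hj
        simp [hm0, hn0, f.2]
      · have := congrFun h ⟨j, hj⟩
        simpa [← hm, ← hn] using this
    obtain ⟨⟨v, a, b⟩, ⟨h₁, h₂, h₃⟩, huniq⟩ := Λ.factorisation f.1 m' n' hf
    dsimp only at h₁ h₂ h₃
    refine ⟨⟨v, ⟨a, by rw [h₁, hm0]⟩, ⟨b, by rw [h₂, hn0]⟩⟩, ⟨?_, ?_, Subtype.ext h₃⟩, ?_⟩
    · funext j
      simp [h₁, hm]
    · funext j
      simp [h₂, hn]
    · rintro ⟨v', a', b'⟩ ⟨h₁', h₂', h₃'⟩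
      have ha : Λ.degree a'.1 = m' := by
        funext j
        by_cases hj : j = i
        · subst hj
          rw [hm0, a'.2]
        · exact (congrFun h₁' ⟨j, hj⟩).trans (hm ⟨j, hj⟩).symm
      have hb : Λ.degree b'.1 = n' := by
        funext j
        by_cases hj : j = i
        · subst hj
          rw [hn0, b'.2]
        · exact (congrFun h₂' ⟨j, hj⟩).trans (hn ⟨j, hj⟩).symm
      have key := huniq ⟨v', a'.1, b'.1⟩ ⟨ha, hb, congrArg Subtype.val h₃'⟩
      obtain ⟨a', ha'⟩ := a'
      obtain ⟨b', hb'⟩ := b'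
      simp only [Sigma.mk.injEq] at key
      obtain ⟨rfl, key⟩ := key
      rw [heq_eq_eq, Prod.mk.injEq] at key
      obtain ⟨rfl, rfl⟩ := key
      rfl

/-- The inclusion of the paths of `Λ^i` into those of `Λ`. -/
def incl {i : ι} (μ : (Λ.deleteColour i).Path) : Λ.Path := ⟨μ.src, μ.rng, μ.hom.1⟩

variable {i : ι}

lemma incl_d (μ : (Λ.deleteColour i).Path) (j : {j : ι // j ≠ i}) : (incl μ).d j = μ.d j := rfl

lemma incl_d_self (μ : (Λ.deleteColour i).Path) : (incl μ).d i = 0 := μ.hom.2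

lemma incl_injective : Function.Injective (incl (Λ := Λ) (i := i)) := by
  rintro ⟨a, b, f, hf⟩ ⟨a', b', f', hf'⟩ h
  have h1 : a = a' := congrArg Path.src h
  have h2 : b = b' := congrArg Path.rng h
  subst h1; subst h2
  have h3 : f = f' := eq_of_heq (Path.mk.inj h).2.2
  subst h3
  rfl

lemma exists_incl (μ : Λ.Path) (h : μ.d i = 0) : ∃ ν : (Λ.deleteColour i).Path, incl ν = μ :=
  ⟨⟨μ.src, μ.rng, ⟨μ.hom, h⟩⟩, rfl⟩

lemma incl_comp (μ ν : (Λ.deleteColour i).Path) (h : μ.src = ν.rng) :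
    incl (μ.comp ν h) = (incl μ).comp (incl ν) h := by
  obtain ⟨a, b, f⟩ := μ; obtain ⟨c, _, g⟩ := ν
  dsimp at h
  subst h
  rfl

lemma d_eq_iff (μ : (Λ.deleteColour i).Path) (m : ι → ℕ) (hm : m i = 0) :
    (incl μ).d = m ↔ μ.d = fun j => m j.1 := by
  constructor
  · rintro rfl
    rfl
  · intro h
    funext j
    by_cases hj : j = i
    · subst hj
      rw [hm, incl_d_self]
    · exact congrFun h ⟨j, hj⟩

lemma minExt_incl (μ ν : (Λ.deleteColour i).Path) :
    minExt (incl μ) (incl ν) = Prod.map incl incl '' minExt μ ν := by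
  ext ⟨α, β⟩
  constructor
  · rintro ⟨h₁, h₂, h, hd⟩
    have hα : α.d i = 0 := by
      have := congrFun hd i
      simpa [Path.comp_d, incl_d_self] using this
    have hβ : β.d i = 0 := by
      rw [h] at hd
      have := congrFun hd i
      simpa [Path.comp_d, incl_d_self] using this
    obtain ⟨α, rfl⟩ := exists_incl α hα
    obtain ⟨β, rfl⟩ := exists_incl β hβ
    have k₁ : μ.src = α.rng := h₁
    have k₂ : ν.src = β.rng := h₂
    have e : incl (μ.comp α k₁) = incl (ν.comp β k₂) := by
      rw [incl_comp, incl_comp]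
      exact h
    have hd' : (incl (μ.comp α k₁)).d = (incl μ).d ⊔ (incl ν).d := by
      rw [incl_comp]
      exact hd
    exact ⟨(α, β), ⟨k₁, k₂, incl_injective e,
      (d_eq_iff _ _ (by simp [incl_d_self])).1 hd'⟩, rfl⟩
  · rintro ⟨⟨α', β'⟩, ⟨h₁, h₂, h, hd⟩, e⟩
    simp only [Prod.map_apply, Prod.mk.injEq] at e
    obtain ⟨rfl, rfl⟩ := e
    have e : (incl μ).comp (incl α') h₁ = (incl ν).comp (incl β') h₂ := by
      rw [← incl_comp _ _ h₁, ← incl_comp _ _ h₂]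
      exact congrArg incl h
    have hd' : ((incl μ).comp (incl α') h₁).d = (incl μ).d ⊔ (incl ν).d := by
      rw [← incl_comp _ _ h₁]
      exact (d_eq_iff _ _ (by simp [incl_d_self])).2 hd
    exact ⟨h₁, h₂, e, hd'⟩

lemma Path.IsPrefix.of_le {κ ρ lam : Λ.Path} (hκ : κ.IsPrefix lam) (hρ : ρ.IsPrefix lam)
    (hd : κ.d ≤ ρ.d) : κ.IsPrefix ρ := by
  obtain ⟨γ, hk, ek⟩ := hκ
  obtain ⟨τ, hc, hτ⟩ := hρ
  obtain ⟨κ', δ, hc', hρ', hd', -⟩ := Path.exists_factor ρ κ.d (ρ.d - κ.d)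
    (add_tsub_cancel_of_le hd).symm
  have hs : δ.src = τ.rng := by
    rw [← hc, ← hρ', Path.comp_src]
  have hs' : (κ'.comp δ hc').src = τ.rng := by
    rw [Path.comp_src]; exact hs
  have e1 : κ'.comp (δ.comp τ hs) (by rw [Path.comp_rng]; exact hc') = κ.comp γ hk := by
    rw [ek, ← hτ, ← Path.comp_assoc κ' δ τ hc' hs hs']
    subst hρ'
    rfl
  have := (Path.comp_inj _ _ e1 hd').1
  subst this
  exact ⟨δ, hc', hρ'⟩

lemma minExt_nonempty_of_prefix (μ ν lam : Λ.Path) (h₁ : μ.IsPrefix lam)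
    (h₂ : ν.IsPrefix lam) : (minExt μ ν).Nonempty := by
  have hle : μ.d ⊔ ν.d ≤ lam.d := by
    obtain ⟨α, ha, rfl⟩ := h₁
    obtain ⟨β, hb, e⟩ := h₂
    refine sup_le ?_ ?_
    · rw [Path.comp_d]; exact le_self_add
    · rw [← e, Path.comp_d]; exact le_self_add
  obtain ⟨ρ, τ, hc, hρ, hd, -⟩ := Path.exists_factor lam (μ.d ⊔ ν.d)
    (lam.d - (μ.d ⊔ ν.d)) (add_tsub_cancel_of_le hle).symm
  have hp : ρ.IsPrefix lam := ⟨τ, hc, hρ⟩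
  obtain ⟨δ, h, e1⟩ := h₁.of_le hp (by rw [hd]; exact le_sup_left)
  obtain ⟨δ', h', e2⟩ := h₂.of_le hp (by rw [hd]; exact le_sup_right)
  exact ⟨(δ, δ'), h, h', e1.trans e2.symm, by dsimp only; rw [e1, hd]⟩

/-- Equality of paths is decided classically. -/
noncomputable instance : DecidableEq Λ.Path := Classical.decEq _

/-- In a finitely aligned graph, `MCE(G)` is finite for every finite nonempty set `G` of paths. -/
lemma mce_finite (hΛ : Λ.FinitelyAligned) (G : Finset Λ.Path) (hG : G.Nonempty) :
    (mce G).Finite := by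
  classical
  induction hG using Finset.Nonempty.cons_induction with
  | singleton a =>
    refine (Set.finite_singleton a).subset fun lam hlam => ?_
    obtain ⟨α, h, e⟩ := hlam.1 a (Finset.mem_singleton_self a)
    have hd := hlam.2
    rw [Finset.sup_singleton, ← e, Path.comp_d] at hd
    have hα : α.d = 0 := by simpa using hd
    have h0 := Path.comp_inj (μ := a) (ν := α) (μ' := lam) (ν' := Λ.vertex lam.src) h
      (vertex_rng _).symm (by rw [Path.comp_vertex]; exact e)
      (by rw [← e, Path.comp_d, hα, add_zero])
    exact h0.1.symm
  | cons a s ha hs ih =>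
    refine (ih.biUnion fun κ _ => (hΛ κ a).image fun p =>
      if h : κ.src = p.1.rng then κ.comp p.1 h else κ).subset fun lam hlam => ?_
    have hd : lam.d = a.d ⊔ s.sup Path.d := by
      rw [hlam.2, Finset.sup_cons]
    have hle : s.sup Path.d ≤ lam.d := by rw [hd]; exact le_sup_right
    obtain ⟨κ, τ, hc, hκ, hκd, -⟩ := Path.exists_factor lam (s.sup Path.d)
      (lam.d - s.sup Path.d) (add_tsub_cancel_of_le hle).symm
    have hκmem : κ ∈ mce s := by
      refine ⟨fun ν hν => ?_, hκd⟩
      exact (hlam.1 ν (Finset.mem_cons_of_mem hν)).of_le ⟨τ, hc, hκ⟩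
        (by rw [hκd]; exact Finset.le_sup (f := Path.d) hν)
    obtain ⟨β, hb, e⟩ := hlam.1 a (Finset.mem_cons_self a s)
    refine Set.mem_biUnion hκmem ⟨(τ, β), ⟨hc, hb, hκ.trans e.symm, ?_⟩, ?_⟩
    · dsimp only
      rw [hκ, hd, hκd, sup_comm]
    · simp only [hc, dif_pos, hκ]

/-- If the finite set `G` consists of paths of `Λ^i` and of at least one path of degree `e_i`, then
the minimal common extensions `μ` of `G` satisfy `d(μ)_i = 1`. -/
lemma mce_degree [DecidableEq ι] {i : ι} {E : Finset (Λ.deleteColour i).Path} {F G : Finset Λ.Path}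
    (hF : ∀ f ∈ F, f.d = Pi.single i 1) (hG : G ⊆ E.image incl ∪ F) (hGF : (G ∩ F).Nonempty)
    {μ : Λ.Path} (hμ : μ ∈ mce G) : μ.d i = 1 := by
  rw [hμ.2, Finset.sup_apply]
  refine le_antisymm (Finset.sup_le fun ν hν => ?_) ?_
  · rcases Finset.mem_union.1 (hG hν) with h | h
    · obtain ⟨κ, -, rfl⟩ := Finset.mem_image.1 h
      rw [incl_d_self]
      exact Nat.zero_le 1
    · rw [hF ν h]
      simp
  · obtain ⟨f, hf⟩ := hGF
    obtain ⟨h1, h2⟩ := Finset.mem_inter.1 hf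
    have := Finset.le_sup (f := fun ν : Λ.Path => ν.d i) h1
    rw [hF f h2] at this
    simpa using this

/-- In a locally convex graph, if `r(ν)` receives an edge of degree `e_j` and `d(ν)_j = 0`, then
`s(ν)` receives an edge of degree `e_j`. -/
lemma LocallyConvex.exists_edge [Fintype ι] [DecidableEq ι] (hΛ : Λ.LocallyConvex) (j : ι) :
    ∀ (n : ℕ) (ν : Λ.Path), ∑ l, ν.d l = n → ν.d j = 0 →
      (∃ f : Λ.Path, f.rng = ν.rng ∧ f.d = Pi.single j 1) →
      ∃ f : Λ.Path, f.rng = ν.src ∧ f.d = Pi.single j 1 := by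
  intro n
  induction n with
  | zero =>
    intro ν hn _ hf
    have h0 : ν.d = 0 := by
      funext l
      exact Finset.sum_eq_zero_iff.1 hn l (Finset.mem_univ l)
    have := Path.eq_vertex_of_d_eq_zero ν h0
    obtain ⟨f, hf1, hf2⟩ := hf
    refine ⟨f, ?_, hf2⟩
    rw [hf1]
    conv_rhs => rw [this]
    rfl
  | succ n ih =>
    intro ν hn hj hf
    obtain ⟨l, hl⟩ : ∃ l, 1 ≤ ν.d l := by
      by_contra! hcon
      have : ∑ l, ν.d l = 0 := Finset.sum_eq_zero fun l _ => by have := hcon l; omega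
      omega
    have hlj : j ≠ l := by rintro rfl; omega
    have hle : (Pi.single l 1 : ι → ℕ) ≤ ν.d := by
      intro t
      by_cases ht : t = l
      · subst ht; simpa using hl
      · simp [ht]
    obtain ⟨e, ρ, hc, he, hd, hd'⟩ := Path.exists_factor ν (Pi.single l 1)
      (ν.d - Pi.single l 1) (add_tsub_cancel_of_le hle).symm
    have hsum : ∑ t, e.d t + ∑ t, ρ.d t = n + 1 := by
      rw [← Finset.sum_add_distrib, ← hn, ← he, Path.comp_d]
      rfl
    have he1 : ∑ t, e.d t = 1 := by
      rw [hd, Finset.sum_pi_single']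
      simp
    have hρj : ρ.d j = 0 := by
      rw [hd']
      simp [hj]
    have hsrc : ν.src = ρ.src := by rw [← he, Path.comp_src]
    rw [hsrc]
    refine ih ρ (by omega) hρj ?_
    obtain ⟨f, hf1, hf2⟩ := hf
    obtain ⟨g, hg1, hg2⟩ := (hΛ j l hlj f e hf2 hd (by rw [hf1, ← he, Path.comp_rng])).2
    exact ⟨g, hg1.trans hc, hg2⟩

/-- Every path can be prolonged by a path without edges of colour `i` so that in each colour
`j ≠ i` the degree is at least `N_j`, or else no further edge of colour `j` can be added. -/
lemma exists_prolongation [Fintype ι] [DecidableEq ι] (i : ι) (N : ι → ℕ) :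
    ∀ (n : ℕ) (lam : Λ.Path), ∑ j, (N j - lam.d j) = n →
      ∃ (τ : Λ.Path) (h : lam.src = τ.rng), τ.d i = 0 ∧ ∀ j, j ≠ i →
        N j ≤ (lam.comp τ h).d j ∨ ∀ f : Λ.Path, f.rng = τ.src → f.d ≠ Pi.single j 1 := by
  intro n
  induction n with
  | zero =>
    intro lam hn
    refine ⟨Λ.vertex lam.src, (vertex_rng lam.src).symm, by simp, fun j _ => Or.inl ?_⟩
    have := Finset.sum_eq_zero_iff.1 hn j (Finset.mem_univ j)
    rw [Path.comp_vertex]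
    omega
  | succ n ih =>
    intro lam hn
    by_cases hmax : ∀ j, j ≠ i → N j ≤ lam.d j ∨ ∀ f : Λ.Path, f.rng = lam.src →
        f.d ≠ Pi.single j 1
    · refine ⟨Λ.vertex lam.src, (vertex_rng lam.src).symm, by simp, fun j hj => ?_⟩
      rw [Path.comp_vertex]
      exact hmax j hj
    · push Not at hmax
      obtain ⟨j, hj, hlt, f, hf1, hf2⟩ := hmax
      obtain ⟨m, hm⟩ : ∃ m, ∑ t, (N t - (lam.comp f hf1.symm).d t) = m := ⟨_, rfl⟩
      have hm' : m = n := by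
        have e : ∀ t, N t - lam.d t
            = (N t - (lam.comp f hf1.symm).d t) + (Pi.single j 1 : ι → ℕ) t := by
          intro t
          rw [Path.comp_d, hf2]
          by_cases ht : t = j
          · subst ht
            simp
            omega
          · simp [ht]
        have : ∑ t, (N t - lam.d t) = m + 1 := by
          rw [Finset.sum_congr rfl fun t _ => e t, Finset.sum_add_distrib, hm]
          simp
        omega
      obtain ⟨τ, hτ, hτi, h⟩ := ih (lam.comp f hf1.symm) (hm.trans hm')
      have hfτ : f.src = τ.rng := by rw [← hτ, Path.comp_src]
      refine ⟨f.comp τ hfτ, by rw [Path.comp_rng, hf1], ?_, ?_⟩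
      · rw [Path.comp_d, hf2]
        simp [hτi, hj.symm]
      · intro t ht
        rw [← Path.comp_assoc lam f τ hf1.symm hfτ hτ, Path.comp_src]
        exact h t ht

/-- In a locally convex graph `Λ`, members of `v FE(Λ^i)` are members of `v FE(Λ)`. -/
lemma IsFE.image_incl [Fintype ι] [DecidableEq ι] (hΛ : Λ.LocallyConvex)
    {i : ι} {v : Λ.Obj} {E : Finset (Λ.deleteColour i).Path}
    (hE : (Λ.deleteColour i).IsFE v E) : Λ.IsFE v (E.image incl) := by
  obtain ⟨-, hE, hex⟩ := hE
  refine ⟨Set.mem_univ _, ?_, ?_⟩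
  · intro lam hlam
    obtain ⟨μ, hμ, rfl⟩ := Finset.mem_image.1 hlam
    refine ⟨Set.mem_univ _, (hE μ hμ).2.1, fun h => (hE μ hμ).2.2 ?_⟩
    exact incl_injective (h.trans rfl)
  intro lam _ hv
  obtain ⟨τ, hτ, hτi, hmax⟩ := exists_prolongation i ((E.image incl).sup Path.d) _ lam rfl
  set κ := lam.comp τ hτ with hκ
  have hle : Function.update κ.d i 0 ≤ κ.d := by
    intro t
    by_cases ht : t = i
    · subst ht; simp
    · simp [ht]
  obtain ⟨ρ, ρ', hc, hρ, hρd, hρd'⟩ := Path.exists_factor κ (Function.update κ.d i 0)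
    (κ.d - Function.update κ.d i 0) (add_tsub_cancel_of_le hle).symm
  obtain ⟨σ, rfl⟩ := exists_incl ρ (i := i) (by simp [hρd])
  have hσv : σ.rng = v := by
    have : (incl σ).rng = κ.rng := by rw [← hρ, Path.comp_rng]
    rw [hκ, Path.comp_rng, hv] at this
    exact this
  obtain ⟨ν, hν, ⟨α, β⟩, ⟨h₁, h₂, e, hd⟩, -⟩ := hex σ (Set.mem_univ _) hσv
  dsimp only at h₁ h₂ e hd
  have hα : α.d = 0 := by
    by_contra hne
    obtain ⟨j, hj⟩ : ∃ j, α.d j ≠ 0 := by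
      by_contra! hcon
      exact hne (funext hcon)
    have hdj := congrFun hd j
    rw [Path.comp_d] at hdj
    have hlt : σ.d j < ν.d j := by
      simp only [Pi.add_apply, Pi.sup_apply] at hdj
      by_contra! hcon
      rw [max_eq_left hcon] at hdj
      omega
    have hN : ν.d j ≤ ((E.image incl).sup Path.d) j :=
      (Finset.le_sup (f := Path.d) (Finset.mem_image_of_mem incl hν)) j.1
    have hσκ : σ.d j = κ.d j := by
      rw [← incl_d, hρd]
      simp [j.2]
    rcases hmax j.1 j.2 with hm | hm
    · have : (lam.comp τ hτ).d j.1 = κ.d j.1 := rfl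
      omega
    · have hedge : ∃ f : Λ.Path, f.rng = ρ'.rng ∧ f.d = Pi.single j.1 1 := by
        have hle1 : (Pi.single j.1 1 : ι → ℕ) ≤ (incl α).d := by
          intro t
          by_cases ht : t = j.1
          · subst ht
            simp only [Pi.single_eq_same, incl_d]
            omega
          · simp [ht]
        obtain ⟨f, g, hfg, e1, hfd, -⟩ := Path.exists_factor (incl α) (Pi.single j.1 1)
          ((incl α).d - Pi.single j.1 1) (add_tsub_cancel_of_le hle1).symm
        refine ⟨f, ?_, hfd⟩
        have : f.rng = (incl α).rng := by rw [← e1, Path.comp_rng]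
        rw [this, ← hc]
        exact h₁.symm
      have hρ'j : ρ'.d j.1 = 0 := by
        rw [hρd']
        simp [j.2]
      obtain ⟨f, hf1, hf2⟩ := hΛ.exists_edge j.1 _ ρ' rfl hρ'j hedge
      refine hm f ?_ hf2
      rw [hf1]
      have : ρ'.src = κ.src := by rw [← hρ, Path.comp_src]
      rw [this, hκ, Path.comp_src]
  have hα' := Path.eq_vertex_of_d_eq_zero α hα
  have eσ : σ = ν.comp β h₂ := by
    rw [← e]
    have key : ∀ (γ : (Λ.deleteColour i).Path) (h : σ.src = γ.rng),
        γ = (Λ.deleteColour i).vertex γ.rng → σ = σ.comp γ h := by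
      intro γ h hγ
      generalize γ.rng = w at hγ
      subst hγ
      exact (Path.comp_vertex σ w h).symm
    exact key α h₁ hα'
  refine ⟨incl ν, Finset.mem_image_of_mem incl hν, ?_⟩
  have hpre : (incl ν).IsPrefix κ := by
    have h₂' : (incl ν).src = (incl β).rng := h₂
    have e1 : incl σ = (incl ν).comp (incl β) h₂' := by
      rw [← incl_comp _ _ h₂]
      exact congrArg incl eσ
    have hb : (incl β).src = ρ'.rng := by
      rw [← hc, e1, Path.comp_src]
    refine ⟨(incl β).comp ρ' hb, by rw [Path.comp_rng]; exact h₂', ?_⟩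
    rw [← Path.comp_assoc (incl ν) (incl β) ρ' h₂' hb (by rw [Path.comp_src]; exact hb), ← hρ]
    congr 1
    exact e1.symm
  obtain ⟨p, hp⟩ := minExt_nonempty_of_prefix lam (incl ν) κ ⟨τ, hτ, rfl⟩ hpre
  exact ⟨p, hp, Set.mem_univ _, Set.mem_univ _⟩

/-! ### Cuntz-Krieger families -/

section Families

variable {B : Type*} [NonUnitalCStarAlgebra B]

/-- A Toeplitz-Cuntz-Krieger `Λ`-family. If `Λ` is finitely aligned, then the sum in the last
condition is a finite sum. -/
structure IsTCKFamily (q : Λ.Path → B) : Prop where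
  isStarProjection : ∀ v : Λ.Obj, IsStarProjection (q (Λ.vertex v))
  orthogonal : ∀ v w : Λ.Obj, v ≠ w → q (Λ.vertex v) * q (Λ.vertex w) = 0
  mul_eq : ∀ (μ ν : Λ.Path) (h : μ.src = ν.rng), q μ * q ν = q (μ.comp ν h)
  star_mul_eq : ∀ μ ν : Λ.Path, star (q μ) * q ν = ∑ᶠ p ∈ minExt μ ν, q p.1 * star (q p.2)

/-- `Δ(q)^E`, the product of the projections `q_v - q_λ q_λ^*` with `λ ∈ E`, for a finite subset
`E` of `vΛ`. The factors of a Toeplitz-Cuntz-Krieger family commute, so the order in which they are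
multiplied is irrelevant; the factor `q_v` at the end gives the empty product the value `q_v`, and
is absorbed by any other factor. -/
noncomputable def gap (q : Λ.Path → B) (v : Λ.Obj) (E : Finset Λ.Path) : B :=
  (E.toList.map fun lam => q (Λ.vertex v) - q lam * star (q lam)).foldr (· * ·) (q (Λ.vertex v))

/-- A Cuntz-Krieger `Λ`-family. -/
structure IsCKFamily (q : Λ.Path → B) : Prop extends IsTCKFamily q where
  gap_eq_zero : ∀ (v : Λ.Obj) (E : Finset Λ.Path), Λ.IsFE v E → gap q v E = 0

lemma minExt_self (μ : Λ.Path) : minExt μ μ = {(Λ.vertex μ.src, Λ.vertex μ.src)} := by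
  ext ⟨α, β⟩
  constructor
  · rintro ⟨h₁, h₂, e, hd⟩
    dsimp only at h₁ h₂ e hd
    have hα : α.d = 0 := by simpa [Path.comp_d] using hd
    have hβ : β.d = 0 := by rw [e] at hd; simpa [Path.comp_d] using hd
    rw [Set.mem_singleton_iff, Path.eq_vertex_of_d_eq_zero α hα, Path.eq_vertex_of_d_eq_zero β hβ,
      ← h₁, ← h₂]
  · rintro h
    obtain ⟨rfl, rfl⟩ := Prod.mk.inj (Set.mem_singleton_iff.1 h)
    exact ⟨(vertex_rng _).symm, (vertex_rng _).symm, rfl, by simp [Path.comp_d]⟩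

lemma IsTCKFamily.star_mul_self {q : Λ.Path → B} (hq : IsTCKFamily q) (μ : Λ.Path) :
    star (q μ) * q μ = q (Λ.vertex μ.src) := by
  rw [hq.star_mul_eq, minExt_self, finsum_mem_singleton,
    (hq.isStarProjection _).isSelfAdjoint.star_eq, (hq.isStarProjection _).isIdempotentElem.eq]

lemma IsTCKFamily.vertex_mul {q : Λ.Path → B} (hq : IsTCKFamily q) (μ : Λ.Path) :
    q (Λ.vertex μ.rng) * q μ = q μ := by
  rw [hq.mul_eq _ _ (vertex_src _), Path.vertex_comp]

lemma IsTCKFamily.mul_vertex {q : Λ.Path → B} (hq : IsTCKFamily q) (μ : Λ.Path) :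
    q μ * q (Λ.vertex μ.src) = q μ := by
  rw [hq.mul_eq _ _ (vertex_rng _).symm, Path.comp_vertex]

lemma IsTCKFamily.mul_eq_zero {q : Λ.Path → B} (hq : IsTCKFamily q) (μ ν : Λ.Path)
    (h : μ.src ≠ ν.rng) : q μ * q ν = 0 := by
  rw [← hq.mul_vertex μ, ← hq.vertex_mul ν, mul_assoc, ← mul_assoc (q (Λ.vertex μ.src)),
    hq.orthogonal _ _ h, zero_mul, mul_zero]

lemma IsTCKFamily.norm_le_one {q : Λ.Path → B} (hq : IsTCKFamily q) (μ : Λ.Path) :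
    ‖q μ‖ ≤ 1 := by
  have hp : ∀ v, ‖q (Λ.vertex v)‖ ≤ 1 := by
    intro v
    have h := CStarRing.norm_star_mul_self (x := q (Λ.vertex v))
    rw [(hq.isStarProjection v).isSelfAdjoint.star_eq,
      (hq.isStarProjection v).isIdempotentElem.eq] at h
    by_contra! hcon
    nlinarith [norm_nonneg (q (Λ.vertex v))]
  have h := CStarRing.norm_star_mul_self (x := q μ)
  rw [hq.star_mul_self] at h
  have := hp μ.src
  nlinarith [norm_nonneg (q μ)]

/-- The range projections of a Toeplitz-Cuntz-Krieger family commute. -/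
lemma IsTCKFamily.commute {q : Λ.Path → B} (hΛ : Λ.FinitelyAligned) (hq : IsTCKFamily q)
    (μ ν : Λ.Path) : Commute (q μ * star (q μ)) (q ν * star (q ν)) := by
  have hself : IsSelfAdjoint ((q μ * star (q μ)) * (q ν * star (q ν))) := by
    have e : (q μ * star (q μ)) * (q ν * star (q ν))
        = ∑ p ∈ (hΛ μ ν).toFinset, (q μ * q p.1) * star (q ν * q p.2) := by
      rw [show (q μ * star (q μ)) * (q ν * star (q ν)) = q μ * (star (q μ) * q ν) * star (q ν) by
        simp only [mul_assoc], hq.star_mul_eq, finsum_mem_eq_finite_toFinset_sum _ (hΛ μ ν),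
        Finset.mul_sum, Finset.sum_mul]
      exact Finset.sum_congr rfl fun p _ => by simp only [star_mul, mul_assoc]
    rw [e]
    refine isSelfAdjoint_sum _ fun p hp => ?_
    obtain ⟨h₁, h₂, h, -⟩ := (hΛ μ ν).mem_toFinset.1 hp
    rw [hq.mul_eq _ _ h₁, hq.mul_eq _ _ h₂, h]
    exact IsSelfAdjoint.mul_star_self _
  have := hself.star_eq
  simp only [star_mul, star_star] at this
  exact this.symm

/-- For a Toeplitz-Cuntz-Krieger family, `Δ(q)^E` may be computed with any enumeration of `E`. -/
lemma IsTCKFamily.gap_eq {q : Λ.Path → B} (hΛ : Λ.FinitelyAligned) (hq : IsTCKFamily q)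
    (v : Λ.Obj) (E : Finset Λ.Path) (l : List Λ.Path) (hl : l.Perm E.toList) :
    gap q v E =
      (l.map fun lam => q (Λ.vertex v) - q lam * star (q lam)).foldr (· * ·) (q (Λ.vertex v)) := by
  rw [gap]
  refine (List.Perm.foldr_eq' (hl.map _) ?_ _).symm
  have hv : q (Λ.vertex v) = q (Λ.vertex v) * star (q (Λ.vertex v)) := by
    rw [(hq.isStarProjection _).isSelfAdjoint.star_eq, (hq.isStarProjection _).isIdempotentElem.eq]
  intro x hx y hy z
  obtain ⟨μ, -, rfl⟩ := List.mem_map.1 hx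
  obtain ⟨ν, -, rfl⟩ := List.mem_map.1 hy
  have hc : Commute (q (Λ.vertex v) - q μ * star (q μ)) (q (Λ.vertex v) - q ν * star (q ν)) := by
    rw [hv]
    exact ((hq.commute hΛ _ _).sub_right (hq.commute hΛ _ _)).sub_left
      ((hq.commute hΛ _ _).sub_right (hq.commute hΛ _ _))
  rw [← mul_assoc, ← mul_assoc, hc.eq]

lemma map_gap {C : Type*} [NonUnitalCStarAlgebra C] (π : B →⋆ₙₐ[ℂ] C) (q : Λ.Path → B)
    (v : Λ.Obj) (E : Finset Λ.Path) : π (gap q v E) = gap (fun lam => π (q lam)) v E := by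
  rw [gap, gap]
  induction E.toList with
  | nil => simp
  | cons a l ih => simp [ih, map_star]

/-- The restriction of a Cuntz-Krieger `Λ`-family to `Λ^i`. -/
lemma IsCKFamily.restrict [Fintype ι] [DecidableEq ι] (hfa : Λ.FinitelyAligned)
    (hlc : Λ.LocallyConvex) {i : ι} {q : Λ.Path → B} (hq : IsCKFamily q) :
    IsCKFamily (fun μ : (Λ.deleteColour i).Path => q (incl μ)) where
  isStarProjection v := hq.isStarProjection v
  orthogonal v w h := hq.orthogonal v w h
  mul_eq μ ν h := by
    rw [incl_comp]
    exact hq.mul_eq _ _ _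
  star_mul_eq μ ν := by
    rw [hq.star_mul_eq, minExt_incl, finsum_mem_image]
    · rfl
    · exact (incl_injective.prodMap incl_injective).injOn
  gap_eq_zero v E hE := by
    have h := hq.gap_eq_zero v _ (hE.image_incl hlc)
    have hl : (E.toList.map incl).Perm (E.image incl).toList := by
      refine (List.perm_ext_iff_of_nodup (E.nodup_toList.map incl_injective)
        (Finset.nodup_toList _)).2 fun a => ?_
      simp
    rw [hq.toIsTCKFamily.gap_eq hfa v _ _ hl, List.map_map] at h
    exact h

end Families

/-! ### The Cuntz-Krieger algebra -/

variable (Λ) in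
/-- A Cuntz-Krieger `Λ`-family in some C*-algebra. -/
structure CKRep where
  alg : Type u
  [inst : NonUnitalCStarAlgebra alg]
  fam : Λ.Path → alg
  isCKFamily : IsCKFamily fam

attribute [instance] CKRep.inst

variable (Λ) in
/-- The `ℓ^∞`-product of the C*-algebras of all Cuntz-Krieger `Λ`-families. -/
abbrev BigProduct : Type (u + 1) := lp (fun ρ : Λ.CKRep => ρ.alg) ∞

/-- The element of the product formed by the `lam`-th members of all Cuntz-Krieger families. -/
noncomputable def bigGen (lam : Λ.Path) : Λ.BigProduct :=
  ⟨fun ρ => ρ.fam lam, memℓp_infty ⟨1, by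
    rintro _ ⟨ρ, rfl⟩
    exact ρ.isCKFamily.norm_le_one lam⟩⟩

variable (Λ) in
/-- The closed *-subalgebra of the product generated by the elements `bigGen lam`. -/
noncomputable def ckSubalgebra : NonUnitalStarSubalgebra ℂ Λ.BigProduct :=
  (NonUnitalStarAlgebra.adjoin ℂ (Set.range (bigGen (Λ := Λ)))).topologicalClosure

variable (Λ) in
/-- The Cuntz-Krieger algebra `C*(Λ)`, the universal C*-algebra of Cuntz-Krieger `Λ`-families: it is
generated by the family which collects all Cuntz-Krieger `Λ`-families. Because `Λ` is countable, a
Cuntz-Krieger family generates a separable C*-algebra, and this has an isomorphic copy in every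
universe; so families in C*-algebras of the universe of `Λ` suffice. -/
def CKAlgebra : Type (u + 1) := Λ.ckSubalgebra

instance : IsClosed (Λ.ckSubalgebra : Set Λ.BigProduct) :=
  NonUnitalStarSubalgebra.isClosed_topologicalClosure _

noncomputable instance : NonUnitalCStarAlgebra Λ.CKAlgebra :=
  NonUnitalStarSubalgebra.nonUnitalCStarAlgebra Λ.ckSubalgebra

/-- The inclusion of `C*(Λ)` into the product. -/
noncomputable def CKAlgebra.val : Λ.CKAlgebra →⋆ₙₐ[ℂ] Λ.BigProduct where
  toFun := Subtype.val
  map_smul' _ _ := rfl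
  map_zero' := rfl
  map_add' _ _ := rfl
  map_mul' _ _ := rfl
  map_star' _ := rfl

lemma CKAlgebra.val_mem (x : Λ.CKAlgebra) : CKAlgebra.val x ∈ Λ.ckSubalgebra := Subtype.property x

lemma CKAlgebra.isEmbedding_val : Topology.IsEmbedding (CKAlgebra.val (Λ := Λ)) :=
  Topology.IsEmbedding.subtypeVal

lemma CKAlgebra.val_injective : Function.Injective (CKAlgebra.val (Λ := Λ)) :=
  Subtype.val_injective

/-- The universal Cuntz-Krieger family `s_lam` in `C*(Λ)`. -/
noncomputable def ckGen (lam : Λ.Path) : Λ.CKAlgebra :=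
  ⟨bigGen lam, NonUnitalStarSubalgebra.le_topologicalClosure _
    (NonUnitalStarAlgebra.subset_adjoin ℂ _ ⟨lam, rfl⟩)⟩

/-- The *-homomorphism from `C*(Λ)` given by a Cuntz-Krieger family. -/
noncomputable def CKRep.lift (ρ : Λ.CKRep) : Λ.CKAlgebra →⋆ₙₐ[ℂ] ρ.alg where
  toFun x := CKAlgebra.val x ρ
  map_smul' _ _ := rfl
  map_zero' := rfl
  map_add' _ _ := rfl
  map_mul' _ _ := rfl
  map_star' _ := rfl

lemma CKRep.lift_ckGen (ρ : Λ.CKRep) (lam : Λ.Path) : ρ.lift (ckGen lam) = ρ.fam lam := rfl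

lemma ckAlgebra_ext {x y : Λ.CKAlgebra} (h : ∀ ρ : Λ.CKRep, ρ.lift x = ρ.lift y) : x = y :=
  CKAlgebra.val_injective (lp.ext (funext h))

lemma isCKFamily_ckGen (hΛ : Λ.FinitelyAligned) : IsCKFamily (ckGen (Λ := Λ)) where
  isStarProjection v :=
    { isIdempotentElem := ckAlgebra_ext fun ρ =>
        (ρ.isCKFamily.isStarProjection v).isIdempotentElem.eq
      isSelfAdjoint := ckAlgebra_ext fun ρ =>
        (ρ.isCKFamily.isStarProjection v).isSelfAdjoint.star_eq }
  orthogonal v w h := ckAlgebra_ext fun ρ => ρ.isCKFamily.orthogonal v w h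
  mul_eq μ ν h := ckAlgebra_ext fun ρ => ρ.isCKFamily.mul_eq μ ν h
  star_mul_eq μ ν := ckAlgebra_ext fun ρ => by
    rw [finsum_mem_eq_finite_toFinset_sum _ (hΛ μ ν), map_sum]
    refine (ρ.isCKFamily.star_mul_eq μ ν).trans ?_
    rw [finsum_mem_eq_finite_toFinset_sum _ (hΛ μ ν)]
    rfl
  gap_eq_zero v E hE := ckAlgebra_ext fun ρ => by
    rw [map_gap, map_zero]
    exact ρ.isCKFamily.gap_eq_zero v E hE

/-- To prove a closed condition for all elements of `C*(Λ)`, it suffices to prove it for the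
generators and to prove that it is stable under the *-algebra operations. -/
lemma ckAlgebra_induction {p : Λ.CKAlgebra → Prop} (hcl : IsClosed {x | p x})
    (gen : ∀ lam, p (ckGen lam)) (gen_star : ∀ lam, p (star (ckGen lam)))
    (zero : p 0) (add : ∀ x y, p x → p y → p (x + y)) (smul : ∀ (c : ℂ) x, p x → p (c • x))
    (mul : ∀ x y, p x → p y → p (x * y)) (x : Λ.CKAlgebra) : p x := by
  have key : ∀ y ∈ NonUnitalStarAlgebra.adjoin ℂ (Set.range (bigGen (Λ := Λ))),
      ∃ h : y ∈ Λ.ckSubalgebra, p ⟨y, h⟩ := by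
    intro y hy
    change y ∈ NonUnitalAlgebra.adjoin ℂ _ at hy
    induction hy using NonUnitalAlgebra.adjoin_induction with
    | mem y hy =>
      rcases hy with ⟨lam, rfl⟩ | hy
      · exact ⟨(ckGen lam).2, gen lam⟩
      · obtain ⟨lam, h⟩ := Set.mem_star.1 hy
        obtain rfl : y = star (bigGen lam) := by rw [h, star_star]
        exact ⟨(star (ckGen lam)).2, gen_star lam⟩
    | zero => exact ⟨zero_mem _, zero⟩
    | add a b _ _ ha hb =>
      obtain ⟨ha, ha'⟩ := ha
      obtain ⟨hb, hb'⟩ := hb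
      exact ⟨add_mem ha hb, add _ _ ha' hb'⟩
    | smul c a _ ha =>
      obtain ⟨ha, ha'⟩ := ha
      exact ⟨SMulMemClass.smul_mem c ha, smul c _ ha'⟩
    | mul a b _ _ ha hb =>
      obtain ⟨ha, ha'⟩ := ha
      obtain ⟨hb, hb'⟩ := hb
      exact ⟨mul_mem ha hb, mul _ _ ha' hb'⟩
  have hx' : x ∈ closure {y : Λ.CKAlgebra | CKAlgebra.val y ∈
      NonUnitalStarAlgebra.adjoin ℂ (Set.range (bigGen (Λ := Λ)))} := by
    rw [CKAlgebra.isEmbedding_val.closure_eq_preimage_closure_image]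
    have hx : CKAlgebra.val x ∈ closure
      (NonUnitalStarAlgebra.adjoin ℂ (Set.range (bigGen (Λ := Λ))) : Set Λ.BigProduct) :=
      CKAlgebra.val_mem x
    refine closure_mono (fun y hy => ?_) hx
    exact ⟨⟨y, (key y hy).1⟩, hy, rfl⟩
  exact (closure_minimal (t := {x | p x}) (fun y hy => (key _ hy).2) hcl) hx'

section Phi

variable [Fintype ι] [DecidableEq ι]

/-- The restriction of a Cuntz-Krieger `Λ`-family to `Λ^i`. -/
def CKRep.restrict (hfa : Λ.FinitelyAligned) (hlc : Λ.LocallyConvex) (i : ι) (ρ : Λ.CKRep) :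
    (Λ.deleteColour i).CKRep where
  alg := ρ.alg
  fam μ := ρ.fam (incl μ)
  isCKFamily := ρ.isCKFamily.restrict hfa hlc

/-- The *-homomorphism between products of C*-algebras that is given by restricting families. -/
noncomputable def bigPhi (hfa : Λ.FinitelyAligned) (hlc : Λ.LocallyConvex) (i : ι) :
    (Λ.deleteColour i).BigProduct →⋆ₙₐ[ℂ] Λ.BigProduct where
  toFun x := ⟨fun ρ => x (ρ.restrict hfa hlc i), memℓp_infty ⟨‖x‖, by
    rintro _ ⟨ρ, rfl⟩
    exact lp.norm_apply_le_norm ENNReal.top_ne_zero x (ρ.restrict hfa hlc i)⟩⟩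
  map_smul' _ _ := rfl
  map_zero' := rfl
  map_add' _ _ := rfl
  map_mul' _ _ := rfl
  map_star' _ := rfl

lemma bigPhi_mem (hfa : Λ.FinitelyAligned) (hlc : Λ.LocallyConvex) (i : ι)
    (x : (Λ.deleteColour i).CKAlgebra) :
    bigPhi hfa hlc i (CKAlgebra.val x) ∈ Λ.ckSubalgebra := by
  refine ckAlgebra_induction (p := fun x => bigPhi hfa hlc i (CKAlgebra.val x) ∈ Λ.ckSubalgebra)
    ?_ ?_ ?_ ?_ ?_ ?_ ?_ x
  · have hc : Continuous (bigPhi hfa hlc i) :=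
      AddMonoidHomClass.continuous_of_bound (bigPhi hfa hlc i) 1 fun x => by
        rw [one_mul]; exact NonUnitalStarAlgHom.norm_apply_le _ x
    exact (NonUnitalStarSubalgebra.isClosed_topologicalClosure _).preimage
      (hc.comp CKAlgebra.isEmbedding_val.continuous)
  · intro lam
    exact CKAlgebra.val_mem (ckGen (incl lam))
  · intro lam
    exact CKAlgebra.val_mem (star (ckGen (incl lam)))
  · rw [map_zero, map_zero]
    exact zero_mem _
  · intro x y hx hy
    rw [map_add, map_add]
    exact add_mem hx hy
  · intro c x hx
    rw [map_smul, map_smul]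
    exact SMulMemClass.smul_mem c hx
  · intro x y hx hy
    rw [map_mul, map_mul]
    exact mul_mem hx hy

/-- For a finitely aligned locally convex graph, the *-homomorphism `φ : C*(Λ^i) → C*(Λ)` with
`φ(s_lam) = s_lam` for every path `lam` of `Λ^i`. -/
noncomputable def phi (hfa : Λ.FinitelyAligned) (hlc : Λ.LocallyConvex) (i : ι) :
    (Λ.deleteColour i).CKAlgebra →⋆ₙₐ[ℂ] Λ.CKAlgebra where
  toFun x := ⟨bigPhi hfa hlc i (CKAlgebra.val x), bigPhi_mem hfa hlc i x⟩
  map_smul' _ _ := rfl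
  map_zero' := rfl
  map_add' _ _ := rfl
  map_mul' _ _ := rfl
  map_star' _ := rfl

lemma phi_ckGen (hfa : Λ.FinitelyAligned) (hlc : Λ.LocallyConvex) (i : ι)
    (lam : (Λ.deleteColour i).Path) : phi hfa hlc i (ckGen lam) = ckGen (incl lam) := rfl

end Phi

end HigherRankGraph

/-! ### Hilbert bimodules inside a C*-algebra -/

section Bimodule

variable {A : Type*} {B : Type*} [NonUnitalCStarAlgebra A] [NonUnitalCStarAlgebra B]

lemma continuous_nonUnitalStarAlgHom (φ : A →⋆ₙₐ[ℂ] B) : Continuous φ :=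
  AddMonoidHomClass.continuous_of_bound φ 1 fun x => by
    rw [one_mul]; exact NonUnitalStarAlgHom.norm_apply_le _ x

lemma exists_preimage_of_isSelfAdjoint (φ : A →⋆ₙₐ[ℂ] B) (a : A) (ha : IsSelfAdjoint a) :
    ∃ a', φ a' = φ a ∧ ‖a'‖ ≤ ‖φ a‖ := by
  have hb : IsSelfAdjoint (φ a) := ha.map φ
  have hφ := continuous_nonUnitalStarAlgHom φ
  let f : ℝ → ℝ := fun t => max (-‖φ a‖) (min t ‖φ a‖)
  have hf : Continuous f := by fun_prop
  have hf0 : f 0 = 0 := by simp [f]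
  refine ⟨cfcₙ f a, ?_, ?_⟩
  · rw [φ.map_cfcₙ f a hf.continuousOn hf0 hφ ha hb]
    conv_rhs => rw [← cfcₙ_id' ℝ (φ a) hb]
    refine cfcₙ_congr fun t ht => ?_
    have h := norm_apply_le_norm_cfcₙ (fun t : ℝ => t) (φ a) ht (by fun_prop) rfl hb
    rw [cfcₙ_id' ℝ (φ a) hb, Real.norm_eq_abs, abs_le] at h
    simp only [f]
    rw [min_eq_left h.2, max_eq_right h.1]
  · refine norm_cfcₙ_le fun t _ => ?_
    rw [Real.norm_eq_abs, abs_le]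
    exact ⟨le_max_left _ _, max_le (by linarith [norm_nonneg (φ a)]) (min_le_right _ _)⟩

/-- The range of a *-homomorphism between C*-algebras is closed. -/
lemma isClosed_range_nonUnitalStarAlgHom (φ : A →⋆ₙₐ[ℂ] B) : IsClosed (Set.range φ) := by
  let f : NormedAddGroupHom A B :=
    { toFun := φ
      map_add' := map_add φ
      bound' := ⟨1, fun x => by rw [one_mul]; exact NonUnitalStarAlgHom.norm_apply_le _ x⟩ }
  have hsurj : f.SurjectiveOnWith f.range 2 := by
    rintro _ ⟨a, rfl⟩
    have hre := exists_preimage_of_isSelfAdjoint φ (realPart a : A) (realPart a).2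
    have him := exists_preimage_of_isSelfAdjoint φ (imaginaryPart a : A) (imaginaryPart a).2
    obtain ⟨x, hx, hx'⟩ := hre
    obtain ⟨y, hy, hy'⟩ := him
    have hφa : (realPart (φ a) : B) = φ (realPart a : A) := by
      rw [realPart_apply_coe, realPart_apply_coe, RCLike.real_smul_eq_coe_smul (K := ℂ),
        RCLike.real_smul_eq_coe_smul (K := ℂ), map_smul, map_add, map_star]
    have hφb : (imaginaryPart (φ a) : B) = φ (imaginaryPart a : A) := by
      rw [imaginaryPart_apply_coe, imaginaryPart_apply_coe,
        RCLike.real_smul_eq_coe_smul (K := ℂ), RCLike.real_smul_eq_coe_smul (K := ℂ), map_smul,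
        map_smul, map_sub, map_star]
    have h1 : ‖φ (realPart a : A)‖ ≤ ‖φ a‖ := by
      rw [← hφa]; simpa using realPart.norm_le (φ a)
    have h2 : ‖φ (imaginaryPart a : A)‖ ≤ ‖φ a‖ := by
      rw [← hφb]; simpa using imaginaryPart.norm_le (φ a)
    refine ⟨x + Complex.I • y, ?_, ?_⟩
    · change φ (x + Complex.I • y) = φ a
      rw [map_add, map_smul, hx, hy, ← map_smul, ← map_add, realPart_add_I_smul_imaginaryPart]
    · calc ‖x + Complex.I • y‖ ≤ ‖x‖ + ‖y‖ := by
            refine (norm_add_le _ _).trans ?_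
            rw [norm_smul, Complex.norm_I, one_mul]
        _ ≤ 2 * ‖φ a‖ := by linarith
  have hcl := controlled_closure_of_complete (by norm_num : (0 : ℝ) < 2) one_pos hsurj
  refine isClosed_of_closure_subset fun b hb => ?_
  obtain ⟨a, ha, -⟩ := hcl b hb
  exact ⟨a, ha⟩

/-- A closed subspace `X` of a C*-algebra `B` with `φ(A)X ⊆ X`, `Xφ(A) ⊆ X` and `X^*X ⊆ φ(A)`, for
a *-homomorphism `φ : A → B`. If `φ` is injective, then `X` is a Hilbert `A`-bimodule with
`a · x · b = φ(a) x φ(b)` and `⟨x, y⟩ = φ⁻¹(x^* y)`, whose norm is the norm of `B`. -/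
structure HilbertSubBimodule (φ : A →⋆ₙₐ[ℂ] B) where
  carrier : Submodule ℂ B
  isClosed : IsClosed (carrier : Set B)
  left_mem : ∀ (a : A), ∀ x ∈ carrier, φ a * x ∈ carrier
  right_mem : ∀ (a : A), ∀ x ∈ carrier, x * φ a ∈ carrier
  inner_mem : ∀ x ∈ carrier, ∀ y ∈ carrier, star x * y ∈ Set.range φ

namespace HilbertSubBimodule

variable {φ : A →⋆ₙₐ[ℂ] B} (X : HilbertSubBimodule φ)

/-- The inner product `⟨x, y⟩ = φ⁻¹(x^* y)`. -/
noncomputable def inner (x y : X.carrier) : A := (X.inner_mem x x.2 y y.2).choose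

lemma phi_inner (x y : X.carrier) : φ (X.inner x y) = star (x : B) * y :=
  (X.inner_mem x x.2 y y.2).choose_spec

/-- The right action `x · a = x φ(a)`. -/
def rightAction (x : X.carrier) (a : A) : X.carrier := ⟨x * φ a, X.right_mem a x x.2⟩

/-- The left action `ψ(a) x = a · x = φ(a) x`. -/
noncomputable def leftAction (a : A) : X.carrier →L[ℂ] X.carrier :=
  LinearMap.mkContinuous
    { toFun := fun x => ⟨φ a * x, X.left_mem a x x.2⟩
      map_add' := fun _ _ => Subtype.ext (mul_add _ _ _)
      map_smul' := fun _ _ => Subtype.ext (mul_smul_comm _ _ _) }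
    ‖φ a‖ fun x => norm_mul_le (φ a) (x : B)

/-- The rank-one operator `Θ_{x,y} : z ↦ x · ⟨y, z⟩`. -/
noncomputable def theta (x y : X.carrier) : X.carrier →L[ℂ] X.carrier :=
  LinearMap.mkContinuous
    { toFun := fun z => X.rightAction x (X.inner y z)
      map_add' := fun z w => Subtype.ext <| by
        simp only [rightAction, phi_inner, Submodule.coe_add, mul_add]
      map_smul' := fun c z => Subtype.ext <| by
        simp only [rightAction, phi_inner, Submodule.coe_smul, mul_smul_comm, RingHom.id_apply] }
    (‖(x : B)‖ * ‖(y : B)‖) fun z => by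
      change ‖(x : B) * φ (X.inner y z)‖ ≤ _
      rw [phi_inner, mul_assoc]
      refine (norm_mul_le _ _).trans (mul_le_mul_of_nonneg_left ?_ (norm_nonneg _))
      refine (norm_mul_le _ _).trans ?_
      rw [norm_star]
      rfl

/-- The generalised compact operators `K_A(X)`: the closed linear span, in the operator norm, of the
rank-one operators. -/
noncomputable def compacts : Submodule ℂ (X.carrier →L[ℂ] X.carrier) :=
  (Submodule.span ℂ {T | ∃ x y : X.carrier, T = X.theta x y}).topologicalClosure

/-- The Katsura ideal `J_X = ψ⁻¹(K_A(X)) ∩ ker(ψ)^⊥`. -/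
def katsuraIdeal : Set A :=
  {a | X.leftAction a ∈ X.compacts ∧ ∀ b : A, X.leftAction b = 0 → a * b = 0}

end HilbertSubBimodule

end Bimodule

namespace HigherRankGraph

variable {ι : Type} {Λ : HigherRankGraph.{u} ι}

/-! ### The bimodule of a higher-rank graph -/

/-- The closed linear span of the elements `s_lam s_μ^*` of `C*(Λ)` with `d(lam)_i = n` and
`d(μ)_i = 0`. -/
noncomputable def spanDegree (Λ : HigherRankGraph.{u} ι) (i : ι) (n : ℕ) :
    Submodule ℂ Λ.CKAlgebra :=
  (Submodule.span ℂ {x | ∃ lam μ : Λ.Path, lam.d i = n ∧ μ.d i = 0 ∧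
    x = ckGen lam * star (ckGen μ)}).topologicalClosure

lemma mem_spanDegree {i : ι} {n : ℕ} (lam μ : Λ.Path) (h : lam.d i = n) (h' : μ.d i = 0) :
    ckGen lam * star (ckGen μ) ∈ spanDegree Λ i n :=
  Submodule.le_topologicalClosure _ (Submodule.subset_span ⟨lam, μ, h, h', rfl⟩)

lemma isClosed_spanDegree (i : ι) (n : ℕ) :
    IsClosed (spanDegree Λ i n : Set Λ.CKAlgebra) :=
  Submodule.isClosed_topologicalClosure _

lemma spanDegree_induction {i : ι} {n : ℕ} {p : Λ.CKAlgebra → Prop} (hcl : IsClosed {x | p x})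
    (gen : ∀ lam μ : Λ.Path, lam.d i = n → μ.d i = 0 → p (ckGen lam * star (ckGen μ)))
    (zero : p 0) (add : ∀ x y, p x → p y → p (x + y)) (smul : ∀ (c : ℂ) x, p x → p (c • x))
    (x : Λ.CKAlgebra) (hx : x ∈ spanDegree Λ i n) : p x := by
  refine closure_minimal (t := {x | p x}) (fun y hy => ?_) hcl hx
  induction hy using Submodule.span_induction with
  | mem y hy =>
    obtain ⟨lam, μ, h, h', rfl⟩ := hy
    exact gen lam μ h h'
  | zero => exact zero
  | add a b _ _ ha hb => exact add a b ha hb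
  | smul c a _ ha => exact smul c a ha

lemma ckGen_comp_star_mem {i : ι} {n : ℕ} (hΛ : Λ.FinitelyAligned) (μ ν α β : Λ.Path)
    (h : μ.d i + α.d i = n) (h' : ν.d i + β.d i = 0) :
    (ckGen μ * ckGen α) * star (ckGen ν * ckGen β) ∈ spanDegree Λ i n := by
  have hq := (isCKFamily_ckGen hΛ).toIsTCKFamily
  by_cases h₁ : μ.src = α.rng
  · by_cases h₂ : ν.src = β.rng
    · rw [hq.mul_eq _ _ h₁, hq.mul_eq _ _ h₂]
      exact mem_spanDegree _ _ (by rw [Path.comp_d]; exact h) (by rw [Path.comp_d]; exact h')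
    · rw [hq.mul_eq_zero _ _ h₂, star_zero, mul_zero]
      exact zero_mem _
  · rw [hq.mul_eq_zero _ _ h₁, zero_mul]
    exact zero_mem _

/-- A product `s_κ (s_μ^* s_ν) s_τ^*` lies in the span of the elements with the expected degree. -/
lemma ckGen_mul_mem {i : ι} {n : ℕ} (hΛ : Λ.FinitelyAligned) (κ μ ν τ : Λ.Path)
    (hτ : τ.d i = 0) (hν : μ.d i ⊔ ν.d i = ν.d i) (h : κ.d i + (ν.d i - μ.d i) = n) :
    ckGen κ * (star (ckGen μ) * ckGen ν) * star (ckGen τ) ∈ spanDegree Λ i n := by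
  rw [(isCKFamily_ckGen hΛ).star_mul_eq, finsum_mem_eq_finite_toFinset_sum _ (hΛ μ ν),
    Finset.mul_sum, Finset.sum_mul]
  refine sum_mem fun p hp => ?_
  obtain ⟨h₁, h₂, e, hd⟩ := (hΛ μ ν).mem_toFinset.1 hp
  have e1 : μ.d i + p.1.d i = ν.d i := by
    have := congrFun hd i
    rw [Path.comp_d] at this
    exact this.trans hν
  have e2 : ν.d i + p.2.d i = ν.d i := by
    rw [e] at hd
    have := congrFun hd i
    rw [Path.comp_d] at this
    exact this.trans hν
  have e3 : ckGen κ * (ckGen p.1 * star (ckGen p.2)) * star (ckGen τ)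
      = (ckGen κ * ckGen p.1) * star (ckGen τ * ckGen p.2) := by
    rw [star_mul]
    simp only [mul_assoc]
  rw [e3]
  exact ckGen_comp_star_mem hΛ _ _ _ _ (by omega) (by omega)

lemma ckGen_mem_spanDegree {i : ι} {n : ℕ} (hΛ : Λ.FinitelyAligned) (μ : Λ.Path) (h : μ.d i = n) :
    ckGen μ ∈ spanDegree Λ i n := by
  have hq := (isCKFamily_ckGen hΛ).toIsTCKFamily
  have := mem_spanDegree (i := i) μ (Λ.vertex μ.src) h (by simp)
  rwa [(hq.isStarProjection _).isSelfAdjoint.star_eq, hq.mul_vertex] at this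

section

variable [Fintype ι] [DecidableEq ι] (hfa : Λ.FinitelyAligned) (hlc : Λ.LocallyConvex) (i : ι)

lemma phi_mul_mem (n : ℕ) (a : (Λ.deleteColour i).CKAlgebra) (x : Λ.CKAlgebra)
    (hx : x ∈ spanDegree Λ i n) : phi hfa hlc i a * x ∈ spanDegree Λ i n := by
  have hq := (isCKFamily_ckGen hfa).toIsTCKFamily
  have hS := isClosed_spanDegree (Λ := Λ) i n
  refine ckAlgebra_induction (p := fun a => ∀ x ∈ spanDegree Λ i n,
    phi hfa hlc i a * x ∈ spanDegree Λ i n) ?_ ?_ ?_ ?_ ?_ ?_ ?_ a x hx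
  · simp only [Set.ofPred_forall]
    exact isClosed_iInter fun x => isClosed_iInter fun _ =>
      hS.preimage ((continuous_nonUnitalStarAlgHom _).mul continuous_const)
  · intro lam x hx
    rw [phi_ckGen]
    refine spanDegree_induction (p := fun x => ckGen (incl lam) * x ∈ spanDegree Λ i n)
      (hS.preimage (continuous_const.mul continuous_id)) ?_ (by simp)
      (fun x y hx hy => by rw [mul_add]; exact add_mem hx hy)
      (fun c x hx => by rw [mul_smul_comm]; exact Submodule.smul_mem _ c hx) x hx
    intro μ ν hμ hν
    have := ckGen_comp_star_mem hfa (i := i) (n := n) (incl lam) ν μ (Λ.vertex ν.src)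
      (by rw [incl_d_self, hμ, zero_add]) (by simp [hν])
    rwa [hq.mul_vertex, mul_assoc] at this
  · intro lam x hx
    rw [map_star, phi_ckGen]
    refine spanDegree_induction (p := fun x => star (ckGen (incl lam)) * x ∈ spanDegree Λ i n)
      (hS.preimage (continuous_const.mul continuous_id)) ?_ (by simp)
      (fun x y hx hy => by rw [mul_add]; exact add_mem hx hy)
      (fun c x hx => by rw [mul_smul_comm]; exact Submodule.smul_mem _ c hx) x hx
    intro μ ν hμ hν
    have := ckGen_mul_mem hfa (i := i) (n := n) (Λ.vertex (incl lam).src) (incl lam) μ ν hν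
      (by rw [incl_d_self]; simp) (by rw [incl_d_self]; simp [hμ])
    rw [← mul_assoc, ← (hq.isStarProjection _).isSelfAdjoint.star_eq, ← star_mul,
      hq.mul_vertex, mul_assoc] at this
    exact this
  · intro x _
    simp
  · intro a b ha hb x hx
    rw [map_add, add_mul]
    exact add_mem (ha x hx) (hb x hx)
  · intro c a ha x hx
    rw [map_smul, smul_mul_assoc]
    exact Submodule.smul_mem _ c (ha x hx)
  · intro a b ha hb x hx
    rw [map_mul, mul_assoc]
    exact ha _ (hb x hx)

lemma mul_phi_mem (n : ℕ) (a : (Λ.deleteColour i).CKAlgebra) (x : Λ.CKAlgebra)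
    (hx : x ∈ spanDegree Λ i n) : x * phi hfa hlc i a ∈ spanDegree Λ i n := by
  have hq := (isCKFamily_ckGen hfa).toIsTCKFamily
  have hS := isClosed_spanDegree (Λ := Λ) i n
  refine ckAlgebra_induction (p := fun a => ∀ x ∈ spanDegree Λ i n,
    x * phi hfa hlc i a ∈ spanDegree Λ i n) ?_ ?_ ?_ ?_ ?_ ?_ ?_ a x hx
  · simp only [Set.ofPred_forall]
    exact isClosed_iInter fun x => isClosed_iInter fun _ =>
      hS.preimage (continuous_const.mul (continuous_nonUnitalStarAlgHom _))
  · intro lam x hx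
    rw [phi_ckGen]
    refine spanDegree_induction (p := fun x => x * ckGen (incl lam) ∈ spanDegree Λ i n)
      (hS.preimage (continuous_id.mul continuous_const)) ?_ (by simp)
      (fun x y hx hy => by rw [add_mul]; exact add_mem hx hy)
      (fun c x hx => by rw [smul_mul_assoc]; exact Submodule.smul_mem _ c hx) x hx
    intro μ ν hμ hν
    have := ckGen_mul_mem hfa (i := i) (n := n) μ ν (incl lam) (Λ.vertex (incl lam).src)
      (by simp) (by rw [incl_d_self, hν]; rfl) (by rw [incl_d_self, hν, hμ]; simp)
    rw [(hq.isStarProjection _).isSelfAdjoint.star_eq, mul_assoc, mul_assoc, hq.mul_vertex,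
      ← mul_assoc] at this
    exact this
  · intro lam x hx
    rw [map_star, phi_ckGen]
    refine spanDegree_induction (p := fun x => x * star (ckGen (incl lam)) ∈ spanDegree Λ i n)
      (hS.preimage (continuous_id.mul continuous_const)) ?_ (by simp)
      (fun x y hx hy => by rw [add_mul]; exact add_mem hx hy)
      (fun c x hx => by rw [smul_mul_assoc]; exact Submodule.smul_mem _ c hx) x hx
    intro μ ν hμ hν
    have := ckGen_comp_star_mem hfa (i := i) (n := n) μ (incl lam) (Λ.vertex μ.src) ν
      (by simp [hμ]) (by rw [incl_d_self, hν])
    rw [hq.mul_vertex, star_mul, ← mul_assoc] at this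
    exact this
  · intro x _
    simp
  · intro a b ha hb x hx
    rw [map_add, mul_add]
    exact add_mem (ha x hx) (hb x hx)
  · intro c a ha x hx
    rw [map_smul, mul_smul_comm]
    exact Submodule.smul_mem _ c (ha x hx)
  · intro a b ha hb x hx
    rw [map_mul, ← mul_assoc]
    exact hb _ (ha x hx)

lemma star_mul_mem_range (n : ℕ) (x y : Λ.CKAlgebra)
    (hx : x ∈ spanDegree Λ i n) (hy : y ∈ spanDegree Λ i n) :
    star x * y ∈ Set.range (phi hfa hlc i) := by
  have hS := isClosed_spanDegree (Λ := Λ) i 0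
  have key : star x * y ∈ spanDegree Λ i 0 := by
    refine spanDegree_induction (p := fun x => star x * y ∈ spanDegree Λ i 0)
      (hS.preimage (continuous_star.mul continuous_const)) ?_ (by simp)
      (fun x y hx hy => by rw [star_add, add_mul]; exact add_mem hx hy)
      (fun c x hx => by rw [star_smul, smul_mul_assoc]; exact Submodule.smul_mem _ _ hx) x hx
    intro μ ν hμ hν
    refine spanDegree_induction
      (p := fun y => star (ckGen μ * star (ckGen ν)) * y ∈ spanDegree Λ i 0)
      (hS.preimage (continuous_const.mul continuous_id)) ?_ (by simp)
      (fun x y hx hy => by rw [mul_add]; exact add_mem hx hy)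
      (fun c x hx => by rw [mul_smul_comm]; exact Submodule.smul_mem _ _ hx) y hy
    intro μ' ν' hμ' hν'
    have := ckGen_mul_mem hfa (i := i) (n := 0) ν μ μ' ν' hν' (by rw [hμ, hμ', sup_idem])
      (by rw [hμ, hμ', hν]; simp)
    rw [star_mul, star_star]
    simpa only [mul_assoc] using this
  refine spanDegree_induction (p := fun x => x ∈ Set.range (phi hfa hlc i))
    (isClosed_range_nonUnitalStarAlgHom _) ?_ ⟨0, map_zero _⟩ ?_ ?_ _ key
  · intro μ ν hμ hν
    obtain ⟨μ, rfl⟩ := exists_incl μ hμ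
    obtain ⟨ν, rfl⟩ := exists_incl ν hν
    exact ⟨ckGen μ * star (ckGen ν), by rw [map_mul, map_star, phi_ckGen, phi_ckGen]⟩
  · rintro _ _ ⟨a, rfl⟩ ⟨b, rfl⟩
    exact ⟨a + b, map_add _ _ _⟩
  · rintro c _ ⟨a, rfl⟩
    exact ⟨c • a, map_smul _ _ _⟩

/-- The Hilbert `C*(Λ^i)`-bimodule `X`, the closed linear span in `C*(Λ)` of the elements
`s_lam s_μ^*` with `d(lam)_i = 1` and `d(μ)_i = 0`. Here `φ : C*(Λ^i) → C*(Λ)` is injective. -/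
noncomputable def edgeBimodule : HilbertSubBimodule (phi hfa hlc i) where
  carrier := spanDegree Λ i 1
  isClosed := isClosed_spanDegree i 1
  left_mem := phi_mul_mem hfa hlc i 1
  right_mem := mul_phi_mem hfa hlc i 1
  inner_mem := fun x hx y hy => star_mul_mem_range hfa hlc i 1 x y hx hy

/-- The element `s_μ` of `X`, for a path `μ` of `Λ` with `d(μ)_i = 1` (and `0` for any other path,
a value which is not used). -/
noncomputable def pathVector (μ : Λ.Path) : (edgeBimodule hfa hlc i).carrier :=
  if h : μ.d i = 1 then ⟨ckGen μ, ckGen_mem_spanDegree hfa μ h⟩ else 0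

/-- The set `H_{J_X}` of the vertices `v` with `s_v ∈ J_X`. -/
def katsuraVertices : Set (Λ.deleteColour i).Obj :=
  {v | ckGen ((Λ.deleteColour i).vertex v) ∈ (edgeBimodule hfa hlc i).katsuraIdeal}

/-- The set of the paths of the graph `Λ^i \ Λ^i H_{J_X}`: the paths of `Λ^i` whose source is not in
`H_{J_X}`. -/
def remainingPaths : Set (Λ.deleteColour i).Path :=
  {μ | μ.src ∉ katsuraVertices hfa hlc i}

end

end HigherRankGraph

/-!
Inclusion and exclusion writes `Δ(s)^{E ∪ F}` as the alternating sum, over the subsets `G` of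
`E ∪ F`, of the projections `s_μ s_μ^*` with `μ ∈ MCE(G)`. If `E ∪ F` is exhaustive, then the sum
is zero. The terms with `G ⊆ E` add up to `φ(Δ(s)^E)`, and in each of the remaining terms `G`
contains an edge of degree `e_i`, so that `d(μ)_i = 1` and `s_μ` belongs to `X`. This is the formula
for `ψ(Δ(s)^E)`, and it shows that this operator is compact (`leftAction_gap_eq_sum`).

The same formula gives `φ(Δ(s)^E b) = 0` whenever `ψ(b) = 0`, as then `s_μ^* φ(b) = 0` for all `s_μ`
in `X`. Hence `Δ(s)^E` annihilates the kernel of `ψ`, because `φ` is injective (`phi_injective`). The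
injectivity is an instance of the gauge-invariant uniqueness theorem, in three steps.

* A homomorphism that is nonzero on the vertex projections is isometric on the core, the part of
  degree zero (`norm_map_of_mem_coreSpan`). An element of the core involves finitely many paths, and
  these lie in a finite set of paths that is closed under minimal common extensions and under
  exchanges of initial segments of the same degree (`SwapClosure.finite`). So the element belongs to
  a finite-dimensional algebra; if it is an element `a` of the kernel, then `a s_λ = 0` for all `λ`
  in that set, by descending induction on the length of `λ`: as the proper extensions of `λ` in the
  set contribute nothing, `a s_λ` is a combination of partial isometries with orthogonal ranges, cut
  down by a gap projection, and the homomorphism is injective on such combinations.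
* Averaging over the torus carries this over to the whole algebra (`injective_of_isometric_on_fixed`).
* The vertex projections of the Cuntz-Krieger algebra are nonzero (`ckGen_vertex_ne_zero`), since
  paths act by shifts on `ℓ²` of the set of the maximal filters of paths; a maximal filter that
  contains `v` meets every finite exhaustive subset of `vΛ`.

For the converse, a compact operator on `X` almost vanishes on the vectors that are orthogonal to
the ranges of finitely many edges of degree `e_i` (`exists_finset_of_mem_compacts`). Let `F` consist
of those edges among them that have range `v = r(E)`. If a path `μ` of `vΛ` with `d(μ)_i ≥ 1` had no
common extension with any member of `E ∪ F`, then `Δ(s)^E` would fix `s_μ`, contrary to the choice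
of `F`. A path `μ` with `d(μ)_i = 0` and `s(μ)` outside `H_{J_X}` meets `E` by hypothesis. If
`s(μ)` belongs to `H_{J_X}`, then `μ` extends to a path with `d(μ)_i = 1`, as each vertex in
`H_{J_X}` receives an edge of degree `e_i` (`exists_edge_of_mem_katsuraVertices`). So `E ∪ F` is
exhaustive.
-/

namespace HigherRankGraph

variable {ι : Type} {Λ : HigherRankGraph.{u} ι}

/-! ### Prefixes and common extensions -/

lemma Path.isPrefix_comp (μ α : Λ.Path) (h : μ.src = α.rng) : μ.IsPrefix (μ.comp α h) :=
  ⟨α, h, rfl⟩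

lemma Path.IsPrefix.refl (μ : Λ.Path) : μ.IsPrefix μ :=
  ⟨Λ.vertex μ.src, rfl, Path.comp_vertex μ _ rfl⟩

lemma Path.IsPrefix.trans {μ ν κ : Λ.Path} (h : μ.IsPrefix ν) (h' : ν.IsPrefix κ) :
    μ.IsPrefix κ := by
  obtain ⟨α, hα, rfl⟩ := h
  obtain ⟨β, hβ, rfl⟩ := h'
  have hs : α.src = β.rng := by rw [← hβ, Path.comp_src]
  exact ⟨α.comp β hs, by rw [Path.comp_rng, hα],
    (Path.comp_assoc μ α β hα hs hβ (by rw [Path.comp_rng, hα])).symm⟩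

lemma Path.IsPrefix.d_le {μ ν : Λ.Path} (h : μ.IsPrefix ν) : μ.d ≤ ν.d := by
  obtain ⟨α, hα, rfl⟩ := h
  rw [Path.comp_d]
  exact le_self_add

lemma Path.IsPrefix.rng_eq {μ ν : Λ.Path} (h : μ.IsPrefix ν) : μ.rng = ν.rng := by
  obtain ⟨α, hα, rfl⟩ := h
  rw [Path.comp_rng]

lemma Path.comp_left_cancel {μ α β : Λ.Path} (h : μ.src = α.rng) (h' : μ.src = β.rng)
    (e : μ.comp α h = μ.comp β h') : α = β :=
  (Path.comp_inj h h' e rfl).2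

/-- Prefixes of a path are determined by their degrees. -/
lemma Path.IsPrefix.eq_of_d_eq {μ ν κ : Λ.Path} (h : μ.IsPrefix κ) (h' : ν.IsPrefix κ)
    (hd : μ.d = ν.d) : μ = ν := by
  obtain ⟨α, hα, rfl⟩ := h
  obtain ⟨β, hβ, e⟩ := h'
  exact (Path.comp_inj hα hβ e.symm hd).1

lemma Path.exists_isPrefix (κ : Λ.Path) {m : ι → ℕ} (hm : m ≤ κ.d) :
    ∃ μ : Λ.Path, μ.IsPrefix κ ∧ μ.d = m := by
  obtain ⟨μ, ν, hc, e, h, -⟩ := Path.exists_factor κ m (κ.d - m) (add_tsub_cancel_of_le hm).symm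
  exact ⟨μ, ⟨ν, hc, e⟩, h⟩

lemma Path.vertex_isPrefix (μ : Λ.Path) : (Λ.vertex μ.rng).IsPrefix μ :=
  ⟨μ, rfl, Path.vertex_comp μ _ rfl⟩

lemma Path.eq_vertex {v : Λ.Obj} {μ : Λ.Path} (hr : μ.rng = v) (hd : μ.d = 0) :
    μ = Λ.vertex v := by
  rw [← hr]
  exact Path.eq_vertex_of_d_eq_zero μ hd

lemma Path.IsPrefix.comp_iff {μ α β : Λ.Path} (h : μ.src = α.rng) (h' : μ.src = β.rng) :
    (μ.comp α h).IsPrefix (μ.comp β h') ↔ α.IsPrefix β := by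
  constructor
  · rintro ⟨γ, hγ, e⟩
    have hs : α.src = γ.rng := by rw [← hγ, Path.comp_src]
    rw [Path.comp_assoc μ α γ h hs hγ (by rw [Path.comp_rng, h])] at e
    exact ⟨γ, hs, Path.comp_left_cancel _ _ e⟩
  · rintro ⟨γ, hs, rfl⟩
    exact ⟨γ, by rw [Path.comp_src, hs],
      Path.comp_assoc μ α γ h hs (by rw [Path.comp_src, hs]) (by rw [Path.comp_rng, h])⟩

lemma Path.IsPrefix.exists_sup {μ ν κ : Λ.Path} (h : μ.IsPrefix κ) (h' : ν.IsPrefix κ) :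
    ∃ ρ : Λ.Path, ρ.IsPrefix κ ∧ μ.IsPrefix ρ ∧ ν.IsPrefix ρ ∧ ρ.d = μ.d ⊔ ν.d := by
  obtain ⟨ρ, hρ, hd⟩ := κ.exists_isPrefix (sup_le h.d_le h'.d_le)
  exact ⟨ρ, hρ, h.of_le hρ (hd ▸ le_sup_left), h'.of_le hρ (hd ▸ le_sup_right), hd⟩

lemma mem_mce_pair {μ ν κ : Λ.Path} :
    κ ∈ mce {μ, ν} ↔ μ.IsPrefix κ ∧ ν.IsPrefix κ ∧ κ.d = μ.d ⊔ ν.d := by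
  simp [mce, and_assoc]

/-- Two paths have a minimal common extension as soon as they have a common extension. -/
lemma minExt_nonempty_iff {μ ν : Λ.Path} :
    (minExt μ ν).Nonempty ↔ ∃ κ : Λ.Path, μ.IsPrefix κ ∧ ν.IsPrefix κ := by
  constructor
  · rintro ⟨⟨α, β⟩, h₁, h₂, e, -⟩
    exact ⟨μ.comp α h₁, ⟨α, h₁, rfl⟩, ⟨β, h₂, e.symm⟩⟩
  · rintro ⟨κ, h, h'⟩
    exact minExt_nonempty_of_prefix _ _ κ h h'

lemma minExt_swap {μ ν : Λ.Path} (h : (minExt μ ν).Nonempty) : (minExt ν μ).Nonempty := by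
  obtain ⟨κ, h, h'⟩ := minExt_nonempty_iff.1 h
  exact minExt_nonempty_iff.2 ⟨κ, h', h⟩

/-! ### Finite sets of paths that span an algebra -/

/-- The smallest set of paths which contains `S`, contains the minimal common extensions of any two
of its members, and contains `μα` whenever it contains `μ`, `ν` and `να` with `d(μ) = d(ν)`. -/
inductive SwapClosure (S : Set Λ.Path) : Λ.Path → Prop
  | base {κ : Λ.Path} : κ ∈ S → SwapClosure S κ
  | mce {ν σ κ : Λ.Path} : SwapClosure S ν → SwapClosure S σ → κ ∈ HigherRankGraph.mce {ν, σ} →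
      SwapClosure S κ
  | swap {μ ν α κ κ' : Λ.Path} (hμ : μ.src = α.rng) (hν : ν.src = α.rng) : SwapClosure S μ →
      SwapClosure S ν → μ.d = ν.d → ν.comp α hν = κ → μ.comp α hμ = κ' → SwapClosure S κ →
      SwapClosure S κ'

lemma SwapClosure.d_le {S : Set Λ.Path} {N : ι → ℕ} (hN : ∀ κ ∈ S, κ.d ≤ N) {κ : Λ.Path}
    (h : SwapClosure S κ) : κ.d ≤ N := by
  induction h with
  | base h => exact hN _ h
  | mce _ _ h ih₁ ih₂ =>
    rw [(mem_mce_pair.1 h).2.2]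
    exact sup_le ih₁ ih₂
  | swap hμ hν _ _ hd e e' _ _ _ ih =>
    rw [← e, Path.comp_d] at ih
    rw [← e', Path.comp_d, hd]
    exact ih

/-- The path `μα`, if `κ = να` for some path `α`; otherwise the value is irrelevant. -/
noncomputable def swapPrefix (μ ν κ : Λ.Path) : Λ.Path :=
  open Classical in
  if h : ∃ (α : Λ.Path) (_ : ν.src = α.rng) (hμ : μ.src = α.rng), ν.comp α ‹_› = κ then
    μ.comp h.choose h.choose_spec.choose_spec.choose else μ

lemma swapPrefix_comp {μ ν α κ : Λ.Path} (hν : ν.src = α.rng) (hμ : μ.src = α.rng)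
    (e : ν.comp α hν = κ) : swapPrefix μ ν κ = μ.comp α hμ := by
  have h : ∃ (α : Λ.Path) (_ : ν.src = α.rng) (hμ : μ.src = α.rng), ν.comp α ‹_› = κ :=
    ⟨α, hν, hμ, e⟩
  rw [swapPrefix, dif_pos h]
  have e' := h.choose_spec.choose_spec.choose_spec
  congr 1
  exact Path.comp_left_cancel _ _ (e'.trans e.symm)

/-- The members of degree `n` of the closure of `S` arise, by at most one exchange of initial
segments of smaller degree, from the finite set `B` of those which lie in `S` or are minimal common
extensions of members of smaller degree. -/
lemma SwapClosure.mem_of_degree {S : Set Λ.Path} {n : ι → ℕ} {κ : Λ.Path} (h : SwapClosure S κ)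
    (hn : κ.d = n) (B : Set Λ.Path) (hS : S ⊆ B) (hB : ∀ ν σ : Λ.Path, SwapClosure S ν →
      SwapClosure S σ → ν.d < n → σ.d < n → HigherRankGraph.mce {ν, σ} ⊆ B) :
    κ ∈ B ∨ ∃ μ ν β : Λ.Path, SwapClosure S μ ∧ SwapClosure S ν ∧ β ∈ B ∧ μ.d < n ∧ ν.d < n ∧
      μ.d = ν.d ∧ ∃ (α : Λ.Path) (hμ : μ.src = α.rng) (hν : ν.src = α.rng), ν.comp α hν = β ∧
        μ.comp α hμ = κ := by
  induction h with
  | base h => exact Or.inl (hS h)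
  | @mce ν σ κ hν hσ h ih₁ ih₂ =>
    obtain ⟨h₁, h₂, hd⟩ := mem_mce_pair.1 h
    rcases eq_or_ne ν.d n with e | e
    · obtain rfl : ν = κ := h₁.eq_of_d_eq (.refl κ) (e.trans hn.symm)
      exact ih₁ hn
    rcases eq_or_ne σ.d n with e' | e'
    · obtain rfl : σ = κ := h₂.eq_of_d_eq (.refl κ) (e'.trans hn.symm)
      exact ih₂ hn
    exact Or.inl (hB ν σ hν hσ (lt_of_le_of_ne (hn ▸ h₁.d_le) e)
      (lt_of_le_of_ne (hn ▸ h₂.d_le) e') h)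
  | @swap μ ν α κ κ' hμ hν cμ cν hd e e' cκ ihμ ihν ihκ =>
    have hκn : κ.d = n := by
      rw [← hn, ← e, ← e', Path.comp_d, Path.comp_d, hd]
    have hνκ : ν.IsPrefix κ := ⟨α, hν, e⟩
    rcases eq_or_ne μ.d n with en | en
    · obtain rfl : μ = κ' := Path.IsPrefix.eq_of_d_eq ⟨α, hμ, e'⟩ (.refl κ') (en.trans hn.symm)
      exact ihμ hn
    have hνn : ν.d < n := lt_of_le_of_ne (hκn ▸ hνκ.d_le) (hd ▸ en)
    rcases ihκ hκn with hκB | ⟨μ₁, ν₁, β, cμ₁, cν₁, hβ, hμ₁n, hν₁n, hd₁, α₁, hμ₁, hν₁, e₁, e₁'⟩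
    · exact Or.inr ⟨μ, ν, κ, cμ, cν, hκB, hd ▸ hνn, hνn, hd, α, hμ, hν, e, e'⟩
    have hμ₁κ : μ₁.IsPrefix κ := ⟨α₁, hμ₁, e₁'⟩
    obtain ⟨ρ, hρκ, ⟨δ, hδ, eδ⟩, ⟨δ₁, hδ₁, eδ₁⟩, hρd⟩ := hνκ.exists_sup hμ₁κ
    have cρ : SwapClosure S ρ := cν.mce cμ₁ (mem_mce_pair.2 ⟨⟨δ, hδ, eδ⟩, ⟨δ₁, hδ₁, eδ₁⟩, hρd⟩)
    rcases eq_or_ne ρ.d n with en' | en'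
    · obtain rfl : ρ = κ := hρκ.eq_of_d_eq (.refl κ) (en'.trans hκn.symm)
      exact Or.inr ⟨μ, ν, ρ, cμ, cν, hB ν μ₁ cν cμ₁ hνn hμ₁n (mem_mce_pair.2 ⟨hνκ, hμ₁κ, hρd⟩),
        hd ▸ hνn, hνn, hd, α, hμ, hν, e, e'⟩
    -- The two exchanges combine into a single one, of initial segments of degree `d(ν) ∨ d(μ₁)`.
    obtain ⟨γ, hγ, eγ⟩ := hρκ
    have hρn : ρ.d < n := lt_of_le_of_ne (by rw [← hκn, ← eγ, Path.comp_d]; exact le_self_add) en'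
    have hδγ : δ.src = γ.rng := by rw [← hγ, ← eδ, Path.comp_src]
    have hδ₁γ : δ₁.src = γ.rng := by rw [← hγ, ← eδ₁, Path.comp_src]
    have hνδγ : ν.src = (δ.comp γ hδγ).rng := by rw [Path.comp_rng, hδ]
    have hμ₁δγ : μ₁.src = (δ₁.comp γ hδ₁γ).rng := by rw [Path.comp_rng, hδ₁]
    have eα : α = δ.comp γ hδγ := by
      refine Path.comp_left_cancel hν hνδγ ?_
      rw [e, ← eγ, ← Path.comp_assoc ν δ γ hδ hδγ (by rw [Path.comp_src, hδγ])]
      subst eδ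
      rfl
    have eα₁ : α₁ = δ₁.comp γ hδ₁γ := by
      refine Path.comp_left_cancel hμ₁ hμ₁δγ ?_
      rw [e₁', ← eγ, ← Path.comp_assoc μ₁ δ₁ γ hδ₁ hδ₁γ (by rw [Path.comp_src, hδ₁γ])]
      subst eδ₁
      rfl
    have hμδ : μ.src = δ.rng := by rw [hμ, eα, Path.comp_rng]
    have hν₁δ₁ : ν₁.src = δ₁.rng := by rw [hν₁, eα₁, Path.comp_rng]
    have c₁ : SwapClosure S (μ.comp δ hμδ) := cμ.swap hμδ hδ cν hd eδ rfl cρ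
    have c₂ : SwapClosure S (ν₁.comp δ₁ hν₁δ₁) := cν₁.swap hν₁δ₁ hδ₁ cμ₁ hd₁.symm eδ₁ rfl cρ
    have d₁ : (μ.comp δ hμδ).d = ρ.d := by rw [← eδ, Path.comp_d, Path.comp_d, hd]
    have d₂ : (ν₁.comp δ₁ hν₁δ₁).d = ρ.d := by rw [← eδ₁, Path.comp_d, Path.comp_d, hd₁]
    refine Or.inr ⟨_, _, β, c₁, c₂, hβ, d₁ ▸ hρn, d₂ ▸ hρn, d₁.trans d₂.symm, γ,
      by rw [Path.comp_src, hδγ], by rw [Path.comp_src, hδ₁γ], ?_, ?_⟩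
    · rw [Path.comp_assoc ν₁ δ₁ γ hν₁δ₁ hδ₁γ _ (by rw [Path.comp_rng, hν₁δ₁]), ← e₁]
      subst eα₁
      rfl
    · rw [Path.comp_assoc μ δ γ hμδ hδγ _ (by rw [Path.comp_rng, hμδ]), ← e']
      subst eα
      rfl

/-- In a finitely aligned graph the closure of a finite set of paths is finite. -/
lemma SwapClosure.finite [Fintype ι] (hfa : Λ.FinitelyAligned) {S : Set Λ.Path} (hS : S.Finite) :
    {κ | SwapClosure S κ}.Finite := by
  classical
  have key : ∀ n : ι → ℕ, {κ | SwapClosure S κ ∧ κ.d = n}.Finite := by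
    intro n
    induction n using WellFoundedLT.induction with
    | ind n ih =>
    set L : Set Λ.Path := {κ | SwapClosure S κ ∧ κ.d < n} with hL
    have hLfin : L.Finite := by
      refine ((Set.finite_Iio n).biUnion fun m hm => ih m hm).subset fun κ hκ => ?_
      exact Set.mem_biUnion (Set.mem_Iio.2 hκ.2) ⟨hκ.1, rfl⟩
    set B : Set Λ.Path := S ∪ ⋃ ν ∈ L, ⋃ σ ∈ L, HigherRankGraph.mce {ν, σ} with hB
    have hBfin : B.Finite := hS.union
      (hLfin.biUnion fun ν _ => hLfin.biUnion fun σ _ => mce_finite hfa _ (by simp))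
    refine (hBfin.union (hLfin.biUnion fun μ _ => hLfin.biUnion fun ν _ =>
      hBfin.image fun β => swapPrefix μ ν β)).subset fun κ hκ => ?_
    have := hκ.1.mem_of_degree hκ.2 B Set.subset_union_left fun ν σ hν hσ hν' hσ' τ hτ =>
      Or.inr (Set.mem_biUnion (x := ν) ⟨hν, hν'⟩ (Set.mem_biUnion (x := σ) ⟨hσ, hσ'⟩ hτ))
    rcases this with h | ⟨μ, ν, β, cμ, cν, hβ, hμ, hν, -, α, hμα, hνα, e, rfl⟩
    · exact Or.inl h
    · exact Or.inr (Set.mem_biUnion (x := μ) ⟨cμ, hμ⟩ (Set.mem_biUnion (x := ν) ⟨cν, hν⟩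
        ⟨β, hβ, swapPrefix_comp hνα hμα e⟩))
  refine ((Set.finite_Iic (hS.toFinset.sup Path.d)).biUnion fun n _ => key n).subset fun κ hκ => ?_
  refine Set.mem_biUnion (Set.mem_Iic.2 (SwapClosure.d_le (fun κ hκ => ?_) hκ)) ⟨hκ, rfl⟩
  exact Finset.le_sup (f := Path.d) (hS.mem_toFinset.2 hκ)

/-! ### Calculus in Toeplitz-Cuntz-Krieger families -/

section Calculus

variable {B : Type*} [NonUnitalCStarAlgebra B] {q : Λ.Path → B}

lemma IsTCKFamily.star_mul_eq_zero (hq : IsTCKFamily q) {μ ν : Λ.Path} (h : minExt μ ν = ∅) :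
    star (q μ) * q ν = 0 := by
  rw [hq.star_mul_eq, h, finsum_mem_empty]

lemma IsTCKFamily.star_mul_eq_zero_of_d_eq (hq : IsTCKFamily q) {μ ν : Λ.Path} (hd : μ.d = ν.d)
    (h : μ ≠ ν) : star (q μ) * q ν = 0 := by
  refine hq.star_mul_eq_zero (Set.not_nonempty_iff_eq_empty.1 fun hne => h ?_)
  obtain ⟨κ, h₁, h₂⟩ := minExt_nonempty_iff.1 hne
  exact h₁.eq_of_d_eq h₂ hd

lemma IsTCKFamily.mul_star_self_mul (hq : IsTCKFamily q) (μ : Λ.Path) :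
    q μ * star (q μ) * q μ = q μ := by
  rw [mul_assoc, hq.star_mul_self, hq.mul_vertex]

lemma IsTCKFamily.star_mul_vertex (hq : IsTCKFamily q) (μ : Λ.Path) :
    star (q μ) * q (Λ.vertex μ.rng) = star (q μ) := by
  rw [← (hq.isStarProjection _).isSelfAdjoint.star_eq, ← star_mul, hq.vertex_mul]

lemma IsTCKFamily.vertex_mul_star (hq : IsTCKFamily q) (μ : Λ.Path) :
    q (Λ.vertex μ.src) * star (q μ) = star (q μ) := by
  rw [← (hq.isStarProjection _).isSelfAdjoint.star_eq, ← star_mul, hq.mul_vertex]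

lemma IsTCKFamily.mul_star_eq_zero (hq : IsTCKFamily q) {μ ν : Λ.Path} (h : μ.src ≠ ν.src) :
    q μ * star (q ν) = 0 := by
  rw [← hq.mul_vertex μ, ← hq.vertex_mul_star ν, mul_assoc, ← mul_assoc (q (Λ.vertex μ.src)),
    hq.orthogonal _ _ h, zero_mul, mul_zero]

lemma IsTCKFamily.mul_star_mul_mul_star (hfa : Λ.FinitelyAligned) (hq : IsTCKFamily q)
    (μ ν σ τ : Λ.Path) : (q μ * star (q ν)) * (q σ * star (q τ)) =
      ∑ p ∈ (hfa ν σ).toFinset, (q μ * q p.1) * star (q τ * q p.2) := by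
  rw [show (q μ * star (q ν)) * (q σ * star (q τ)) = q μ * (star (q ν) * q σ) * star (q τ) by
    simp only [mul_assoc], hq.star_mul_eq, finsum_mem_eq_finite_toFinset_sum _ (hfa ν σ),
    Finset.mul_sum, Finset.sum_mul]
  exact Finset.sum_congr rfl fun p _ => by simp only [star_mul, mul_assoc]

lemma gap_empty (v : Λ.Obj) : gap q v ∅ = q (Λ.vertex v) := by
  simp [gap]

lemma IsTCKFamily.gap_insert (hfa : Λ.FinitelyAligned) (hq : IsTCKFamily q) (v : Λ.Obj)
    {E : Finset Λ.Path} {a : Λ.Path} (ha : a ∉ E) :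
    gap q v (insert a E) = (q (Λ.vertex v) - q a * star (q a)) * gap q v E := by
  rw [hq.gap_eq hfa v _ _ (Finset.toList_insert ha).symm, List.map_cons, List.foldr_cons]
  rfl

lemma IsTCKFamily.gap_mul_eq_self (hfa : Λ.FinitelyAligned) (hq : IsTCKFamily q) {v : Λ.Obj}
    {E : Finset Λ.Path} {x : B} (hx : q (Λ.vertex v) * x = x) (h : ∀ β ∈ E, star (q β) * x = 0) :
    gap q v E * x = x := by
  induction E using Finset.induction_on with
  | empty => rw [gap_empty, hx]
  | insert a E ha ih =>
    rw [hq.gap_insert hfa v ha, mul_assoc, ih fun β hβ => h β (Finset.mem_insert_of_mem hβ),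
      sub_mul, hx, mul_assoc, h a (Finset.mem_insert_self a E), mul_zero, sub_zero]

lemma IsTCKFamily.mul_gap_eq_self (hfa : Λ.FinitelyAligned) (hq : IsTCKFamily q) {v : Λ.Obj}
    {E : Finset Λ.Path} {x : B} (hx : x * q (Λ.vertex v) = x) (h : ∀ β ∈ E, x * q β = 0) :
    x * gap q v E = x := by
  induction E using Finset.induction_on with
  | empty => rw [gap_empty, hx]
  | insert a E ha ih =>
    rw [hq.gap_insert hfa v ha, ← mul_assoc, mul_sub, hx, ← mul_assoc,
      h a (Finset.mem_insert_self a E), zero_mul, sub_zero,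
      ih fun β hβ => h β (Finset.mem_insert_of_mem hβ)]

lemma IsTCKFamily.vertex_mul_gap (hfa : Λ.FinitelyAligned) (hq : IsTCKFamily q) {v : Λ.Obj}
    {E : Finset Λ.Path} (hE : ∀ β ∈ E, β.rng = v) :
    q (Λ.vertex v) * gap q v E = gap q v E := by
  have hv := (hq.isStarProjection v).isIdempotentElem.eq
  induction E using Finset.induction_on with
  | empty => rw [gap_empty, hv]
  | insert a E ha ih =>
    obtain rfl := hE a (Finset.mem_insert_self a E)
    rw [hq.gap_insert hfa _ ha, ← mul_assoc, mul_sub, hv, ← mul_assoc, hq.vertex_mul]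

lemma IsTCKFamily.star_mul_gap (hfa : Λ.FinitelyAligned) (hq : IsTCKFamily q) {E : Finset Λ.Path}
    {β : Λ.Path} (hβ : β ∈ E) : star (q β) * gap q β.rng E = 0 := by
  rw [← Finset.insert_erase hβ, hq.gap_insert hfa _ (Finset.notMem_erase β E), ← mul_assoc,
    mul_sub, hq.star_mul_vertex, ← mul_assoc, hq.star_mul_self, hq.vertex_mul_star, sub_self,
    zero_mul]

lemma gap_image_incl {i : ι} (hfa : Λ.FinitelyAligned) (hq : IsTCKFamily q) (v : Λ.Obj)
    (E : Finset (Λ.deleteColour i).Path) :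
    gap q v (E.image incl) = gap (Λ := Λ.deleteColour i) (fun μ => q (incl μ)) v E := by
  have hl : (E.toList.map incl).Perm (E.image incl).toList := by
    refine (List.perm_ext_iff_of_nodup (E.nodup_toList.map incl_injective)
      (Finset.nodup_toList _)).2 fun a => ?_
    simp
  rw [hq.gap_eq hfa v _ _ hl, List.map_map]
  rfl

/-! ### The inclusion-exclusion formula for gaps -/

lemma IsTCKFamily.range_mul_range (hfa : Λ.FinitelyAligned) (hq : IsTCKFamily q) (μ ν : Λ.Path) :
    (q μ * star (q μ)) * (q ν * star (q ν)) = ∑ᶠ κ ∈ mce {μ, ν}, q κ * star (q κ) := by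
  have hfin := mce_finite hfa {μ, ν} (by simp)
  rw [hq.mul_star_mul_mul_star hfa, finsum_mem_eq_finite_toFinset_sum _ hfin]
  refine Finset.sum_bij
    (fun p hp => μ.comp p.1 ((hfa μ ν).mem_toFinset.1 hp).choose) ?_ ?_ ?_ ?_
  · intro p hp
    obtain ⟨h₁, h₂, e, hd⟩ := (hfa μ ν).mem_toFinset.1 hp
    exact hfin.mem_toFinset.2 (mem_mce_pair.2 ⟨⟨p.1, h₁, rfl⟩, ⟨p.2, h₂, e.symm⟩, hd⟩)
  · intro p hp p' hp' e'
    obtain ⟨h₁, h₂, e, hd⟩ := (hfa μ ν).mem_toFinset.1 hp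
    obtain ⟨h₁', h₂', e₁, hd'⟩ := (hfa μ ν).mem_toFinset.1 hp'
    refine Prod.ext (Path.comp_left_cancel _ _ e') (Path.comp_left_cancel h₂ h₂' ?_)
    rw [← e, ← e₁]
    exact e'
  · intro κ hκ
    obtain ⟨⟨α, hα, e⟩, ⟨β, hβ, e'⟩, hd⟩ := mem_mce_pair.1 (hfin.mem_toFinset.1 hκ)
    exact ⟨(α, β), (hfa μ ν).mem_toFinset.2 ⟨hα, hβ, e.trans e'.symm, by rw [← hd, ← e]⟩, e⟩
  · intro p hp
    obtain ⟨h₁, h₂, e, hd⟩ := (hfa μ ν).mem_toFinset.1 hp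
    rw [hq.mul_eq _ _ h₁, hq.mul_eq _ _ h₂, e]

/-- Minimal common extensions of `G ∪ {a}` are minimal common extensions of `a` and a minimal common
extension of `G`. -/
lemma mce_insert {a : Λ.Path} {G : Finset Λ.Path} :
    mce (insert a G) = ⋃ κ ∈ mce G, mce {a, κ} := by
  ext τ
  simp only [Set.mem_iUnion, exists_prop, mem_mce_pair]
  constructor
  · rintro ⟨h, hd⟩
    rw [Finset.sup_insert] at hd
    obtain ⟨κ, hκτ, hκ⟩ := τ.exists_isPrefix (m := G.sup Path.d) (by rw [hd]; exact le_sup_right)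
    refine ⟨κ, ⟨fun ν hν => (h ν (Finset.mem_insert_of_mem hν)).of_le hκτ ?_, hκ⟩,
      h a (Finset.mem_insert_self a G), hκτ, by rw [hd, hκ]⟩
    rw [hκ]
    exact Finset.le_sup (f := Path.d) hν
  · rintro ⟨κ, ⟨hκ, hκd⟩, ha, hκτ, hd⟩
    refine ⟨fun ν hν => ?_, by rw [hd, hκd, Finset.sup_insert]⟩
    rcases Finset.mem_insert.1 hν with rfl | hν
    · exact ha
    · exact (hκ ν hν).trans hκτ

lemma IsTCKFamily.range_mul_sum_mce (hfa : Λ.FinitelyAligned) (hq : IsTCKFamily q) (a : Λ.Path)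
    {G : Finset Λ.Path} (hG : G.Nonempty) :
    (q a * star (q a)) * ∑ᶠ κ ∈ mce G, q κ * star (q κ) =
      ∑ᶠ κ ∈ mce (insert a G), q κ * star (q κ) := by
  rw [mce_insert, finsum_mem_biUnion]
  · rw [finsum_mem_eq_finite_toFinset_sum _ (mce_finite hfa G hG), Finset.mul_sum,
      finsum_mem_eq_finite_toFinset_sum _ (mce_finite hfa G hG)]
    exact Finset.sum_congr rfl fun κ _ => hq.range_mul_range hfa a κ
  · intro κ hκ κ' hκ' hne
    refine Set.disjoint_left.2 fun τ hτ hτ' => hne ?_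
    exact (mem_mce_pair.1 hτ).2.1.eq_of_d_eq (mem_mce_pair.1 hτ').2.1 (hκ.2.trans hκ'.2.symm)
  · exact mce_finite hfa G hG
  · exact fun κ _ => mce_finite hfa _ (by simp)

/-- The product of the projections `q_λ q_λ^*` with `λ ∈ G`, for a finite subset `G` of `vΛ`; its
value is `q_v` for `G = ∅`. -/
noncomputable def rangeProd (q : Λ.Path → B) (v : Λ.Obj) (G : Finset Λ.Path) : B :=
  if G.Nonempty then ∑ᶠ κ ∈ mce G, q κ * star (q κ) else q (Λ.vertex v)

lemma mce_singleton (a : Λ.Path) : mce {a} = {a} := by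
  ext κ
  constructor
  · rintro ⟨h, hd⟩
    exact (Path.IsPrefix.eq_of_d_eq (h a (by simp)) (.refl κ) (by simpa using hd.symm)).symm
  · rintro rfl
    exact ⟨by simpa using Path.IsPrefix.refl _, by simp⟩

lemma IsTCKFamily.range_mul_rangeProd (hfa : Λ.FinitelyAligned) (hq : IsTCKFamily q) (a : Λ.Path)
    (G : Finset Λ.Path) :
    (q a * star (q a)) * rangeProd q a.rng G = rangeProd q a.rng (insert a G) := by
  rw [rangeProd, rangeProd, if_pos (Finset.insert_nonempty a G)]
  split_ifs with hG
  · exact hq.range_mul_sum_mce hfa a hG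
  · rw [Finset.not_nonempty_iff_eq_empty.1 hG, insert_empty_eq, mce_singleton,
      finsum_mem_singleton, mul_assoc, hq.star_mul_vertex]

/-- Inclusion-exclusion: expanding the product `Δ(q)^E`. -/
lemma IsTCKFamily.gap_eq_sum (hfa : Λ.FinitelyAligned) (hq : IsTCKFamily q) {v : Λ.Obj}
    {E : Finset Λ.Path} (hE : ∀ β ∈ E, β.rng = v) :
    gap q v E = ∑ G ∈ E.powerset, (-1 : ℂ) ^ G.card • rangeProd q v G := by
  induction E using Finset.induction_on with
  | empty => simp [gap_empty, rangeProd]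
  | insert a E ha ih =>
    have hE' : ∀ β ∈ E, β.rng = v := fun β hβ => hE β (Finset.mem_insert_of_mem hβ)
    rw [hq.gap_insert hfa v ha, sub_mul, hq.vertex_mul_gap hfa hE', ih hE',
      Finset.sum_powerset_insert ha, sub_eq_add_neg, Finset.mul_sum, ← Finset.sum_neg_distrib]
    congr 1
    refine Finset.sum_congr rfl fun G hG => ?_
    obtain rfl := hE a (Finset.mem_insert_self a E)
    rw [mul_smul_comm, hq.range_mul_rangeProd hfa,
      Finset.card_insert_of_notMem fun h => ha (Finset.mem_powerset.1 hG h), pow_succ, mul_neg_one,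
      neg_smul]

/-- If `Δ(q)^{E ∪ F} = 0`, then `Δ(q)^E` is an alternating sum of the projections `q_μ q_μ^*` over
the minimal common extensions `μ` of the subsets of `E ∪ F` that meet `F`. -/
lemma IsTCKFamily.gap_eq_sum_of_union (hfa : Λ.FinitelyAligned) (hq : IsTCKFamily q) {v : Λ.Obj}
    {E F : Finset Λ.Path} (hE : ∀ β ∈ E, β.rng = v) (hF : ∀ β ∈ F, β.rng = v)
    (hEF : Disjoint E F) (h0 : gap q v (E ∪ F) = 0) :
    gap q v E = ∑ G ∈ (E ∪ F).powerset with (G ∩ F).Nonempty,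
      ∑ᶠ μ ∈ mce G, (-1 : ℂ) ^ (G.card + 1) • (q μ * star (q μ)) := by
  rw [hq.gap_eq_sum hfa (by simpa [or_imp, forall_and] using ⟨hE, hF⟩),
    ← Finset.sum_filter_add_sum_filter_not _ fun G => (G ∩ F).Nonempty] at h0
  have e : (E ∪ F).powerset.filter (fun G => ¬ (G ∩ F).Nonempty) = E.powerset := by
    ext G
    simp only [Finset.mem_filter, Finset.mem_powerset, Finset.not_nonempty_iff_eq_empty,
      ← Finset.disjoint_iff_inter_eq_empty]
    constructor
    · rintro ⟨h, hd⟩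
      exact hd.left_le_of_le_sup_right h
    · exact fun h => ⟨h.trans Finset.subset_union_left, hEF.mono_left h⟩
  rw [e, ← hq.gap_eq_sum hfa hE] at h0
  rw [eq_neg_of_add_eq_zero_right h0, ← Finset.sum_neg_distrib]
  refine Finset.sum_congr rfl fun G hG => ?_
  have hne : G.Nonempty := (Finset.mem_filter.1 hG).2.mono Finset.inter_subset_left
  rw [rangeProd, if_pos hne, pow_succ, mul_neg_one, ← neg_smul,
    finsum_mem_eq_finite_toFinset_sum _ (mce_finite hfa G hne),
    finsum_mem_eq_finite_toFinset_sum _ (mce_finite hfa G hne), Finset.smul_sum]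

end Calculus

/-! ### Homomorphisms that do not vanish on vertices are isometric on the core -/

section Core

variable {A : Type*} [NonUnitalCStarAlgebra A] {q : Λ.Path → A}
variable {B : Type*} [NonUnitalCStarAlgebra B]

/-- The part of the core that is spanned by the elements `q_μ q_ν^*` with `μ, ν ∈ M`, `d(μ) = d(ν)`
and `s(μ) = s(ν)`. For `M = Λ` this is the span of the elements of degree zero. -/
def coreSpan (q : Λ.Path → A) (M : Set Λ.Path) : Submodule ℂ A :=
  Submodule.span ℂ {x | ∃ μ ∈ M, ∃ ν ∈ M, μ.d = ν.d ∧ μ.src = ν.src ∧ x = q μ * star (q ν)}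

lemma coreSpan_mono {M M' : Set Λ.Path} (h : M ⊆ M') : coreSpan q M ≤ coreSpan q M' :=
  Submodule.span_mono fun _ ⟨μ, hμ, ν, hν, hx⟩ => ⟨μ, h hμ, ν, h hν, hx⟩

lemma star_mem_coreSpan {M : Set Λ.Path} {x : A} (hx : x ∈ coreSpan q M) :
    star x ∈ coreSpan q M := by
  induction hx using Submodule.span_induction with
  | mem x hx =>
    obtain ⟨μ, hμ, ν, hν, hd, hs, rfl⟩ := hx
    exact Submodule.subset_span ⟨ν, hν, μ, hμ, hd.symm, hs.symm, by rw [star_mul, star_star]⟩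
  | zero => rw [star_zero]; exact zero_mem _
  | add x y _ _ hx hy => rw [star_add]; exact add_mem hx hy
  | smul c x _ hx => rw [star_smul]; exact Submodule.smul_mem _ _ hx

/-- The core elements on a set of paths that is closed under minimal common extensions and exchanges
form an algebra. -/
lemma mul_mem_coreSpan (hfa : Λ.FinitelyAligned) (hq : IsTCKFamily q) {S : Set Λ.Path} {x y : A}
    (hx : x ∈ coreSpan q {κ | SwapClosure S κ}) (hy : y ∈ coreSpan q {κ | SwapClosure S κ}) :
    x * y ∈ coreSpan q {κ | SwapClosure S κ} := by
  induction hx using Submodule.span_induction with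
  | zero => rw [zero_mul]; exact zero_mem _
  | add x x' _ _ hx hx' => rw [add_mul]; exact add_mem hx hx'
  | smul c x _ hx => rw [smul_mul_assoc]; exact Submodule.smul_mem _ _ hx
  | mem x hx =>
  induction hy using Submodule.span_induction with
  | zero => rw [mul_zero]; exact zero_mem _
  | add y y' _ _ hy hy' => rw [mul_add]; exact add_mem hy hy'
  | smul c y _ hy => rw [mul_smul_comm]; exact Submodule.smul_mem _ _ hy
  | mem y hy =>
  obtain ⟨μ, hμ, ν, hν, hd, hs, rfl⟩ := hx
  obtain ⟨σ, hσ, τ, hτ, hd', hs', rfl⟩ := hy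
  rw [hq.mul_star_mul_mul_star hfa]
  refine sum_mem fun p hp => ?_
  obtain ⟨h₁, h₂, e, hp⟩ := (hfa ν σ).mem_toFinset.1 hp
  have hκ : SwapClosure S (ν.comp p.1 h₁) :=
    .mce hν hσ (mem_mce_pair.2 ⟨⟨_, h₁, rfl⟩, ⟨_, h₂, e.symm⟩, hp⟩)
  rw [hq.mul_eq _ _ (hs.trans h₁), hq.mul_eq _ _ (hs'.symm.trans h₂)]
  refine Submodule.subset_span ⟨_, .swap (hs.trans h₁) h₁ hμ hν hd rfl rfl hκ, _,
    .swap (hs'.symm.trans h₂) h₂ hτ hσ hd'.symm e.symm rfl hκ, ?_, ?_, rfl⟩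
  · have := congrArg Path.d e
    rw [Path.comp_d, Path.comp_d] at this
    rw [Path.comp_d, Path.comp_d, hd, ← hd', this]
  · have := congrArg Path.src e
    rwa [Path.comp_src, Path.comp_src] at this ⊢

/-- The image of `Δ(q)^E` vanishes only if `E` is exhaustive. -/
lemma IsTCKFamily.isFE_of_map_gap_eq_zero (hfa : Λ.FinitelyAligned) (hq : IsTCKFamily q)
    (π : A →⋆ₙₐ[ℂ] B) (hπ : ∀ v, π (q (Λ.vertex v)) ≠ 0) {v : Λ.Obj} {E : Finset Λ.Path}
    (hE : ∀ β ∈ E, β.rng = v ∧ β ≠ Λ.vertex v) (h0 : π (gap q v E) = 0) : Λ.IsFE v E := by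
  refine ⟨Set.mem_univ _, fun β hβ => ⟨Set.mem_univ _, hE β hβ⟩, fun μ _ hμ => ?_⟩
  by_contra! hcon
  have hmiss : ∀ β ∈ E, minExt μ β = ∅ := fun β hβ =>
    Set.eq_empty_of_forall_notMem fun p hp => hcon β hβ p hp (Set.mem_univ _) (Set.mem_univ _)
  have e : gap q v E * q μ = q μ := by
    refine hq.gap_mul_eq_self hfa (by rw [← hμ, hq.vertex_mul]) fun β hβ => ?_
    refine hq.star_mul_eq_zero (Set.not_nonempty_iff_eq_empty.1 fun hne => ?_)
    exact (minExt_swap hne).ne_empty (hmiss β hβ)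
  refine hπ μ.src ?_
  rw [← hq.star_mul_self, ← e, map_mul, map_mul, h0, zero_mul, mul_zero]

/-- The paths `α` of positive degree with `λα ∈ M`. -/
def properTails (M : Set Λ.Path) (lam : Λ.Path) : Set Λ.Path :=
  {α | α.d ≠ 0 ∧ ∃ h : lam.src = α.rng, lam.comp α h ∈ M}

lemma finite_properTails {M : Set Λ.Path} (hM : M.Finite) (lam : Λ.Path) :
    (properTails M lam).Finite := by
  classical
  let f : Λ.Path → Λ.Path := fun α => if h : lam.src = α.rng then lam.comp α h else α
  refine Set.Finite.of_finite_image (f := f) (hM.subset ?_) ?_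
  · rintro _ ⟨α, ⟨-, h, hα⟩, rfl⟩
    simpa only [f, dif_pos h] using hα
  · rintro α ⟨-, h, -⟩ β ⟨-, h', -⟩ e
    simp only [f, dif_pos h, dif_pos h'] at e
    exact Path.comp_left_cancel _ _ e

/-- If `M` is closed under minimal common extensions, then multiplication by `q_λ Δ(q)^E`, where `E`
is the set of the proper tails of `λ ∈ M`, maps the core elements on `M` to combinations of the
elements `q_κ Δ(q)^E` with `d(κ) = d(λ)`. -/
lemma mul_gap_mem_span (hfa : Λ.FinitelyAligned) (hq : IsTCKFamily q) {M : Set Λ.Path}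
    (hmce : ∀ ν ∈ M, ∀ σ ∈ M, mce {ν, σ} ⊆ M) {lam : Λ.Path} (hlam : lam ∈ M)
    {E : Finset Λ.Path} (hE : (E : Set Λ.Path) = properTails M lam) {a : A}
    (ha : a ∈ coreSpan q M) :
    a * q lam * gap q lam.src E ∈ Submodule.span ℂ
      (Set.range fun κ : {κ : Λ.Path // κ.d = lam.d ∧ κ.src = lam.src} =>
        q κ.1 * gap q lam.src E) := by
  have hmemE : ∀ β, β ∈ E ↔ β ∈ properTails M lam := fun β => by rw [← hE, Finset.mem_coe]
  have hEr : ∀ β ∈ E, β.rng = lam.src := fun β hβ => ((hmemE β).1 hβ).2.choose.symm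
  induction ha using Submodule.span_induction with
  | zero => rw [zero_mul, zero_mul]; exact zero_mem _
  | add x x' _ _ hx hx' => rw [add_mul, add_mul]; exact add_mem hx hx'
  | smul c x _ hx => rw [smul_mul_assoc, smul_mul_assoc]; exact Submodule.smul_mem _ _ hx
  | mem x hx =>
  obtain ⟨μ, hμ, ν, hν, hd, hs, rfl⟩ := hx
  rw [show q μ * star (q ν) * q lam * gap q lam.src E =
      q μ * (star (q ν) * q lam) * gap q lam.src E by simp only [mul_assoc], hq.star_mul_eq,
    finsum_mem_eq_finite_toFinset_sum _ (hfa ν lam), Finset.mul_sum, Finset.sum_mul]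
  refine sum_mem fun p hp => ?_
  obtain ⟨h₁, h₂, e, hp⟩ := (hfa ν lam).mem_toFinset.1 hp
  rw [show q μ * (q p.1 * star (q p.2)) * gap q lam.src E =
      (q μ * q p.1) * (star (q p.2) * gap q lam.src E) by simp only [mul_assoc]]
  by_cases h0 : p.2.d = 0
  · have e2 : p.2 = Λ.vertex lam.src := Path.eq_vertex h₂.symm h0
    rw [e2, (hq.isStarProjection _).isSelfAdjoint.star_eq, hq.vertex_mul_gap hfa hEr,
      hq.mul_eq _ _ (hs.trans h₁)]
    refine Submodule.subset_span ⟨⟨μ.comp p.1 (hs.trans h₁), ?_, ?_⟩, rfl⟩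
    · have := congrArg Path.d e
      rw [Path.comp_d, Path.comp_d, h0, add_zero] at this
      rw [Path.comp_d, hd, this]
    · have := congrArg Path.src e
      rw [Path.comp_src, Path.comp_src, e2] at this
      rw [Path.comp_src, this]
      rfl
  · have hmem : p.2 ∈ E := (hmemE _).2 ⟨h0, h₂, hmce ν hν lam hlam
      (mem_mce_pair.2 ⟨⟨_, h₁, e⟩, ⟨_, h₂, rfl⟩, by rw [← e, hp]⟩)⟩
    rw [h₂, hq.star_mul_gap hfa hmem, mul_zero]
    exact zero_mem _

/-- A homomorphism is injective on the span of the elements `q_κ Δ(q)^E` with a fixed degree of `κ`,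
unless it annihilates `Δ(q)^E`. -/
lemma eq_zero_of_mem_span_mul_gap (hq : IsTCKFamily q) (π : A →⋆ₙₐ[ℂ] B)
    {n : ι → ℕ} {v : Λ.Obj} {g : A} (hg : q (Λ.vertex v) * g = g) (hπ : π g = 0 → g = 0) {w : A}
    (hw : w ∈ Submodule.span ℂ
      (Set.range fun κ : {κ : Λ.Path // κ.d = n ∧ κ.src = v} => q κ.1 * g))
    (h0 : π w = 0) : w = 0 := by
  by_cases hg0 : g = 0
  · have : (fun κ : {κ : Λ.Path // κ.d = n ∧ κ.src = v} => q κ.1 * g) = fun _ => 0 := by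
      funext κ
      rw [hg0, mul_zero]
    rw [this] at hw
    obtain ⟨c, rfl⟩ := Finsupp.mem_span_range_iff_exists_finsupp.1 hw
    simp
  obtain ⟨c, rfl⟩ := Finsupp.mem_span_range_iff_exists_finsupp.1 hw
  suffices hc : c = 0 by rw [hc, Finsupp.sum_zero_index]
  ext κ
  have key : star (q κ.1) * (c.sum fun κ a => a • (q κ.1 * g)) = c κ • g := by
    rw [Finsupp.sum, Finset.mul_sum, Finset.sum_eq_single κ]
    · rw [mul_smul_comm, ← mul_assoc, hq.star_mul_self, κ.2.2, hg]
    · intro κ' _ hne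
      rw [mul_smul_comm, ← mul_assoc,
        hq.star_mul_eq_zero_of_d_eq (κ.2.1.trans κ'.2.1.symm) fun h => hne (Subtype.ext h).symm,
        zero_mul, smul_zero]
    · intro h
      rw [Finsupp.notMem_support_iff.1 h, zero_smul, mul_zero]
  have h1 : π (c κ • g) = 0 := by rw [← key, map_mul, h0, mul_zero]
  rw [map_smul] at h1
  exact (smul_eq_zero.1 h1).resolve_right fun h => hg0 (hπ h)

/-- A homomorphism that is nonzero on the vertex projections is injective on the core elements on a
finite set `M` of paths that is closed under minimal common extensions: if `π a = 0`, then `a q_λ = 0`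
for `λ ∈ M`, by induction on how much the length of `λ` falls short of the maximal length in `M`. -/
lemma eq_zero_of_mem_coreSpan [Fintype ι] (hfa : Λ.FinitelyAligned) (hq : IsCKFamily q)
    (π : A →⋆ₙₐ[ℂ] B) (hπ : ∀ v, π (q (Λ.vertex v)) ≠ 0) {M : Set Λ.Path} (hM : M.Finite)
    (hmce : ∀ ν ∈ M, ∀ σ ∈ M, mce {ν, σ} ⊆ M) {a : A} (ha : a ∈ coreSpan q M) (h0 : π a = 0) :
    a = 0 := by
  have hq' := hq.toIsTCKFamily
  have key : ∀ n : ℕ, ∀ lam ∈ M, (hM.toFinset.sup fun κ => ∑ j, κ.d j) - ∑ j, lam.d j = n →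
      a * q lam = 0 := by
    intro n
    induction n using Nat.strong_induction_on with
    | _ n ih =>
    intro lam hlam hn
    set E := (finite_properTails hM lam).toFinset with hE
    have hEmem : ∀ β, β ∈ E ↔ β ∈ properTails M lam := fun β => Set.Finite.mem_toFinset _
    have hEr : ∀ β ∈ E, β.rng = lam.src ∧ β ≠ Λ.vertex lam.src := fun β hβ => by
      obtain ⟨hd, h, -⟩ := (hEmem β).1 hβ
      exact ⟨h.symm, fun e => hd (by rw [e, vertex_d])⟩
    rw [← hq'.mul_gap_eq_self hfa (x := a * q lam) (E := E) (v := lam.src)]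
    · refine eq_zero_of_mem_span_mul_gap hq' π
        (hq'.vertex_mul_gap hfa fun β hβ => (hEr β hβ).1) (fun h => ?_)
        (mul_gap_mem_span hfa hq' hmce hlam (Set.Finite.coe_toFinset _) ha) ?_
      · exact hq.gap_eq_zero _ _ (hq'.isFE_of_map_gap_eq_zero hfa π hπ hEr h)
      · rw [map_mul, map_mul, h0, zero_mul, zero_mul]
    · rw [mul_assoc, hq'.mul_vertex]
    · intro β hβ
      obtain ⟨hd, h, hβM⟩ := (hEmem β).1 hβ
      rw [mul_assoc, hq'.mul_eq _ _ h]
      refine ih _ ?_ _ hβM rfl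
      have hle := Finset.le_sup (f := fun κ : Λ.Path => ∑ j, κ.d j) (hM.mem_toFinset.2 hβM)
      have hpos : 0 < ∑ j, β.d j := by
        rw [Nat.pos_iff_ne_zero]
        intro h
        exact hd (funext fun j => Finset.sum_eq_zero_iff.1 h j (Finset.mem_univ j))
      simp only [Path.comp_d, Pi.add_apply, Finset.sum_add_distrib] at hle ⊢
      omega
  have hstar : ∀ x ∈ coreSpan q M, a * star x = 0 := by
    intro x hx
    induction hx using Submodule.span_induction with
    | zero => rw [star_zero, mul_zero]
    | add x y _ _ hx hy => rw [star_add, mul_add, hx, hy, add_zero]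
    | smul c x _ hx => rw [star_smul, mul_smul_comm, hx, smul_zero]
    | mem x hx =>
      obtain ⟨μ, hμ, ν, hν, -, -, rfl⟩ := hx
      rw [star_mul, star_star, ← mul_assoc, key _ ν hν rfl, zero_mul]
  exact (CStarRing.mul_star_self_eq_zero_iff a).1 (hstar a ha)

lemma exists_finite_of_mem_coreSpan {a : A} (ha : a ∈ coreSpan q Set.univ) :
    ∃ S : Set Λ.Path, S.Finite ∧ a ∈ coreSpan q S := by
  induction ha using Submodule.span_induction with
  | zero => exact ⟨∅, Set.finite_empty, zero_mem _⟩
  | add x y _ _ hx hy =>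
    obtain ⟨S, hS, hx⟩ := hx
    obtain ⟨T, hT, hy⟩ := hy
    exact ⟨S ∪ T, hS.union hT, add_mem (coreSpan_mono Set.subset_union_left hx)
      (coreSpan_mono Set.subset_union_right hy)⟩
  | smul c x _ hx =>
    obtain ⟨S, hS, hx⟩ := hx
    exact ⟨S, hS, Submodule.smul_mem _ _ hx⟩
  | mem x hx =>
    obtain ⟨μ, -, ν, -, h⟩ := hx
    exact ⟨{μ, ν}, by simp, Submodule.subset_span ⟨μ, by simp, ν, by simp, h⟩⟩

/-- A homomorphism that is nonzero on the vertex projections of a Cuntz-Krieger family is isometric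
on the core: each element of the core lies in a finite-dimensional C*-subalgebra on which the
homomorphism is injective. -/
lemma norm_map_of_mem_coreSpan [Fintype ι] (hfa : Λ.FinitelyAligned) (hq : IsCKFamily q)
    (π : A →⋆ₙₐ[ℂ] B) (hπ : ∀ v, π (q (Λ.vertex v)) ≠ 0) {a : A}
    (ha : a ∈ coreSpan q Set.univ) : ‖π a‖ = ‖a‖ := by
  obtain ⟨S, hS, haS⟩ := exists_finite_of_mem_coreSpan ha
  set M : Set Λ.Path := {κ | SwapClosure S κ} with hMdef
  have hM : M.Finite := SwapClosure.finite hfa hS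
  have haM : a ∈ coreSpan q M := coreSpan_mono (fun κ hκ => SwapClosure.base hκ) haS
  let V : NonUnitalStarSubalgebra ℂ A :=
    { carrier := coreSpan q M
      add_mem' := fun h h' => (coreSpan q M).add_mem h h'
      zero_mem' := (coreSpan q M).zero_mem
      smul_mem' := fun c _ h => (coreSpan q M).smul_mem c h
      mul_mem' := fun h h' => mul_mem_coreSpan hfa hq.toIsTCKFamily h h'
      star_mem' := fun h => star_mem_coreSpan h }
  have hfin : FiniteDimensional ℂ (coreSpan q M) := by
    refine FiniteDimensional.span_of_finite ℂ
      (((hM.prod hM).image fun p => q p.1 * star (q p.2)).subset ?_)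
    rintro _ ⟨μ, hμ, ν, hν, -, -, rfl⟩
    exact ⟨(μ, ν), ⟨hμ, hν⟩, rfl⟩
  have hclosed : IsClosed (V : Set A) := (coreSpan q M).closed_of_finiteDimensional
  let πV : V →⋆ₙₐ[ℂ] B := π.comp (NonUnitalStarSubalgebraClass.subtype V)
  have hinj : Function.Injective πV := by
    refine (injective_iff_map_eq_zero πV).2 fun x hx => Subtype.ext ?_
    exact eq_zero_of_mem_coreSpan hfa hq π hπ hM (fun ν hν σ hσ κ hκ => .mce hν hσ hκ) x.2 hx
  exact NonUnitalStarAlgHom.norm_map πV hinj ⟨a, haM⟩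

end Core

end HigherRankGraph

/-! ### Averaging over a compact group -/

section Averaging

open MeasureTheory

/-- A continuous function with positive values in a C*-algebra vanishes if its integral does. -/
lemma Continuous.eq_zero_of_integral_eq_zero_of_nonneg {T : Type*} [TopologicalSpace T]
    [MeasurableSpace T] [BorelSpace T] [CompactSpace T] (m : Measure T) [m.IsOpenPosMeasure]
    [IsFiniteMeasure m] {A : Type*} [NonUnitalCStarAlgebra A] [PartialOrder A] [StarOrderedRing A]
    {f : T → A} (hf : Continuous f) (hint : Integrable f m) (hpos : ∀ t, 0 ≤ f t)
    (h0 : ∫ t, f t ∂m = 0) (t : T) : f t = 0 := by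
  by_contra hne
  have hn : 0 < ‖f t‖ := norm_pos_iff.2 hne
  set U : Set T := {s | ‖f s - f t‖ < ‖f t‖ / 2} with hU
  have hUo : IsOpen U := isOpen_lt (by fun_prop) continuous_const
  have hUpos : 0 < m.real U := by
    refine ENNReal.toReal_pos (hUo.measure_pos m ⟨t, ?_⟩).ne' (measure_ne_top m U)
    simpa [hU] using hn
  have hsum := integral_add_compl hUo.measurableSet hint
  rw [h0] at hsum
  have h1 : ∫ s in U, f s ∂m = 0 := by
    refine le_antisymm ?_ (integral_nonneg hpos)
    rw [eq_neg_of_add_eq_zero_left hsum]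
    exact neg_nonpos.2 (integral_nonneg hpos)
  have h2 : ∫ s in U, (f s - f t) ∂m = - (m.real U • f t) := by
    rw [integral_sub hint.integrableOn (integrable_const _), h1, setIntegral_const, zero_sub]
  have h3 := norm_setIntegral_le_of_norm_le_const (μ := m) (s := U) (measure_lt_top m U)
    (f := fun s => f s - f t) (C := ‖f t‖ / 2) fun s hs => le_of_lt hs
  rw [h2, norm_neg, norm_smul, Real.norm_of_nonneg hUpos.le] at h3
  nlinarith

/-- Let a compact group `T` act strongly continuously on a C*-algebra that is densely spanned by
eigenvectors, those for the trivial character lying in `C`. A homomorphism with `T`-invariant kernel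
that is isometric on `C` is injective: averaging over `T` maps the kernel into the closure of `C`,
and is faithful on positive elements. -/
theorem injective_of_isometric_on_fixed {T : Type*} [Group T] [TopologicalSpace T]
    [IsTopologicalGroup T] [CompactSpace T] {A B : Type*} [NonUnitalCStarAlgebra A]
    [NonUnitalCStarAlgebra B] (γ : T → A →⋆ₙₐ[ℂ] A) (hγ : ∀ a, Continuous fun z => γ z a)
    (hγ1 : ∀ a, γ 1 a = a) (C : Submodule ℂ A) (D : Set A)
    (hD : (Submodule.span ℂ D).topologicalClosure = ⊤)
    (hDC : ∀ x ∈ D, (x ∈ C ∧ ∀ z, γ z x = x) ∨ ∃ χ : T →* ℂ, (∀ z, γ z x = χ z • x) ∧ ∃ w, χ w ≠ 1)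
    (π : A →⋆ₙₐ[ℂ] B) (hker : ∀ z a, π a = 0 → π (γ z a) = 0) (hC : ∀ x ∈ C, ‖π x‖ = ‖x‖) :
    Function.Injective π := by
  borelize T
  let : PartialOrder A := CStarAlgebra.spectralOrder A
  have : StarOrderedRing A := CStarAlgebra.spectralOrderedRing A
  let m : Measure T := Measure.haar
  have hint : ∀ a, Integrable (fun z => γ z a) m := fun a =>
    (hγ a).integrable_of_hasCompactSupport (HasCompactSupport.of_compactSpace _)
  let Φ : A →ₗ[ℂ] A :=
    { toFun := fun a => ∫ z, γ z a ∂m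
      map_add' := fun a b => by
        simp only [map_add]
        exact integral_add (hint a) (hint b)
      map_smul' := fun c a => by
        simp only [map_smul, RingHom.id_apply]
        exact integral_smul c _ }
  have hΦ : Continuous Φ := by
    refine AddMonoidHomClass.continuous_of_bound Φ (m.real Set.univ) fun a => ?_
    rw [mul_comm]
    exact norm_integral_le_of_norm_le_const
      (Filter.Eventually.of_forall fun z => NonUnitalStarAlgHom.norm_apply_le (γ z) a)
  have hπ := continuous_nonUnitalStarAlgHom π
  have hΦC : ∀ a, Φ a ∈ C.topologicalClosure := by
    intro a
    have ha : a ∈ (Submodule.span ℂ D).topologicalClosure := hD ▸ Submodule.mem_top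
    refine closure_minimal (t := {a | Φ a ∈ C.topologicalClosure}) (fun x hx => ?_)
      (C.isClosed_topologicalClosure.preimage hΦ) ha
    refine (Submodule.span_le (p := C.topologicalClosure.comap Φ)).2 (fun x hx => ?_) hx
    change ∫ z, γ z x ∂m ∈ C.topologicalClosure
    rcases hDC x hx with ⟨hxC, h⟩ | ⟨χ, h, w, hw⟩
    · simp only [h, integral_const]
      exact Submodule.smul_of_tower_mem _ _ (C.le_topologicalClosure hxC)
    · have e := integral_mul_left_eq_self (μ := m) (fun z => γ z x) w
      simp only [h, map_mul, mul_smul] at e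
      rw [integral_smul] at e
      have h0 : (χ w - 1) • ∫ z, χ z • x ∂m = 0 := by rw [sub_smul, e, one_smul, sub_self]
      simp only [h, (smul_eq_zero.1 h0).resolve_left (sub_ne_zero.2 hw)]
      exact zero_mem _
  refine (injective_iff_map_eq_zero π).2 fun a ha => ?_
  set b : A := star a * a with hb
  have hπΦ : π (Φ b) = 0 := by
    let L : A →L[ℂ] B := ⟨(π : A →ₗ[ℂ] B), hπ⟩
    have e : ∫ z, L (γ z b) ∂m = L (Φ b) := L.integral_comp_comm (hint b)
    have e0 : ∀ z, L (γ z b) = 0 := fun z => hker z b (by rw [hb, map_mul, ha, mul_zero])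
    simp only [e0, integral_zero] at e
    exact e.symm
  have hΦb : Φ b = 0 := by
    have key : ‖π (Φ b)‖ = ‖Φ b‖ := by
      refine closure_minimal (t := {x | ‖π x‖ = ‖x‖}) hC
        (isClosed_eq hπ.norm continuous_norm) (hΦC b)
    rw [hπΦ, norm_zero] at key
    exact norm_eq_zero.1 key.symm
  have hb0 := (hγ b).eq_zero_of_integral_eq_zero_of_nonneg m (hint b)
    (fun z => by rw [hb, map_mul, map_star]; exact star_mul_self_nonneg _) hΦb 1
  rw [hγ1] at hb0
  exact (CStarRing.star_mul_self_eq_zero_iff a).1 hb0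

end Averaging

namespace HigherRankGraph

variable {ι : Type} {Λ : HigherRankGraph.{u} ι}

/-! ### Generators of the Cuntz-Krieger algebra -/

/-- Homomorphisms on `C*(Λ)` are determined by the values on the generators. -/
lemma ckAlgebra_hom_ext {B : Type*} [NonUnitalCStarAlgebra B] {f g : Λ.CKAlgebra →⋆ₙₐ[ℂ] B}
    (h : ∀ lam, f (ckGen lam) = g (ckGen lam)) (x : Λ.CKAlgebra) : f x = g x := by
  refine ckAlgebra_induction (p := fun x => f x = g x)
    (isClosed_eq (continuous_nonUnitalStarAlgHom f) (continuous_nonUnitalStarAlgHom g)) h ?_ ?_ ?_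
    ?_ ?_ x
  · intro lam
    rw [map_star, map_star, h]
  · rw [map_zero, map_zero]
  · intro x y hx hy
    rw [map_add, map_add, hx, hy]
  · intro c x hx
    rw [map_smul, map_smul, hx]
  · intro x y hx hy
    rw [map_mul, map_mul, hx, hy]

/-- The elements `s_μ s_ν^*` span a dense subspace of `C*(Λ)`. -/
lemma topologicalClosure_span_eq_top (hfa : Λ.FinitelyAligned) :
    (Submodule.span ℂ {x : Λ.CKAlgebra | ∃ μ ν : Λ.Path,
      x = ckGen μ * star (ckGen ν)}).topologicalClosure = ⊤ := by
  have hq := (isCKFamily_ckGen hfa).toIsTCKFamily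
  set V := Submodule.span ℂ {x : Λ.CKAlgebra | ∃ μ ν : Λ.Path, x = ckGen μ * star (ckGen ν)}
  have hV : ∀ μ ν : Λ.Path, ckGen μ * star (ckGen ν) ∈ V := fun μ ν =>
    Submodule.subset_span ⟨μ, ν, rfl⟩
  have hmul : ∀ x ∈ V, ∀ y ∈ V, x * y ∈ V := by
    intro x hx y hy
    induction hx using Submodule.span_induction with
    | zero => rw [zero_mul]; exact zero_mem _
    | add x x' _ _ hx hx' => rw [add_mul]; exact add_mem hx hx'
    | smul c x _ hx => rw [smul_mul_assoc]; exact Submodule.smul_mem _ _ hx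
    | mem x hx =>
    induction hy using Submodule.span_induction with
    | zero => rw [mul_zero]; exact zero_mem _
    | add y y' _ _ hy hy' => rw [mul_add]; exact add_mem hy hy'
    | smul c y _ hy => rw [mul_smul_comm]; exact Submodule.smul_mem _ _ hy
    | mem y hy =>
    obtain ⟨μ, ν, rfl⟩ := hx
    obtain ⟨σ, τ, rfl⟩ := hy
    rw [hq.mul_star_mul_mul_star hfa]
    refine sum_mem fun p hp => ?_
    by_cases h₁ : μ.src = p.1.rng
    · by_cases h₂ : τ.src = p.2.rng
      · rw [hq.mul_eq _ _ h₁, hq.mul_eq _ _ h₂]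
        exact hV _ _
      · rw [hq.mul_eq_zero _ _ h₂, star_zero, mul_zero]
        exact zero_mem _
    · rw [hq.mul_eq_zero _ _ h₁, zero_mul]
      exact zero_mem _
  refine Submodule.eq_top_iff'.2 fun x => ?_
  have hcl := V.isClosed_topologicalClosure
  refine ckAlgebra_induction (p := fun x => x ∈ V.topologicalClosure) hcl ?_ ?_ (zero_mem _)
    (fun x y hx hy => add_mem hx hy) (fun c x hx => Submodule.smul_mem _ c hx) ?_ x
  · intro lam
    have := hV lam (Λ.vertex lam.src)
    rw [(hq.isStarProjection _).isSelfAdjoint.star_eq, hq.mul_vertex] at this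
    exact V.le_topologicalClosure this
  · intro lam
    have := hV (Λ.vertex lam.src) lam
    rw [hq.vertex_mul_star] at this
    exact V.le_topologicalClosure this
  · intro x y hx hy
    exact map_mem_closure₂ continuous_mul hx hy hmul

/-! ### The gauge action -/

section Gauge

variable [Fintype ι]

/-- The number `z^d(μ)`, for a point `z` of the torus. -/
noncomputable def weight (z : ι → Circle) (μ : Λ.Path) : ℂ := ((∏ j, z j ^ μ.d j : Circle) : ℂ)

lemma weight_vertex (z : ι → Circle) (v : Λ.Obj) : weight z (Λ.vertex v) = 1 := by
  simp [weight]

lemma weight_comp (z : ι → Circle) (μ ν : Λ.Path) (h : μ.src = ν.rng) :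
    weight z (μ.comp ν h) = weight z μ * weight z ν := by
  simp [weight, Path.comp_d, pow_add, Finset.prod_mul_distrib]

lemma weight_mul_star (z : ι → Circle) (μ : Λ.Path) : weight z μ * star (weight z μ) = 1 := by
  rw [weight, RCLike.star_def, Complex.mul_conj, Circle.normSq_coe, Complex.ofReal_one]

lemma continuous_weight (μ : Λ.Path) : Continuous fun z : ι → Circle => weight z μ :=
  (by fun_prop : Continuous fun w : Circle => (w : ℂ)).comp
    (by fun_prop : Continuous fun z : ι → Circle => ∏ j, z j ^ μ.d j)

lemma IsCKFamily.twist (hfa : Λ.FinitelyAligned) {B : Type*} [NonUnitalCStarAlgebra B]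
    {q : Λ.Path → B} (hq : IsCKFamily q) (z : ι → Circle) :
    IsCKFamily fun μ => weight z μ • q μ where
  isStarProjection v := by
    simp only [weight_vertex, one_smul]
    exact hq.isStarProjection v
  orthogonal v w h := by
    simp only [weight_vertex, one_smul]
    exact hq.orthogonal v w h
  mul_eq μ ν h := by
    rw [smul_mul_smul_comm, hq.mul_eq _ _ h, weight_comp]
  star_mul_eq μ ν := by
    rw [star_smul, smul_mul_smul_comm, hq.star_mul_eq,
      finsum_mem_eq_finite_toFinset_sum _ (hfa μ ν), finsum_mem_eq_finite_toFinset_sum _ (hfa μ ν),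
      Finset.smul_sum]
    refine Finset.sum_congr rfl fun p hp => ?_
    obtain ⟨h₁, h₂, e, -⟩ := (hfa μ ν).mem_toFinset.1 hp
    rw [star_smul, smul_mul_smul_comm]
    congr 1
    have e' := congrArg (weight z) e
    rw [weight_comp, weight_comp] at e'
    calc star (weight z μ) * weight z ν
        = star (weight z μ) * (weight z ν * weight z p.2) * star (weight z p.2) := by
          rw [mul_assoc, mul_assoc, weight_mul_star, mul_one]
      _ = (weight z μ * star (weight z μ)) * (weight z p.1 * star (weight z p.2)) := by
          rw [← e']; ring
      _ = weight z p.1 * star (weight z p.2) := by rw [weight_mul_star, one_mul]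
  gap_eq_zero v E hE := by
    refine Eq.trans ?_ (hq.gap_eq_zero v E hE)
    have e : ∀ lam : Λ.Path, (weight z lam • q lam) * star (weight z lam • q lam) =
        q lam * star (q lam) := fun lam => by
      rw [star_smul, smul_mul_smul_comm, weight_mul_star, one_smul]
    simp only [gap, e, weight_vertex, one_smul]

/-- The Cuntz-Krieger family `z^d(μ) q_μ`. -/
noncomputable def CKRep.twist (hfa : Λ.FinitelyAligned) (z : ι → Circle) (ρ : Λ.CKRep) :
    Λ.CKRep where
  alg := ρ.alg
  fam μ := weight z μ • ρ.fam μ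
  isCKFamily := ρ.isCKFamily.twist hfa z

/-- The gauge action on the product of the C*-algebras of all Cuntz-Krieger families. -/
noncomputable def bigGauge (hfa : Λ.FinitelyAligned) (z : ι → Circle) :
    Λ.BigProduct →⋆ₙₐ[ℂ] Λ.BigProduct where
  toFun x := ⟨fun ρ => x (ρ.twist hfa z), memℓp_infty ⟨‖x‖, by
    rintro _ ⟨ρ, rfl⟩
    exact lp.norm_apply_le_norm ENNReal.top_ne_zero x (ρ.twist hfa z)⟩⟩
  map_smul' _ _ := rfl
  map_zero' := rfl
  map_add' _ _ := rfl
  map_mul' _ _ := rfl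
  map_star' _ := rfl

lemma bigGauge_mem (hfa : Λ.FinitelyAligned) (z : ι → Circle) (x : Λ.CKAlgebra) :
    bigGauge hfa z (CKAlgebra.val x) ∈ Λ.ckSubalgebra := by
  refine ckAlgebra_induction (p := fun x => bigGauge hfa z (CKAlgebra.val x) ∈ Λ.ckSubalgebra)
    ?_ ?_ ?_ ?_ ?_ ?_ ?_ x
  · exact (NonUnitalStarSubalgebra.isClosed_topologicalClosure _).preimage
      ((AddMonoidHomClass.continuous_of_bound (bigGauge hfa z) 1 fun x => by
        rw [one_mul]; exact NonUnitalStarAlgHom.norm_apply_le _ x).comp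
          CKAlgebra.isEmbedding_val.continuous)
  · intro lam
    exact CKAlgebra.val_mem (weight z lam • ckGen lam)
  · intro lam
    exact CKAlgebra.val_mem (star (weight z lam • ckGen lam))
  · rw [map_zero, map_zero]
    exact zero_mem _
  · intro x y hx hy
    rw [map_add, map_add]
    exact add_mem hx hy
  · intro c x hx
    rw [map_smul, map_smul]
    exact SMulMemClass.smul_mem c hx
  · intro x y hx hy
    rw [map_mul, map_mul]
    exact mul_mem hx hy

/-- The gauge action of the torus on `C*(Λ)`, with `γ_z(s_μ) = z^d(μ) s_μ`. -/
noncomputable def gauge (hfa : Λ.FinitelyAligned) (z : ι → Circle) :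
    Λ.CKAlgebra →⋆ₙₐ[ℂ] Λ.CKAlgebra where
  toFun x := ⟨bigGauge hfa z (CKAlgebra.val x), bigGauge_mem hfa z x⟩
  map_smul' _ _ := rfl
  map_zero' := rfl
  map_add' _ _ := rfl
  map_mul' _ _ := rfl
  map_star' _ := rfl

lemma gauge_ckGen (hfa : Λ.FinitelyAligned) (z : ι → Circle) (lam : Λ.Path) :
    gauge hfa z (ckGen lam) = weight z lam • ckGen lam := rfl

lemma gauge_mul_star (hfa : Λ.FinitelyAligned) (z : ι → Circle) (μ ν : Λ.Path) :
    gauge hfa z (ckGen μ * star (ckGen ν)) =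
      (weight z μ * star (weight z ν)) • (ckGen μ * star (ckGen ν)) := by
  rw [map_mul, map_star, gauge_ckGen, gauge_ckGen, star_smul, smul_mul_smul_comm]

lemma gauge_one (hfa : Λ.FinitelyAligned) (x : Λ.CKAlgebra) : gauge hfa 1 x = x := by
  refine ckAlgebra_hom_ext (g := NonUnitalStarAlgHom.id ℂ _) (fun lam => ?_) x
  rw [gauge_ckGen]
  simp [weight]

lemma continuous_gauge (hfa : Λ.FinitelyAligned) (x : Λ.CKAlgebra) :
    Continuous fun z => gauge hfa z x := by
  refine ckAlgebra_induction (p := fun x => Continuous fun z => gauge hfa z x)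
    ?_ ?_ ?_ ?_ ?_ ?_ ?_ x
  · refine isClosed_of_closure_subset fun x hx => ?_
    refine continuous_of_uniform_approx_of_continuous fun u hu => ?_
    obtain ⟨ε, hε, hεu⟩ := Metric.mem_uniformity_dist.1 hu
    obtain ⟨y, hy, hxy⟩ := Metric.mem_closure_iff.1 hx ε hε
    refine ⟨_, hy, fun z => hεu ?_⟩
    rw [dist_eq_norm, ← map_sub]
    refine (NonUnitalStarAlgHom.norm_apply_le _ _).trans_lt ?_
    rwa [← dist_eq_norm]
  · intro lam
    simp only [gauge_ckGen]
    exact (continuous_weight lam).smul continuous_const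
  · intro lam
    simp only [map_star, gauge_ckGen]
    exact ((continuous_weight lam).smul continuous_const).star
  · simp only [map_zero]
    exact continuous_const
  · intro x y hx hy
    simp only [map_add]
    exact hx.add hy
  · intro c x hx
    simp only [map_smul]
    exact hx.const_smul c
  · intro x y hx hy
    simp only [map_mul]
    exact hx.mul hy

/-- A character of the torus of the form `z ↦ z^m z̄^n` with `m ≠ n` is nontrivial. -/
lemma exists_weight_ne_one {μ ν : Λ.Path} (h : μ.d ≠ ν.d) :
    ∃ w : ι → Circle, weight w μ * star (weight w ν) ≠ 1 := by
  classical
  obtain ⟨j, hj⟩ := Function.ne_iff.1 h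
  have hne : (μ.d j : ℝ) - ν.d j ≠ 0 := sub_ne_zero.2 (Nat.cast_injective.ne hj)
  set t : ℝ := Real.pi / ((μ.d j : ℝ) - ν.d j) with ht
  have hw : ∀ κ : Λ.Path, weight (Pi.mulSingle j (Circle.exp t)) κ =
      Complex.exp ((κ.d j * t : ℝ) * Complex.I) := fun κ => by
    rw [weight, Finset.prod_eq_single j (fun l _ hl => by simp [hl]) (by simp),
      Pi.mulSingle_eq_same, Circle.coe_pow, Circle.coe_exp, ← Complex.exp_nat_mul]
    push_cast
    ring_nf
  refine ⟨Pi.mulSingle j (Circle.exp t), ?_⟩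
  have e : ((μ.d j * t : ℝ) : ℂ) * Complex.I =
      ((ν.d j * t : ℝ) : ℂ) * Complex.I + Real.pi * Complex.I := by
    have : μ.d j * t = ν.d j * t + Real.pi := by
      rw [ht]
      field_simp
      ring
    rw [this]
    push_cast
    ring
  have e' : weight (Pi.mulSingle j (Circle.exp t)) μ =
      -weight (Pi.mulSingle j (Circle.exp t)) ν := by
    rw [hw, hw, e, Complex.exp_add, Complex.exp_pi_mul_I, mul_neg_one]
  rw [e', neg_mul, weight_mul_star]
  norm_num

/-- The gauge-invariant uniqueness theorem: a homomorphism on `C*(Λ)` with gauge-invariant kernel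
that is nonzero on the vertex projections is injective. -/
theorem injective_of_gaugeInvariant (hfa : Λ.FinitelyAligned) {B : Type*} [NonUnitalCStarAlgebra B]
    (π : Λ.CKAlgebra →⋆ₙₐ[ℂ] B) (hker : ∀ z a, π a = 0 → π (gauge hfa z a) = 0)
    (hπ : ∀ v, π (ckGen (Λ.vertex v)) ≠ 0) : Function.Injective π := by
  have hq := isCKFamily_ckGen hfa
  refine injective_of_isometric_on_fixed (gauge hfa) (continuous_gauge hfa) (gauge_one hfa)
    (coreSpan ckGen Set.univ) _ (topologicalClosure_span_eq_top hfa) ?_ π hker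
    fun x hx => norm_map_of_mem_coreSpan hfa hq π hπ hx
  rintro _ ⟨μ, ν, rfl⟩
  by_cases hs : μ.src = ν.src
  · by_cases hd : μ.d = ν.d
    · refine Or.inl ⟨Submodule.subset_span ⟨μ, trivial, ν, trivial, hd, hs, rfl⟩, fun z => ?_⟩
      have : weight z μ = weight z ν := by rw [weight, weight, hd]
      rw [gauge_mul_star, this, weight_mul_star, one_smul]
    · let χ : (ι → Circle) →* ℂ :=
        { toFun := fun z => weight z μ * star (weight z ν)
          map_one' := by simp [weight]
          map_mul' := fun z w => by
            simp only [weight, Pi.mul_apply, mul_pow, Finset.prod_mul_distrib, Circle.coe_mul,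
              star_mul]
            ring }
      exact Or.inr ⟨χ, fun z => gauge_mul_star hfa z μ ν, exists_weight_ne_one hd⟩
  · rw [hq.toIsTCKFamily.mul_star_eq_zero hs]
    exact Or.inl ⟨zero_mem _, fun z => map_zero _⟩

end Gauge

lemma FinitelyAligned.deleteColour (hfa : Λ.FinitelyAligned) (i : ι) :
    (Λ.deleteColour i).FinitelyAligned := by
  intro μ ν
  have h := hfa (incl μ) (incl ν)
  rw [minExt_incl] at h
  exact h.of_finite_image (incl_injective.prodMap incl_injective).injOn

/-- The homomorphism `φ : C*(Λ^i) → C*(Λ)` is injective if the vertex projections of `C*(Λ)` are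
nonzero. -/
lemma phi_injective_of_ne_zero [Fintype ι] [DecidableEq ι] (hfa : Λ.FinitelyAligned)
    (hlc : Λ.LocallyConvex) (i : ι) (h0 : ∀ v, ckGen (Λ.vertex v) ≠ 0) :
    Function.Injective (phi hfa hlc i) := by
  refine injective_of_gaugeInvariant (hfa.deleteColour i) _ (fun z a ha => ?_) fun v => ?_
  · let w : ι → Circle := fun j => if h : j ≠ i then z ⟨j, h⟩ else 1
    have e := ckAlgebra_hom_ext
      (f := (phi hfa hlc i).comp (gauge (hfa.deleteColour i) z))
      (g := (gauge hfa w).comp (phi hfa hlc i)) (fun lam => ?_) a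
    · simp only [NonUnitalStarAlgHom.comp_apply] at e
      rw [e, ha, map_zero]
    · simp only [NonUnitalStarAlgHom.comp_apply, gauge_ckGen, map_smul, phi_ckGen]
      congr 1
      rw [weight, weight, Fintype.prod_eq_mul_prod_subtype_ne _ i, incl_d_self, pow_zero, one_mul]
      congr 1
      refine Finset.prod_congr rfl fun j _ => ?_
      simp only [w, dif_pos j.2, incl_d]
      rfl
  · exact h0 v

end HigherRankGraph

/-! ### Partial bijections as partial isometries -/

section PartialIsometry

variable {X : Type u}

lemma PEquiv.sum_elim_le (f : X ≃. X) (g : X → ℝ) (s : Finset X) :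
    ∃ t : Finset X, ∑ x ∈ s, (f x).elim 0 g ≤ ∑ y ∈ t, g y := by
  classical
  refine ⟨s.biUnion fun x => (f x).toFinset, ?_⟩
  rw [Finset.sum_biUnion]
  · refine Finset.sum_le_sum fun x _ => ?_
    cases h : f x with
    | none => simp
    | some y => simp
  · intro x _ x' _ hne
    refine Finset.disjoint_left.2 fun y hy hy' => hne ?_
    exact f.inj (Option.mem_toFinset.1 hy) (Option.mem_toFinset.1 hy')

lemma PEquiv.sum_norm_rpow_le (f : X ≃. X) (ξ : lp (fun _ : X => ℂ) 2) (s : Finset X) :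
    ∑ x ∈ s, ‖(f x).elim 0 ξ‖ ^ (2 : ℝ≥0∞).toReal ≤ ‖ξ‖ ^ (2 : ℝ≥0∞).toReal := by
  obtain ⟨t, ht⟩ := f.sum_elim_le (fun y => ‖ξ y‖ ^ (2 : ℝ≥0∞).toReal) s
  refine le_trans (le_of_eq (Finset.sum_congr rfl fun x _ => ?_))
    (ht.trans (lp.sum_rpow_le_norm_rpow (by simp) ξ t))
  cases f x with
  | none => simp
  | some y => rfl

/-- The partial isometry of `ℓ²(X)` that maps the basis vector at `x` to the one at `f(x)`, for `x`
in the domain of the partial bijection `f`, and the other basis vectors to zero. -/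
noncomputable def partialIsometry (f : X ≃. X) :
    lp (fun _ : X => ℂ) 2 →L[ℂ] lp (fun _ : X => ℂ) 2 :=
  LinearMap.mkContinuous
    { toFun := fun ξ => ⟨fun x => (f.symm x).elim 0 ξ, memℓp_gen' (f.symm.sum_norm_rpow_le ξ)⟩
      map_add' := fun ξ η => by
        ext x
        change (f.symm x).elim 0 (⇑(ξ + η)) = (f.symm x).elim 0 ⇑ξ + (f.symm x).elim 0 ⇑η
        cases f.symm x with
        | none => exact (add_zero (0 : ℂ)).symm
        | some y => rfl
      map_smul' := fun c ξ => by
        ext x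
        change (f.symm x).elim 0 (⇑(c • ξ)) = c * (f.symm x).elim 0 ⇑ξ
        cases f.symm x <;> simp }
    1 fun ξ => by
      rw [one_mul]
      exact lp.norm_le_of_forall_sum_le (by simp) (norm_nonneg _) (f.symm.sum_norm_rpow_le ξ)

lemma partialIsometry_apply (f : X ≃. X) (ξ : lp (fun _ : X => ℂ) 2) (x : X) :
    partialIsometry f ξ x = (f.symm x).elim 0 ξ := rfl

lemma star_partialIsometry (f : X ≃. X) :
    star (partialIsometry f) = partialIsometry f.symm := by
  rw [ContinuousLinearMap.star_eq_adjoint, eq_comm, ContinuousLinearMap.eq_adjoint_iff]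
  intro ξ η
  rw [lp.inner_eq_tsum, lp.inner_eq_tsum]
  simp only [partialIsometry_apply, PEquiv.symm_symm, RCLike.inner_apply]
  have hdom : ∀ y : Function.support fun y => (f.symm y).elim 0 η * star (ξ y),
      ∃ x, f x = some y.1 := by
    rintro ⟨y, hy⟩
    cases h : f.symm y with
    | none => simp [h] at hy
    | some x => exact ⟨x, f.eq_some_iff.1 h⟩
  choose i hi using hdom
  refine (tsum_eq_tsum_of_ne_zero_bij i ?_ ?_ ?_)
  · intro y y' h
    have := hi y
    rw [h, hi y'] at this
    exact Subtype.ext (Option.some.inj this).symm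
  · intro x hx
    cases h : f x with
    | none => simp [h] at hx
    | some y =>
      have h' := f.eq_some_iff.2 h
      have hy : (f.symm y).elim 0 η * star (ξ y) ≠ 0 := by simpa [h, h'] using hx
      refine ⟨⟨y, hy⟩, ?_⟩
      have := f.eq_some_iff.2 (hi ⟨y, hy⟩)
      rw [h'] at this
      exact (Option.some.inj this).symm
  · intro y
    simp [hi y, f.eq_some_iff.2 (hi y)]

end PartialIsometry

namespace HigherRankGraph

variable {ι : Type} {Λ : HigherRankGraph.{u} ι}

/-! ### Maximal filters of paths -/

/-- A filter of paths: a nonempty set of paths which contains the prefixes of its members and in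
which any two members have a common extension. -/
structure IsPathFilter (x : Set Λ.Path) : Prop where
  nonempty : x.Nonempty
  mem_of_isPrefix : ∀ {μ κ : Λ.Path}, μ.IsPrefix κ → κ ∈ x → μ ∈ x
  exists_extension : ∀ {μ ν : Λ.Path}, μ ∈ x → ν ∈ x → ∃ κ ∈ x, μ.IsPrefix κ ∧ ν.IsPrefix κ

lemma IsPathFilter.rng_eq {x : Set Λ.Path} (hx : IsPathFilter x) {μ ν : Λ.Path} (hμ : μ ∈ x)
    (hν : ν ∈ x) : μ.rng = ν.rng := by
  obtain ⟨κ, -, h, h'⟩ := hx.exists_extension hμ hν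
  rw [h.rng_eq, h'.rng_eq]

lemma IsPathFilter.vertex_mem {x : Set Λ.Path} (hx : IsPathFilter x) {μ : Λ.Path} (hμ : μ ∈ x) :
    Λ.vertex μ.rng ∈ x :=
  hx.mem_of_isPrefix μ.vertex_isPrefix hμ

lemma IsPathFilter.eq_of_d_eq {x : Set Λ.Path} (hx : IsPathFilter x) {μ ν : Λ.Path} (hμ : μ ∈ x)
    (hν : ν ∈ x) (hd : μ.d = ν.d) : μ = ν := by
  obtain ⟨κ, -, h, h'⟩ := hx.exists_extension hμ hν
  exact h.eq_of_d_eq h' hd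

lemma exists_maximal_pathFilter (v : Λ.Obj) :
    ∃ x : Set Λ.Path, Λ.vertex v ∈ x ∧ Maximal IsPathFilter x := by
  have h0 : IsPathFilter {Λ.vertex v} :=
    { nonempty := Set.singleton_nonempty _
      mem_of_isPrefix := by
        rintro μ κ h rfl
        have hd := h.d_le
        rw [vertex_d] at hd
        exact Path.eq_vertex h.rng_eq (le_antisymm hd zero_le)
      exists_extension := by
        rintro μ ν rfl rfl
        exact ⟨_, rfl, .refl _, .refl _⟩ }
  have hchain : ∀ c ⊆ {x : Set Λ.Path | IsPathFilter x}, IsChain (· ⊆ ·) c → c.Nonempty →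
      ∃ u ∈ {x : Set Λ.Path | IsPathFilter x}, ∀ s ∈ c, s ⊆ u := by
    rintro c hc hchain ⟨s, hs⟩
    refine ⟨⋃₀ c, ?_, fun s hs => Set.subset_sUnion_of_mem hs⟩
    refine ⟨(hc hs).nonempty.mono (Set.subset_sUnion_of_mem hs), ?_, ?_⟩
    · rintro μ κ h ⟨t, ht, hκ⟩
      exact ⟨t, ht, (hc ht).mem_of_isPrefix h hκ⟩
    · rintro μ ν ⟨t, ht, hμ⟩ ⟨t', ht', hν⟩
      obtain ⟨r, hr, h, h'⟩ := hchain.directedOn t ht t' ht'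
      obtain ⟨κ, hκ, e⟩ := (hc hr).exists_extension (h hμ) (h' hν)
      exact ⟨κ, ⟨r, hr, hκ⟩, e⟩
  obtain ⟨m, hm, hmax⟩ := zorn_subset_nonempty _ hchain _ h0
  exact ⟨m, hm rfl, hmax⟩

/-- A path that has a common extension with each member of a maximal filter is itself a member:
by finite alignment and compactness, the common extensions can be chosen coherently. -/
lemma mem_of_forall_exists_extension (hfa : Λ.FinitelyAligned) {x : Set Λ.Path}
    (hx : Maximal IsPathFilter x) {ν : Λ.Path}
    (h : ∀ μ ∈ x, ∃ κ : Λ.Path, ν.IsPrefix κ ∧ μ.IsPrefix κ) : ν ∈ x := by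
  choose κ hνκ hκ using fun μ : x => h μ.1 μ.2
  let F : Filter x := ⨅ τ : x, Filter.principal {μ : x | τ.1.IsPrefix μ.1}
  have : Nonempty x := hx.1.nonempty.to_subtype
  have hF : F.NeBot := by
    refine Filter.iInf_neBot_of_directed' (fun τ τ' => ?_) fun τ => ?_
    · obtain ⟨ρ, hρ, h₁, h₂⟩ := hx.1.exists_extension τ.2 τ'.2
      exact ⟨⟨ρ, hρ⟩, Filter.principal_mono.2 fun μ hμ => h₁.trans hμ,
        Filter.principal_mono.2 fun μ hμ => h₂.trans hμ⟩
    · exact Filter.principal_neBot_iff.2 ⟨τ, .refl _⟩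
  let U : Ultrafilter x := Ultrafilter.of F
  let y : Set Λ.Path := {τ | ∀ᶠ μ in U, τ.IsPrefix (κ μ)}
  have hxy : x ⊆ y := fun τ hτ => by
    have h1 : {μ : x | τ.IsPrefix μ.1} ∈ F :=
      Filter.mem_iInf_of_mem ⟨τ, hτ⟩ (Filter.mem_principal_self _)
    filter_upwards [Ultrafilter.of_le F h1] with μ hμ
    exact Path.IsPrefix.trans hμ (hκ μ)
  have hy : IsPathFilter y := by
    refine ⟨hx.1.nonempty.mono hxy, fun {μ τ} hμτ hτ => ?_, fun {τ τ'} hτ hτ' => ?_⟩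
    · filter_upwards [hτ] with σ hσ
      exact hμτ.trans hσ
    · have hex : ∀ᶠ μ in U, ∃ ρ ∈ mce {τ, τ'}, ρ.IsPrefix (κ μ) := by
        filter_upwards [hτ, hτ'] with μ h₁ h₂
        obtain ⟨ρ, hρ, h₃, h₄, hd⟩ := Path.IsPrefix.exists_sup h₁ h₂
        exact ⟨ρ, mem_mce_pair.2 ⟨h₃, h₄, hd⟩, hρ⟩
      obtain ⟨ρ, hρ, hρy⟩ :=
        (Ultrafilter.eventually_exists_mem_iff (mce_finite hfa {τ, τ'} (by simp))).1 hex
      obtain ⟨h₁, h₂, -⟩ := mem_mce_pair.1 hρ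
      exact ⟨ρ, hρy, h₁, h₂⟩
  exact hx.2 hy hxy (Filter.Eventually.of_forall hνκ)

lemma IsPathFilter.exists_upper_bound {x : Set Λ.Path} (hx : IsPathFilter x) {μ₀ : Λ.Path}
    (hμ₀ : μ₀ ∈ x) (E : Finset Λ.Path) (f : Λ.Path → Λ.Path) (hf : ∀ ν ∈ E, f ν ∈ x) :
    ∃ μ ∈ x, μ₀.IsPrefix μ ∧ ∀ ν ∈ E, (f ν).IsPrefix μ := by
  induction E using Finset.induction_on with
  | empty => exact ⟨μ₀, hμ₀, .refl _, by simp⟩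
  | insert a E _ ih =>
    obtain ⟨μ, hμ, h₀, h⟩ := ih fun ν hν => hf ν (Finset.mem_insert_of_mem hν)
    obtain ⟨κ, hκ, h₁, h₂⟩ := hx.exists_extension hμ (hf a (Finset.mem_insert_self a E))
    refine ⟨κ, hκ, h₀.trans h₁, fun ν hν => ?_⟩
    rcases Finset.mem_insert.1 hν with rfl | hν
    · exact h₂
    · exact (h ν hν).trans h₁

/-- A maximal filter of paths with range `v` meets all members of `v FE(Λ)`. -/
lemma exists_mem_of_isFE (hfa : Λ.FinitelyAligned) {x : Set Λ.Path} (hx : Maximal IsPathFilter x)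
    {v : Λ.Obj} (hv : Λ.vertex v ∈ x) {E : Finset Λ.Path} (hE : Λ.IsFE v E) : ∃ ν ∈ E, ν ∈ x := by
  by_contra! hcon
  have hex : ∀ ν, ∃ μ, ν ∈ E → μ ∈ x ∧ ∀ κ : Λ.Path, ν.IsPrefix κ → ¬ μ.IsPrefix κ := by
    intro ν
    by_cases hν : ν ∈ E
    · by_contra! h
      refine hcon ν hν (mem_of_forall_exists_extension hfa hx fun μ hμ => ?_)
      exact (h μ).2 hμ
    · exact ⟨ν, fun h => absurd h hν⟩
  choose f hf using hex
  obtain ⟨μ, hμ, hvμ, hfμ⟩ := hx.1.exists_upper_bound hv E f fun ν hν => (hf ν hν).1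
  obtain ⟨ν, hν, p, hp, -⟩ := hE.2.2 μ (Set.mem_univ _) hvμ.rng_eq.symm
  obtain ⟨κ, h₁, h₂⟩ := minExt_nonempty_iff.1 ⟨p, hp⟩
  exact (hf ν hν).2 κ h₂ ((hfμ ν hν).trans h₁)

/-- The set of the prefixes of the paths `λα` with `α ∈ x`. -/
def pushFilter (lam : Λ.Path) (x : Set Λ.Path) : Set Λ.Path :=
  {κ | ∃ α ∈ x, ∃ h : lam.src = α.rng, κ.IsPrefix (lam.comp α h)}

/-- The set of the paths `α` with `λα ∈ x`. -/
def pullFilter (lam : Λ.Path) (x : Set Λ.Path) : Set Λ.Path :=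
  {α | ∃ h : lam.src = α.rng, lam.comp α h ∈ x}

lemma pushFilter_mono (lam : Λ.Path) {x y : Set Λ.Path} (h : x ⊆ y) :
    pushFilter lam x ⊆ pushFilter lam y :=
  fun _ ⟨α, hα, h'⟩ => ⟨α, h hα, h'⟩

lemma pullFilter_mono (lam : Λ.Path) {x y : Set Λ.Path} (h : x ⊆ y) :
    pullFilter lam x ⊆ pullFilter lam y :=
  fun _ ⟨h', hα⟩ => ⟨h', h hα⟩

lemma IsPathFilter.rng_eq_of_vertex_mem {x : Set Λ.Path} (hx : IsPathFilter x) {v : Λ.Obj}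
    (hv : Λ.vertex v ∈ x) {α : Λ.Path} (hα : α ∈ x) : v = α.rng :=
  hx.rng_eq hv hα

lemma mem_pushFilter_self {lam : Λ.Path} {x : Set Λ.Path} (hv : Λ.vertex lam.src ∈ x) :
    lam ∈ pushFilter lam x :=
  ⟨_, hv, rfl, ⟨_, rfl, rfl⟩⟩

lemma vertex_mem_pullFilter {lam : Λ.Path} {x : Set Λ.Path} (h : lam ∈ x) :
    Λ.vertex lam.src ∈ pullFilter lam x :=
  ⟨(vertex_rng _).symm, by rwa [Path.comp_vertex]⟩

lemma IsPathFilter.push {lam : Λ.Path} {x : Set Λ.Path} (hx : IsPathFilter x)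
    (hv : Λ.vertex lam.src ∈ x) : IsPathFilter (pushFilter lam x) where
  nonempty := ⟨_, mem_pushFilter_self hv⟩
  mem_of_isPrefix h := fun ⟨α, hα, hs, h'⟩ => ⟨α, hα, hs, h.trans h'⟩
  exists_extension := by
    rintro μ ν ⟨α, hα, hs, h⟩ ⟨β, hβ, hs', h'⟩
    obtain ⟨γ, hγ, hαγ, hβγ⟩ := hx.exists_extension hα hβ
    have hsγ : lam.src = γ.rng := hs.trans hαγ.rng_eq
    exact ⟨lam.comp γ hsγ, ⟨γ, hγ, hsγ, .refl _⟩, h.trans ((Path.IsPrefix.comp_iff hs hsγ).2 hαγ),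
      h'.trans ((Path.IsPrefix.comp_iff hs' hsγ).2 hβγ)⟩

lemma IsPathFilter.pull {lam : Λ.Path} {x : Set Λ.Path} (hx : IsPathFilter x) (h : lam ∈ x) :
    IsPathFilter (pullFilter lam x) where
  nonempty := ⟨_, vertex_mem_pullFilter h⟩
  mem_of_isPrefix hμκ := fun ⟨hs, hκ⟩ =>
    ⟨hs.trans hμκ.rng_eq.symm, hx.mem_of_isPrefix ((Path.IsPrefix.comp_iff _ hs).2 hμκ) hκ⟩
  exists_extension := by
    rintro μ ν ⟨hs, hμ⟩ ⟨hs', hν⟩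
    obtain ⟨κ, hκ, h₁, h₂⟩ := hx.exists_extension hμ hν
    obtain ⟨γ, hγ, rfl⟩ := (Path.isPrefix_comp lam μ hs).trans h₁
    exact ⟨γ, ⟨hγ, hκ⟩, (Path.IsPrefix.comp_iff hs hγ).1 h₁, (Path.IsPrefix.comp_iff hs' hγ).1 h₂⟩

lemma IsPathFilter.pull_push {lam : Λ.Path} {x : Set Λ.Path} (hx : IsPathFilter x)
    (hv : Λ.vertex lam.src ∈ x) : pullFilter lam (pushFilter lam x) = x := by
  ext α
  constructor
  · rintro ⟨hs, β, hβ, hs', h⟩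
    exact hx.mem_of_isPrefix ((Path.IsPrefix.comp_iff hs hs').1 h) hβ
  · intro hα
    have hs : lam.src = α.rng := hx.rng_eq_of_vertex_mem hv hα
    exact ⟨hs, α, hα, hs, .refl _⟩

lemma IsPathFilter.push_pull {lam : Λ.Path} {x : Set Λ.Path} (hx : IsPathFilter x) (h : lam ∈ x) :
    pushFilter lam (pullFilter lam x) = x := by
  ext κ
  constructor
  · rintro ⟨α, ⟨hs, hα⟩, hs', hκ⟩
    exact hx.mem_of_isPrefix hκ hα
  · intro hκ
    obtain ⟨τ, hτ, ⟨α, hs, rfl⟩, hκτ⟩ := hx.exists_extension h hκ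
    exact ⟨α, ⟨hs, hτ⟩, hs, hκτ⟩

lemma maximal_push {lam : Λ.Path} {x : Set Λ.Path} (hx : Maximal IsPathFilter x)
    (hv : Λ.vertex lam.src ∈ x) : Maximal IsPathFilter (pushFilter lam x) := by
  refine ⟨hx.1.push hv, fun y hy hxy => ?_⟩
  have hlam : lam ∈ y := hxy (mem_pushFilter_self hv)
  have h := pullFilter_mono lam hxy
  rw [hx.1.pull_push hv] at h
  have h' := pushFilter_mono lam (hx.2 (hy.pull hlam) h)
  rwa [hy.push_pull hlam] at h'

lemma maximal_pull {lam : Λ.Path} {x : Set Λ.Path} (hx : Maximal IsPathFilter x) (h : lam ∈ x) :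
    Maximal IsPathFilter (pullFilter lam x) := by
  refine ⟨hx.1.pull h, fun y hy hxy => ?_⟩
  have hv : Λ.vertex lam.src ∈ y := hxy (vertex_mem_pullFilter h)
  have h₁ := pushFilter_mono lam hxy
  rw [hx.1.push_pull h] at h₁
  have h₂ := pullFilter_mono lam (hx.2 (hy.push hv) h₁)
  rwa [hy.pull_push hv] at h₂

lemma pullFilter_comp {μ ν : Λ.Path} (h : μ.src = ν.rng) (x : Set Λ.Path) :
    pullFilter (μ.comp ν h) x = pullFilter ν (pullFilter μ x) := by
  ext α
  constructor
  · rintro ⟨hs, hα⟩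
    have hs' : ν.src = α.rng := by rwa [Path.comp_src] at hs
    have hs'' : μ.src = (ν.comp α hs').rng := by rw [Path.comp_rng, h]
    exact ⟨hs', hs'', by rwa [← Path.comp_assoc μ ν α h hs' hs hs'']⟩
  · rintro ⟨hs', hs'', hα⟩
    have hs : (μ.comp ν h).src = α.rng := by rw [Path.comp_src, hs']
    exact ⟨hs, by rwa [Path.comp_assoc μ ν α h hs' hs hs'']⟩

variable (Λ) in
/-- The space of the maximal filters of paths. -/
abbrev MaxFilter : Type u := {x : Set Λ.Path // Maximal IsPathFilter x}

open Classical in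
/-- The partial bijection `x ↦ λx` of the space of maximal filters of paths, with domain the filters
of paths with range `s(λ)` and image the filters that contain `λ`. -/
noncomputable def pathShift (lam : Λ.Path) : Λ.MaxFilter ≃. Λ.MaxFilter where
  toFun x := if h : Λ.vertex lam.src ∈ x.1 then some ⟨_, maximal_push x.2 h⟩ else none
  invFun x := if h : lam ∈ x.1 then some ⟨_, maximal_pull x.2 h⟩ else none
  inv x y := by
    simp only [Option.dite_none_right_eq_some, Option.some.injEq, Subtype.ext_iff]
    constructor
    · rintro ⟨h, e⟩
      exact ⟨by rw [← e]; exact vertex_mem_pullFilter h, by rw [← e, y.2.1.push_pull h]⟩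
    · rintro ⟨h, e⟩
      exact ⟨by rw [← e]; exact mem_pushFilter_self h, by rw [← e, x.2.1.pull_push h]⟩

lemma pathShift_apply {lam : Λ.Path} {x : Λ.MaxFilter} (h : Λ.vertex lam.src ∈ x.1) :
    pathShift lam x = some ⟨_, maximal_push x.2 h⟩ := dif_pos h

lemma pathShift_apply_eq_none {lam : Λ.Path} {x : Λ.MaxFilter} (h : Λ.vertex lam.src ∉ x.1) :
    pathShift lam x = none := dif_neg h

lemma pathShift_symm_apply {lam : Λ.Path} {x : Λ.MaxFilter} (h : lam ∈ x.1) :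
    (pathShift lam).symm x = some ⟨_, maximal_pull x.2 h⟩ := dif_pos h

lemma pathShift_symm_apply_eq_none {lam : Λ.Path} {x : Λ.MaxFilter} (h : lam ∉ x.1) :
    (pathShift lam).symm x = none := dif_neg h

lemma IsPathFilter.push_comp {μ ν : Λ.Path} (h : μ.src = ν.rng) {z : Set Λ.Path}
    (hz : IsPathFilter z) (hv : Λ.vertex ν.src ∈ z) :
    pushFilter (μ.comp ν h) z = pushFilter μ (pushFilter ν z) := by
  have hν : Λ.vertex μ.src ∈ pushFilter ν z := by
    rw [h]
    exact (hz.push hv).vertex_mem (mem_pushFilter_self hv)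
  have hμ : μ.comp ν h ∈ pushFilter μ (pushFilter ν z) :=
    ⟨ν, mem_pushFilter_self hv, h, .refl _⟩
  rw [← ((hz.push hv).push hν).push_pull hμ, pullFilter_comp, (hz.push hv).pull_push hν,
    hz.pull_push hv]

/-! ### The Cuntz-Krieger family on the maximal filters -/

/-- The operator `ξ ↦ (x ↦ ξ(λ⁻¹x))` on `ℓ²` of the maximal filters of paths. -/
noncomputable def filterOp (lam : Λ.Path) :
    lp (fun _ : Λ.MaxFilter => ℂ) 2 →L[ℂ] lp (fun _ : Λ.MaxFilter => ℂ) 2 :=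
  partialIsometry (pathShift lam)

lemma filterOp_apply {lam : Λ.Path} {x : Λ.MaxFilter} (h : lam ∈ x.1)
    (ξ : lp (fun _ : Λ.MaxFilter => ℂ) 2) :
    filterOp lam ξ x = ξ ⟨_, maximal_pull x.2 h⟩ := by
  rw [filterOp, partialIsometry_apply, pathShift_symm_apply h]
  rfl

lemma filterOp_apply_eq_zero {lam : Λ.Path} {x : Λ.MaxFilter} (h : lam ∉ x.1)
    (ξ : lp (fun _ : Λ.MaxFilter => ℂ) 2) : filterOp lam ξ x = 0 := by
  rw [filterOp, partialIsometry_apply, pathShift_symm_apply_eq_none h]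
  rfl

lemma star_filterOp_apply {lam : Λ.Path} {x : Λ.MaxFilter} (h : Λ.vertex lam.src ∈ x.1)
    (ξ : lp (fun _ : Λ.MaxFilter => ℂ) 2) :
    star (filterOp lam) ξ x = ξ ⟨_, maximal_push x.2 h⟩ := by
  rw [filterOp, star_partialIsometry, partialIsometry_apply, PEquiv.symm_symm, pathShift_apply h]
  rfl

lemma star_filterOp_apply_eq_zero {lam : Λ.Path} {x : Λ.MaxFilter} (h : Λ.vertex lam.src ∉ x.1)
    (ξ : lp (fun _ : Λ.MaxFilter => ℂ) 2) : star (filterOp lam) ξ x = 0 := by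
  rw [filterOp, star_partialIsometry, partialIsometry_apply, PEquiv.symm_symm,
    pathShift_apply_eq_none h]
  rfl

lemma pullFilter_vertex {v : Λ.Obj} {x : Set Λ.Path} (hx : IsPathFilter x) (h : Λ.vertex v ∈ x) :
    pullFilter (Λ.vertex v) x = x := by
  ext α
  constructor
  · rintro ⟨hs, hα⟩
    rwa [Path.vertex_comp] at hα
  · intro hα
    have hs : (Λ.vertex v).src = α.rng := hx.rng_eq_of_vertex_mem h hα
    exact ⟨hs, by rwa [Path.vertex_comp]⟩

lemma pushFilter_vertex {v : Λ.Obj} {x : Set Λ.Path} (hx : IsPathFilter x) (h : Λ.vertex v ∈ x) :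
    pushFilter (Λ.vertex v) x = x := by
  have := hx.push_pull h
  rwa [pullFilter_vertex hx h] at this

lemma filterOp_vertex_apply {v : Λ.Obj} {x : Λ.MaxFilter} (h : Λ.vertex v ∈ x.1)
    (ξ : lp (fun _ : Λ.MaxFilter => ℂ) 2) : filterOp (Λ.vertex v) ξ x = ξ x := by
  rw [filterOp_apply h]
  exact congrArg ξ (Subtype.ext (pullFilter_vertex x.2.1 h))

lemma filterOp_mul_star_apply {lam : Λ.Path} {x : Λ.MaxFilter} (h : lam ∈ x.1)
    (ξ : lp (fun _ : Λ.MaxFilter => ℂ) 2) :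
    (filterOp lam * star (filterOp lam)) ξ x = ξ x := by
  rw [mul_apply_eq_comp, filterOp_apply h,
    star_filterOp_apply (vertex_mem_pullFilter h)]
  exact congrArg ξ (Subtype.ext (x.2.1.push_pull h))

lemma filterOp_ext {S T : lp (fun _ : Λ.MaxFilter => ℂ) 2 →L[ℂ] lp (fun _ : Λ.MaxFilter => ℂ) 2}
    (h : ∀ ξ x, S ξ x = T ξ x) : S = T :=
  ContinuousLinearMap.ext fun ξ => lp.ext (funext (h ξ))

lemma star_filterOp_mul_filterOp (hfa : Λ.FinitelyAligned) (μ ν : Λ.Path) :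
    star (filterOp μ) * filterOp ν = ∑ᶠ p ∈ minExt μ ν, filterOp p.1 * star (filterOp p.2) := by
  rw [finsum_mem_eq_finite_toFinset_sum _ (hfa μ ν)]
  refine filterOp_ext fun ξ x => ?_
  rw [mul_apply_eq_comp, sum_apply, lp.coeFn_sum,
    Finset.sum_apply]
  by_cases hp : ∃ p ∈ minExt μ ν, p.1 ∈ x.1
  · obtain ⟨p, hp, hpx⟩ := hp
    have hp' := hp
    obtain ⟨h₁, h₂, e, hd⟩ := hp'
    rw [Finset.sum_eq_single p]
    · have hv : Λ.vertex μ.src ∈ x.1 := by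
        rw [h₁]
        exact x.2.1.vertex_mem hpx
      have hz := x.2.1.pull hpx
      have hv1 : Λ.vertex p.1.src ∈ pullFilter p.1 x.1 := vertex_mem_pullFilter hpx
      have hv2 : Λ.vertex p.2.src ∈ pullFilter p.1 x.1 := by
        have := congrArg Path.src e
        rw [Path.comp_src, Path.comp_src] at this
        rwa [← this]
      have key : pushFilter μ x.1 = pushFilter ν (pushFilter p.2 (pullFilter p.1 x.1)) := by
        conv_lhs => rw [← x.2.1.push_pull hpx]
        rw [← hz.push_comp h₁ hv1, ← hz.push_comp h₂ hv2, e]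
      have hv3 : Λ.vertex ν.src ∈ pushFilter p.2 (pullFilter p.1 x.1) := by
        rw [h₂]
        exact (hz.push hv2).vertex_mem (mem_pushFilter_self hv2)
      have hν : ν ∈ pushFilter μ x.1 := by
        rw [key]
        exact mem_pushFilter_self hv3
      rw [star_filterOp_apply hv, filterOp_apply hν, mul_apply_eq_comp,
        filterOp_apply hpx, star_filterOp_apply hv2]
      refine congrArg ξ (Subtype.ext ?_)
      change pullFilter ν (pushFilter μ x.1) = pushFilter p.2 (pullFilter p.1 x.1)
      rw [key, (hz.push hv2).pull_push hv3]
    · intro p' hp' hne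
      obtain ⟨h₁', h₂', e', hd'⟩ := (hfa μ ν).mem_toFinset.1 hp'
      refine filterOp_apply_eq_zero (fun hp'x => hne ?_) _
      rw [← hd, Path.comp_d, Path.comp_d] at hd'
      have e1 : p'.1 = p.1 := x.2.1.eq_of_d_eq hp'x hpx (add_left_cancel hd')
      refine Prod.ext e1 (Path.comp_left_cancel h₂' h₂ ?_)
      rw [← e, ← e']
      congr 1
    · exact fun h => absurd ((hfa μ ν).mem_toFinset.2 hp) h
  · rw [Finset.sum_eq_zero fun p hp' => by
      rw [mul_apply_eq_comp]
      exact filterOp_apply_eq_zero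
        (fun hpx => hp ⟨p, (hfa μ ν).mem_toFinset.1 hp', hpx⟩) _]
    by_cases hv : Λ.vertex μ.src ∈ x.1
    · rw [star_filterOp_apply hv]
      refine filterOp_apply_eq_zero (fun hν => hp ?_) _
      obtain ⟨α, hα, hs, hνα⟩ := hν
      obtain ⟨ρ, hρα, ⟨δ, hδ, rfl⟩, ⟨β, hβ, e⟩, hd⟩ := (Path.isPrefix_comp μ α hs).exists_sup hνα
      exact ⟨(δ, β), ⟨hδ, hβ, e.symm, hd⟩,
        x.2.1.mem_of_isPrefix ((Path.IsPrefix.comp_iff hδ hs).1 hρα) hα⟩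
    · exact star_filterOp_apply_eq_zero hv _

lemma filterOp_mul (μ ν : Λ.Path) (h : μ.src = ν.rng) :
    filterOp μ * filterOp ν = filterOp (μ.comp ν h) := by
  refine filterOp_ext fun ξ x => ?_
  rw [mul_apply_eq_comp]
  by_cases hμν : μ.comp ν h ∈ x.1
  · have hμ : μ ∈ x.1 := x.2.1.mem_of_isPrefix (Path.isPrefix_comp μ ν h) hμν
    have hν : ν ∈ pullFilter μ x.1 := ⟨h, hμν⟩
    rw [filterOp_apply hμν, filterOp_apply hμ, filterOp_apply hν]
    exact congrArg ξ (Subtype.ext (pullFilter_comp h x.1).symm)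
  · rw [filterOp_apply_eq_zero hμν]
    by_cases hμ : μ ∈ x.1
    · rw [filterOp_apply hμ]
      exact filterOp_apply_eq_zero (x := ⟨_, maximal_pull x.2 hμ⟩) (fun h' => hμν h'.2) _
    · exact filterOp_apply_eq_zero hμ _

lemma isTCKFamily_filterOp (hfa : Λ.FinitelyAligned) :
    IsTCKFamily (filterOp (Λ := Λ)) where
  isStarProjection v :=
    { isIdempotentElem := by
        have h : (Λ.vertex v).src = (Λ.vertex v).rng := rfl
        rw [IsIdempotentElem, filterOp_mul _ _ h, Path.vertex_comp]
      isSelfAdjoint := filterOp_ext fun ξ x => by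
        by_cases h : Λ.vertex v ∈ x.1
        · rw [filterOp_vertex_apply h, star_filterOp_apply h]
          exact congrArg ξ (Subtype.ext (pushFilter_vertex x.2.1 h))
        · rw [filterOp_apply_eq_zero h, star_filterOp_apply_eq_zero h] }
  orthogonal v w hvw := filterOp_ext fun ξ x => by
    rw [mul_apply_eq_comp]
    by_cases h : Λ.vertex v ∈ x.1
    · rw [filterOp_vertex_apply h, filterOp_apply_eq_zero (lam := Λ.vertex w)
        fun h' => hvw (x.2.1.rng_eq h h')]
      rfl
    · exact filterOp_apply_eq_zero h _
  mul_eq := filterOp_mul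
  star_mul_eq := star_filterOp_mul_filterOp hfa

lemma gap_filterOp_apply_eq_zero {v : Λ.Obj} {x : Λ.MaxFilter} (hv : Λ.vertex v ∈ x.1)
    {E : Finset Λ.Path} {ν : Λ.Path} (hν : ν ∈ E) (hνx : ν ∈ x.1)
    (ξ : lp (fun _ : Λ.MaxFilter => ℂ) 2) : gap filterOp v E ξ x = 0 := by
  rw [← Finset.mem_toList] at hν
  rw [gap]
  generalize E.toList = l at hν ⊢
  induction l with
  | nil => simp at hν
  | cons a l ih =>
    rw [List.map_cons, List.foldr_cons, mul_apply_eq_comp, sub_apply, lp.coeFn_sub, Pi.sub_apply,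
      filterOp_vertex_apply hv]
    by_cases ha : a ∈ x.1
    · rw [filterOp_mul_star_apply ha, sub_self]
    · have hνl : ν ∈ l := by
        rcases List.mem_cons.1 hν with rfl | h
        · exact absurd hνx ha
        · exact h
      rw [ih hνl, mul_apply_eq_comp, filterOp_apply_eq_zero ha, sub_zero]

lemma isCKFamily_filterOp (hfa : Λ.FinitelyAligned) : IsCKFamily (filterOp (Λ := Λ)) where
  toIsTCKFamily := isTCKFamily_filterOp hfa
  gap_eq_zero v E hE := filterOp_ext fun ξ x => by
    by_cases hv : Λ.vertex v ∈ x.1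
    · obtain ⟨ν, hν, hνx⟩ := exists_mem_of_isFE hfa x.2 hv hE
      exact gap_filterOp_apply_eq_zero hv hν hνx ξ
    · rw [← (isTCKFamily_filterOp hfa).vertex_mul_gap hfa fun β hβ => (hE.2.1 β hβ).2.1,
        mul_apply_eq_comp]
      exact filterOp_apply_eq_zero hv _

/-- The vertex projections of `C*(Λ)` are nonzero. -/
theorem ckGen_vertex_ne_zero (hfa : Λ.FinitelyAligned) (v : Λ.Obj) :
    ckGen (Λ.vertex v) ≠ 0 := by
  classical
  let ρ : Λ.CKRep :=
    { alg := lp (fun _ : Λ.MaxFilter => ℂ) 2 →L[ℂ] lp (fun _ : Λ.MaxFilter => ℂ) 2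
      fam := filterOp
      isCKFamily := isCKFamily_filterOp hfa }
  intro h
  have h' : filterOp (Λ.vertex v) = 0 := by
    rw [← map_zero ρ.lift, ← h]
    rfl
  obtain ⟨x, hv, hx⟩ := exists_maximal_pathFilter v
  have e := filterOp_vertex_apply (x := ⟨x, hx⟩) hv (lp.single 2 ⟨x, hx⟩ 1)
  rw [h', zero_apply, lp.coeFn_single, Pi.single_eq_same] at e
  exact zero_ne_one e

/-- The homomorphism `φ : C*(Λ^i) → C*(Λ)` is injective. -/
theorem phi_injective [Fintype ι] [DecidableEq ι] (hfa : Λ.FinitelyAligned)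
    (hlc : Λ.LocallyConvex) (i : ι) : Function.Injective (phi hfa hlc i) :=
  phi_injective_of_ne_zero hfa hlc i (ckGen_vertex_ne_zero hfa)

end HigherRankGraph

/-! ### The left action and the rank-one operators -/

namespace HilbertSubBimodule

variable {A : Type*} {B : Type*} [NonUnitalCStarAlgebra A] [NonUnitalCStarAlgebra B]
  {φ : A →⋆ₙₐ[ℂ] B} (X : HilbertSubBimodule φ)

lemma coe_leftAction (a : A) (x : X.carrier) : (X.leftAction a x : B) = φ a * x := rfl

lemma coe_theta (x y z : X.carrier) : (X.theta x y z : B) = x * (star (y : B) * z) := by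
  change (x : B) * φ (X.inner y z) = _
  rw [phi_inner]

lemma leftAction_eq_zero_iff {a : A} : X.leftAction a = 0 ↔ ∀ x ∈ X.carrier, φ a * x = 0 := by
  constructor
  · intro h x hx
    exact congrArg Subtype.val (DFunLike.congr_fun h (⟨x, hx⟩ : X.carrier))
  · intro h
    exact ContinuousLinearMap.ext fun x => Subtype.ext (h x x.2)

/-- The kernel of the left action is closed under the involution. -/
lemma star_mul_phi_eq_zero {a : A} (h : X.leftAction a = 0) {x : B} (hx : x ∈ X.carrier) :
    star x * φ a = 0 := by
  have hax := X.left_mem (star a) x hx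
  have h0 : star (φ (star a) * x) * (φ (star a) * x) = 0 := by
    rw [star_mul, map_star, star_star, mul_assoc, ← map_star,
      X.leftAction_eq_zero_iff.1 h _ hax, mul_zero]
  have h1 := (CStarRing.star_mul_self_eq_zero_iff _).1 h0
  have h2 := congrArg star h1
  rwa [star_mul, map_star, star_star, star_zero] at h2

end HilbertSubBimodule

namespace HigherRankGraph

variable {ι : Type} {Λ : HigherRankGraph.{u} ι}

/-! ### Gaps and compact operators -/

lemma ckGen_ne_zero (hfa : Λ.FinitelyAligned) (μ : Λ.Path) : ckGen μ ≠ 0 := by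
  intro h
  refine ckGen_vertex_ne_zero hfa μ.src ?_
  rw [← (isCKFamily_ckGen hfa).toIsTCKFamily.star_mul_self, h, mul_zero]

lemma one_le_norm_ckGen (hfa : Λ.FinitelyAligned) (μ : Λ.Path) : 1 ≤ ‖ckGen μ‖ := by
  have hq := (isCKFamily_ckGen hfa).toIsTCKFamily
  have h : ‖ckGen μ‖ ≤ ‖ckGen μ‖ * ‖star (ckGen μ)‖ * ‖ckGen μ‖ := by
    conv_lhs => rw [← hq.mul_star_self_mul μ]
    exact (norm_mul_le _ _).trans (mul_le_mul_of_nonneg_right (norm_mul_le _ _) (norm_nonneg _))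
  rw [norm_star] at h
  have hpos := norm_pos_iff.2 (ckGen_ne_zero hfa μ)
  nlinarith [mul_pos hpos hpos]

/-- A path with `d(λ)_i ≥ 1` begins with an edge of degree `e_i`. -/
lemma Path.exists_edge_comp [DecidableEq ι] {i : ι} (lam : Λ.Path) (h : 1 ≤ lam.d i) :
    ∃ (f ν : Λ.Path) (hc : f.src = ν.rng), f.comp ν hc = lam ∧ f.d = Pi.single i 1 := by
  have hle : (Pi.single i 1 : ι → ℕ) ≤ lam.d := by
    intro t
    by_cases ht : t = i
    · subst ht; simpa using h
    · simp [ht]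
  obtain ⟨f, ν, hc, e, hd, -⟩ := lam.exists_factor (Pi.single i 1) (lam.d - Pi.single i 1)
    (add_tsub_cancel_of_le hle).symm
  exact ⟨f, ν, hc, e, hd⟩

/-- An element of the algebraic span that underlies `X` involves only finitely many edges of
degree `e_i`. -/
lemma exists_finset_star_mul_eq_zero [DecidableEq ι] (hfa : Λ.FinitelyAligned) (i : ι)
    {y : Λ.CKAlgebra}
    (hy : y ∈ Submodule.span ℂ {x | ∃ lam μ : Λ.Path, lam.d i = 1 ∧ μ.d i = 0 ∧
      x = ckGen lam * star (ckGen μ)}) :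
    ∃ F : Finset Λ.Path, (∀ f ∈ F, f.d = Pi.single i 1) ∧
      ∀ w : Λ.CKAlgebra, (∀ f ∈ F, star (ckGen f) * w = 0) → star y * w = 0 := by
  have hq := (isCKFamily_ckGen hfa).toIsTCKFamily
  induction hy using Submodule.span_induction with
  | zero => exact ⟨∅, by simp, fun w _ => by rw [star_zero, zero_mul]⟩
  | add x y _ _ hx hy =>
    obtain ⟨F, hF, h⟩ := hx
    obtain ⟨F', hF', h'⟩ := hy
    refine ⟨F ∪ F', fun f hf => (Finset.mem_union.1 hf).elim (hF f) (hF' f), fun w hw => ?_⟩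
    rw [star_add, add_mul, h w fun f hf => hw f (Finset.mem_union_left _ hf),
      h' w fun f hf => hw f (Finset.mem_union_right _ hf), add_zero]
  | smul c x _ hx =>
    obtain ⟨F, hF, h⟩ := hx
    exact ⟨F, hF, fun w hw => by rw [star_smul, smul_mul_assoc, h w hw, smul_zero]⟩
  | mem x hx =>
    obtain ⟨lam, μ, hlam, -, rfl⟩ := hx
    obtain ⟨f, ν, hc, rfl, hf⟩ := lam.exists_edge_comp (i := i) hlam.ge
    refine ⟨{f}, by simpa using hf, fun w hw => ?_⟩
    rw [← hq.mul_eq, star_mul, star_mul, mul_assoc, mul_assoc, hw f (Finset.mem_singleton_self f),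
      mul_zero, mul_zero]

section

variable [Fintype ι] [DecidableEq ι] (hfa : Λ.FinitelyAligned) (hlc : Λ.LocallyConvex) (i : ι)

lemma coe_pathVector {μ : Λ.Path} (h : μ.d i = 1) :
    (pathVector hfa hlc i μ : Λ.CKAlgebra) = ckGen μ := by
  rw [pathVector, dif_pos h]

lemma phi_gap (v : (Λ.deleteColour i).Obj) (E : Finset (Λ.deleteColour i).Path) :
    phi hfa hlc i (gap ckGen v E) = gap ckGen (Λ := Λ) v (E.image incl) := by
  exact (map_gap _ _ _ _).trans
    (gap_image_incl hfa (isCKFamily_ckGen hfa).toIsTCKFamily v E).symm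

variable {i} in
/-- The expansion of `φ(Δ(s)^E)` for exhaustive `E ∪ F`. -/
lemma phi_gap_eq_sum {v : (Λ.deleteColour i).Obj} {E : Finset (Λ.deleteColour i).Path}
    {F : Finset Λ.Path} (hF : ∀ f ∈ F, f.rng = v ∧ f.d = Pi.single i 1)
    (hEF : Λ.IsFE v (E.image incl ∪ F)) :
    phi hfa hlc i (gap ckGen v E) =
      ∑ G ∈ (E.image incl ∪ F).powerset with (G ∩ F).Nonempty,
        ∑ᶠ μ ∈ mce G, (-1 : ℂ) ^ (G.card + 1) • (ckGen μ * star (ckGen μ)) := by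
  have hq := isCKFamily_ckGen hfa
  have hr : ∀ β ∈ E.image incl ∪ F, β.rng = v := fun β hβ => (hEF.2.1 β hβ).2.1
  rw [phi_gap]
  refine hq.toIsTCKFamily.gap_eq_sum_of_union hfa
    (fun β hβ => hr β (Finset.mem_union_left _ hβ))
    (fun β hβ => hr β (Finset.mem_union_right _ hβ)) ?_ (hq.gap_eq_zero v _ hEF)
  refine Finset.disjoint_left.2 fun β hβ hβF => ?_
  obtain ⟨κ, -, rfl⟩ := Finset.mem_image.1 hβ
  have h1 := incl_d_self κ
  rw [(hF _ hβF).2] at h1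
  simp at h1

variable {i} in
/-- The left action of `Δ(s)^E`, for exhaustive `E ∪ F`, as a sum of rank-one operators. -/
lemma leftAction_gap_eq_sum {v : (Λ.deleteColour i).Obj} {E : Finset (Λ.deleteColour i).Path}
    {F : Finset Λ.Path} (hF : ∀ f ∈ F, f.rng = v ∧ f.d = Pi.single i 1)
    (hEF : Λ.IsFE v (E.image incl ∪ F)) :
    (edgeBimodule hfa hlc i).leftAction (gap ckGen v E) =
      ∑ G ∈ (E.image incl ∪ F).powerset with (G ∩ F).Nonempty,
        ∑ᶠ μ ∈ mce G, (-1 : ℂ) ^ (G.card + 1) • (edgeBimodule hfa hlc i).theta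
          (pathVector hfa hlc i μ) (pathVector hfa hlc i μ) := by
  refine ContinuousLinearMap.ext fun z => Subtype.ext ?_
  rw [HilbertSubBimodule.coe_leftAction, phi_gap_eq_sum hfa hlc hF hEF, sum_apply,
    Submodule.coe_sum, Finset.sum_mul]
  refine Finset.sum_congr rfl fun G hG => ?_
  obtain ⟨hG, hGF⟩ := Finset.mem_filter.1 hG
  have hfin := mce_finite hfa G (hGF.mono Finset.inter_subset_left)
  rw [finsum_mem_eq_finite_toFinset_sum _ hfin, finsum_mem_eq_finite_toFinset_sum _ hfin,
    sum_apply, Submodule.coe_sum, Finset.sum_mul]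
  refine Finset.sum_congr rfl fun μ hμ => ?_
  have hd := mce_degree (fun f hf => (hF f hf).2) (Finset.mem_powerset.1 hG) hGF
    (hfin.mem_toFinset.1 hμ)
  rw [smul_apply, Submodule.coe_smul, HilbertSubBimodule.coe_theta,
    coe_pathVector hfa hlc i hd, smul_mul_assoc, mul_assoc]

variable {i} in
lemma leftAction_gap_mem_compacts {v : (Λ.deleteColour i).Obj}
    {E : Finset (Λ.deleteColour i).Path} {F : Finset Λ.Path}
    (hF : ∀ f ∈ F, f.rng = v ∧ f.d = Pi.single i 1) (hEF : Λ.IsFE v (E.image incl ∪ F)) :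
    (edgeBimodule hfa hlc i).leftAction (gap ckGen v E) ∈ (edgeBimodule hfa hlc i).compacts := by
  rw [leftAction_gap_eq_sum hfa hlc hF hEF]
  refine sum_mem fun G hG => ?_
  have hfin := mce_finite hfa G ((Finset.mem_filter.1 hG).2.mono Finset.inter_subset_left)
  rw [finsum_mem_eq_finite_toFinset_sum _ hfin]
  exact sum_mem fun μ _ => Submodule.smul_mem _ _
    (Submodule.le_topologicalClosure _ (Submodule.subset_span ⟨_, _, rfl⟩))

variable {i} in
/-- If `E ∪ F` is exhaustive, then `Δ(s)^E` annihilates the kernel of the left action. This rests on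
the injectivity of `φ`. -/
lemma gap_mul_eq_zero {v : (Λ.deleteColour i).Obj} {E : Finset (Λ.deleteColour i).Path}
    {F : Finset Λ.Path} (hF : ∀ f ∈ F, f.rng = v ∧ f.d = Pi.single i 1)
    (hEF : Λ.IsFE v (E.image incl ∪ F)) {b : (Λ.deleteColour i).CKAlgebra}
    (hb : (edgeBimodule hfa hlc i).leftAction b = 0) : gap ckGen v E * b = 0 := by
  refine phi_injective hfa hlc i ?_
  rw [map_zero, map_mul, phi_gap_eq_sum hfa hlc hF hEF, Finset.sum_mul]
  refine Finset.sum_eq_zero fun G hG => ?_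
  obtain ⟨hG, hGF⟩ := Finset.mem_filter.1 hG
  have hfin := mce_finite hfa G (hGF.mono Finset.inter_subset_left)
  rw [finsum_mem_eq_finite_toFinset_sum _ hfin, Finset.sum_mul]
  refine Finset.sum_eq_zero fun μ hμ => ?_
  have hd := mce_degree (fun f hf => (hF f hf).2) (Finset.mem_powerset.1 hG) hGF
    (hfin.mem_toFinset.1 hμ)
  rw [smul_mul_assoc, mul_assoc, (edgeBimodule hfa hlc i).star_mul_phi_eq_zero hb
    (ckGen_mem_spanDegree hfa μ hd), mul_zero, smul_zero]

variable {i} in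
/-- A compact operator on `X` is concentrated, up to `ε`, on finitely many edges of degree `e_i`. -/
lemma exists_finset_of_mem_compacts
    {T : (edgeBimodule hfa hlc i).carrier →L[ℂ] (edgeBimodule hfa hlc i).carrier}
    (hT : T ∈ (edgeBimodule hfa hlc i).compacts) {ε : ℝ} (hε : 0 < ε) :
    ∃ F : Finset Λ.Path, (∀ f ∈ F, f.d = Pi.single i 1) ∧
      ∀ (z : (edgeBimodule hfa hlc i).carrier) (c : Λ.CKAlgebra),
        (∀ f ∈ F, star (ckGen f) * ((z : Λ.CKAlgebra) * c) = 0) →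
        ‖(T z : Λ.CKAlgebra) * c‖ ≤ ε * (‖z‖ * ‖c‖) := by
  have hT' : T ∈ closure (Submodule.span ℂ {T | ∃ x y : (edgeBimodule hfa hlc i).carrier,
      T = (edgeBimodule hfa hlc i).theta x y} : Set _) := hT
  obtain ⟨T₀, hT₀, hdist⟩ := (Metric.mem_closure_iff
    (α := (edgeBimodule hfa hlc i).carrier →L[ℂ] (edgeBimodule hfa hlc i).carrier)).1 hT'
      (ε / 2) (by positivity)
  have key : ∀ δ : ℝ, 0 < δ → ∃ F : Finset Λ.Path, (∀ f ∈ F, f.d = Pi.single i 1) ∧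
      ∀ (z : (edgeBimodule hfa hlc i).carrier) (c : Λ.CKAlgebra),
        (∀ f ∈ F, star (ckGen f) * ((z : Λ.CKAlgebra) * c) = 0) →
        ‖(T₀ z : Λ.CKAlgebra) * c‖ ≤ δ * (‖z‖ * ‖c‖) := by
    clear hdist
    induction hT₀ using Submodule.span_induction with
    | zero =>
      refine fun δ hδ => ⟨∅, by simp, fun z c _ => ?_⟩
      rw [zero_apply, Submodule.coe_zero, zero_mul, norm_zero]
      positivity
    | add S S' _ _ hS hS' =>
      intro δ hδ
      obtain ⟨F, hF, h⟩ := hS (δ / 2) (by positivity)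
      obtain ⟨F', hF', h'⟩ := hS' (δ / 2) (by positivity)
      refine ⟨F ∪ F', fun f hf => (Finset.mem_union.1 hf).elim (hF f) (hF' f), fun z c hz => ?_⟩
      have h1 := h z c fun f hf => hz f (Finset.mem_union_left _ hf)
      have h2 := h' z c fun f hf => hz f (Finset.mem_union_right _ hf)
      rw [add_apply, Submodule.coe_add, add_mul]
      refine (norm_add_le _ _).trans ?_
      linarith
    | smul a S _ hS =>
      intro δ hδ
      obtain ⟨F, hF, h⟩ := hS (δ / (‖a‖ + 1)) (by positivity)
      refine ⟨F, hF, fun z c hz => ?_⟩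
      rw [smul_apply, Submodule.coe_smul, smul_mul_assoc, norm_smul]
      have hle : ‖a‖ * (δ / (‖a‖ + 1)) ≤ δ := by
        rw [mul_div_assoc', div_le_iff₀ (by positivity)]
        nlinarith [norm_nonneg a]
      calc ‖a‖ * ‖(S z : Λ.CKAlgebra) * c‖ ≤ ‖a‖ * (δ / (‖a‖ + 1) * (‖z‖ * ‖c‖)) := by
            gcongr
            exact h z c hz
        _ = ‖a‖ * (δ / (‖a‖ + 1)) * (‖z‖ * ‖c‖) := by ring
        _ ≤ δ * (‖z‖ * ‖c‖) := by gcongr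
    | mem S hS =>
      obtain ⟨x, y, rfl⟩ := hS
      intro δ hδ
      obtain ⟨y₀, hy₀, hd⟩ := Metric.mem_closure_iff.1 y.2 (δ / (‖x‖ + 1)) (by positivity)
      obtain ⟨F, hF, h⟩ := exists_finset_star_mul_eq_zero hfa i hy₀
      refine ⟨F, hF, fun z c hz => ?_⟩
      have e : (((edgeBimodule hfa hlc i).theta x y z : _) : Λ.CKAlgebra) * c =
          (x : Λ.CKAlgebra) * (star ((y : Λ.CKAlgebra) - y₀) * ((z : Λ.CKAlgebra) * c)) := by
        rw [HilbertSubBimodule.coe_theta, star_sub, sub_mul, h _ hz, sub_zero]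
        simp only [mul_assoc]
      rw [dist_eq_norm] at hd
      have hle : ‖x‖ * (δ / (‖x‖ + 1)) ≤ δ := by
        rw [mul_div_assoc', div_le_iff₀ (by positivity)]
        nlinarith [norm_nonneg x]
      calc ‖(((edgeBimodule hfa hlc i).theta x y z : _) : Λ.CKAlgebra) * c‖
          ≤ ‖x‖ * (‖(y : Λ.CKAlgebra) - y₀‖ * (‖z‖ * ‖c‖)) := by
            rw [e]
            refine (norm_mul_le _ _).trans ?_
            refine mul_le_mul_of_nonneg_left ?_ (norm_nonneg _)
            refine (norm_mul_le _ _).trans ?_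
            rw [norm_star]
            exact mul_le_mul_of_nonneg_left (norm_mul_le _ _) (norm_nonneg _)
        _ ≤ ‖x‖ * (δ / (‖x‖ + 1) * (‖z‖ * ‖c‖)) := by gcongr
        _ = ‖x‖ * (δ / (‖x‖ + 1)) * (‖z‖ * ‖c‖) := by ring
        _ ≤ δ * (‖z‖ * ‖c‖) := by gcongr
  obtain ⟨F, hF, h⟩ := key (ε / 2) (by positivity)
  refine ⟨F, hF, fun z c hz => ?_⟩
  have e : (T z : Λ.CKAlgebra) * c = ((T - T₀) z : Λ.CKAlgebra) * c + (T₀ z : Λ.CKAlgebra) * c := by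
    rw [sub_apply, Submodule.coe_sub, sub_mul, sub_add_cancel]
  have h1 : ‖((T - T₀) z : Λ.CKAlgebra) * c‖ ≤ ε / 2 * (‖z‖ * ‖c‖) := by
    refine (norm_mul_le _ _).trans ?_
    have : ‖(T - T₀) z‖ ≤ ε / 2 * ‖z‖ := by
      refine ((T - T₀).le_opNorm z).trans ?_
      exact mul_le_mul_of_nonneg_right ((dist_eq_norm T T₀).symm.trans_lt hdist).le
        (norm_nonneg z)
    calc ‖(T - T₀) z‖ * ‖c‖ ≤ ε / 2 * ‖z‖ * ‖c‖ := by gcongr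
      _ = _ := by ring
  rw [e]
  refine (norm_add_le _ _).trans ?_
  have := h z c hz
  linarith

variable {i} in
/-- A vertex of `H_{J_X}` receives an edge of degree `e_i`: otherwise its projection would lie in
the kernel of the left action and in the annihilator of the kernel. -/
lemma exists_edge_of_mem_katsuraVertices {w : (Λ.deleteColour i).Obj}
    (hw : w ∈ katsuraVertices hfa hlc i) :
    ∃ f : Λ.Path, f.rng = w ∧ f.d = Pi.single i 1 := by
  by_contra! hcon
  have hfi := hfa.deleteColour i
  have hq := (isCKFamily_ckGen hfa).toIsTCKFamily
  have hp := (isCKFamily_ckGen hfi).isStarProjection w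
  refine ckGen_vertex_ne_zero hfi w ?_
  rw [← hp.isIdempotentElem.eq]
  refine hw.2 _ ((edgeBimodule hfa hlc i).leftAction_eq_zero_iff.2 fun x hx => ?_)
  rw [phi_ckGen]
  refine spanDegree_induction (p := fun x => ckGen (incl ((Λ.deleteColour i).vertex w)) * x = 0)
    (isClosed_eq (continuous_const.mul continuous_id) continuous_const) ?_ (mul_zero _)
    (fun x y hx hy => by rw [mul_add, hx, hy, add_zero])
    (fun c x hx => by rw [mul_smul_comm, hx, smul_zero]) x hx
  intro lam μ hlam _
  obtain ⟨f, ν, hc, rfl, hf⟩ := lam.exists_edge_comp (i := i) hlam.ge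
  rw [← mul_assoc, hq.mul_eq_zero _ _ fun h => hcon f ?_ hf, zero_mul]
  rw [Path.comp_rng] at h
  exact h.symm

variable {i} in
/-- If the left action of `Δ(s)^E` is compact, then finitely many edges of degree `e_i` complete `E`
to an exhaustive set: a path that has no common extension with any of them, nor with a member
of `E`, would give a vector on which the left action of `Δ(s)^E` is isometric. -/
lemma exists_isFE_of_leftAction_mem_compacts {v : (Λ.deleteColour i).Obj}
    {E : Finset (Λ.deleteColour i).Path}
    (hE : (Λ.deleteColour i).IsFEIn (remainingPaths hfa hlc i) v E)
    (hK : (edgeBimodule hfa hlc i).leftAction (gap ckGen v E) ∈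
      (edgeBimodule hfa hlc i).compacts) :
    ∃ F : Finset Λ.Path, (∀ f ∈ F, f.rng = v ∧ f.d = Pi.single i 1) ∧
      Λ.IsFE v (E.image incl ∪ F) := by
  classical
  have hq := (isCKFamily_ckGen hfa).toIsTCKFamily
  obtain ⟨F, hF, hFK⟩ := exists_finset_of_mem_compacts hfa hlc hK one_half_pos
  have hFv : ∀ f ∈ F.filter (fun f => f.rng = v), f.rng = v ∧ f.d = Pi.single i 1 := fun f hf =>
    ⟨(Finset.mem_filter.1 hf).2, hF f (Finset.mem_filter.1 hf).1⟩
  refine ⟨F.filter fun f => f.rng = v, hFv, Set.mem_univ _, fun κ hκ => ?_, ?_⟩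
  · rcases Finset.mem_union.1 hκ with hκ | hκ
    · obtain ⟨κ, hκE, rfl⟩ := Finset.mem_image.1 hκ
      obtain ⟨-, hr, hne⟩ := hE.2.1 κ hκE
      exact ⟨Set.mem_univ _, hr, fun h => hne (incl_injective h)⟩
    · refine ⟨Set.mem_univ _, (hFv κ hκ).1, fun h => ?_⟩
      have hd := congrFun (hFv κ hκ).2 i
      rw [h, Pi.single_eq_same] at hd
      exact zero_ne_one ((congrFun (vertex_d (Λ := Λ) v) i).symm.trans hd)
  -- No path `μ` of `vΛ` with `d(μ)_i ≥ 1` can miss `E ∪ F`.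
  have key : ∀ μ : Λ.Path, μ.rng = v → 1 ≤ μ.d i →
      ∃ ν ∈ E.image incl ∪ F.filter (fun f => f.rng = v), (minExt μ ν).Nonempty := by
    intro μ hμ hμi
    by_contra! hcon
    have hmiss : ∀ ν ∈ E.image incl ∪ F.filter (fun f => f.rng = v), star (ckGen ν) * ckGen μ = 0 :=
      fun ν hν => hq.star_mul_eq_zero (Set.not_nonempty_iff_eq_empty.1 fun h =>
        (minExt_swap h).ne_empty (hcon ν hν))
    -- the initial segment of `μ` with `i`-th degree one and all other degrees unchanged
    obtain ⟨μ', μ'', hc, e, hd, -⟩ := μ.exists_factor (Function.update μ.d i 1)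
      (μ.d - Function.update μ.d i 1) (add_tsub_cancel_of_le fun t => by
        by_cases ht : t = i
        · subst ht; simpa using hμi
        · simp [ht]).symm
    have hd1 : μ'.d i = 1 := by rw [hd, Function.update_self]
    have hz := coe_pathVector hfa hlc i hd1
    have hmul : ckGen μ' * ckGen μ'' = ckGen μ := by rw [hq.mul_eq _ _ hc, e]
    have h := hFK (pathVector hfa hlc i μ') (ckGen μ'') fun f hf => by
      rw [hz, hmul]
      by_cases hfv : f.rng = v
      · exact hmiss f (Finset.mem_union_right _ (Finset.mem_filter.2 ⟨hf, hfv⟩))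
      · refine hq.star_mul_eq_zero (Set.not_nonempty_iff_eq_empty.1 fun hne => hfv ?_)
        obtain ⟨κ, h₁, h₂⟩ := minExt_nonempty_iff.1 hne
        rw [h₁.rng_eq, ← h₂.rng_eq, hμ]
    have hgap : gap ckGen (Λ := Λ) v (E.image incl) * ckGen μ = ckGen μ :=
      hq.gap_mul_eq_self hfa (by rw [← hμ, hq.vertex_mul]) fun β hβ =>
        hmiss β (Finset.mem_union_left _ hβ)
    rw [HilbertSubBimodule.coe_leftAction, hz, mul_assoc, hmul, phi_gap, hgap] at h
    have h1 : ‖pathVector hfa hlc i μ'‖ ≤ 1 := by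
      rw [show ‖pathVector hfa hlc i μ'‖ = ‖ckGen μ'‖ from congrArg norm hz]
      exact hq.norm_le_one μ'
    have h2 := hq.norm_le_one μ''
    have h3 := one_le_norm_ckGen hfa μ
    have h4 : ‖pathVector hfa hlc i μ'‖ * ‖ckGen μ''‖ ≤ 1 :=
      mul_le_one₀ h1 (norm_nonneg _) h2
    linarith
  intro μ _ hμ
  suffices h : ∃ ν ∈ E.image incl ∪ F.filter (fun f => f.rng = v), (minExt μ ν).Nonempty by
    obtain ⟨ν, hν, p, hp⟩ := h
    exact ⟨ν, hν, p, hp, Set.mem_univ _, Set.mem_univ _⟩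
  rcases Nat.eq_zero_or_pos (μ.d i) with h0 | hpos
  · obtain ⟨σ, rfl⟩ := exists_incl μ h0
    by_cases hH : σ.src ∈ katsuraVertices hfa hlc i
    · obtain ⟨f, hf, hfd⟩ := exists_edge_of_mem_katsuraVertices hfa hlc hH
      have hs : (incl σ).src = f.rng := hf.symm
      obtain ⟨ν, hν, hne⟩ := key ((incl σ).comp f hs) (by rw [Path.comp_rng, hμ])
        (by rw [Path.comp_d, hfd]; simp)
      obtain ⟨κ, h₁, h₂⟩ := minExt_nonempty_iff.1 hne
      exact ⟨ν, hν, minExt_nonempty_iff.2 ⟨κ, (Path.isPrefix_comp _ _ hs).trans h₁, h₂⟩⟩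
    · obtain ⟨ν, hν, p, hp, -⟩ := hE.2.2 σ hH hμ
      refine ⟨incl ν, Finset.mem_union_left _ (Finset.mem_image_of_mem _ hν), ?_⟩
      rw [minExt_incl]
      exact ⟨_, p, hp, rfl⟩
  · exact key μ hμ hpos

end

end HigherRankGraph

theorem mainTheorem5 {k : ℕ} (Λ : HigherRankGraph.{u} (Fin k))
    (hfa : Λ.FinitelyAligned) (hlc : Λ.LocallyConvex) (i : Fin k)
    (v : (Λ.deleteColour i).Obj) (E : Finset (Λ.deleteColour i).Path)
    (hE : (Λ.deleteColour i).IsFEIn (HigherRankGraph.remainingPaths hfa hlc i) v E)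
    (hEdges : ∀ μ ∈ E, ∃ j : Fin k, (HigherRankGraph.incl μ).d = Pi.single j 1) :
    (HigherRankGraph.gap HigherRankGraph.ckGen v E ∈
        (HigherRankGraph.edgeBimodule hfa hlc i).katsuraIdeal ↔
      ∃ F : Finset Λ.Path, (∀ f ∈ F, f.rng = v ∧ f.d = Pi.single i 1) ∧
        Λ.IsFE v (E.image HigherRankGraph.incl ∪ F)) ∧
    ∀ F : Finset Λ.Path, (∀ f ∈ F, f.rng = v ∧ f.d = Pi.single i 1) →
      Λ.IsFE v (E.image HigherRankGraph.incl ∪ F) →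
      (HigherRankGraph.edgeBimodule hfa hlc i).leftAction
          (HigherRankGraph.gap HigherRankGraph.ckGen v E) =
        ∑ G ∈ (E.image HigherRankGraph.incl ∪ F).powerset with (G ∩ F).Nonempty,
          ∑ᶠ μ ∈ HigherRankGraph.mce G, (-1 : ℂ) ^ (G.card + 1) •
            (HigherRankGraph.edgeBimodule hfa hlc i).theta
              (HigherRankGraph.pathVector hfa hlc i μ) (HigherRankGraph.pathVector hfa hlc i μ) ∧
      (HigherRankGraph.edgeBimodule hfa hlc i).leftAction
          (HigherRankGraph.gap HigherRankGraph.ckGen v E) ∈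
        (HigherRankGraph.edgeBimodule hfa hlc i).compacts := by
  refine ⟨⟨fun h => HigherRankGraph.exists_isFE_of_leftAction_mem_compacts hfa hlc hE h.1, ?_⟩,
    fun F hF hEF => ⟨HigherRankGraph.leftAction_gap_eq_sum hfa hlc hF hEF,
      HigherRankGraph.leftAction_gap_mem_compacts hfa hlc hF hEF⟩⟩
  rintro ⟨F, hF, hEF⟩
  exact ⟨HigherRankGraph.leftAction_gap_mem_compacts hfa hlc hF hEF,
    fun b hb => HigherRankGraph.gap_mul_eq_zero hfa hlc hF hEF hb⟩
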